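/- **Conventions.** Models of subsystems of second order arithmetic are structures $\mathcal M=(M,\mathcal S,+,\cdot,0,1,<)$ with $\mathcal S\subseteq\mathcal P(M)$, over which the set variables range; "over $T$" means in every model of $T$ (equivalently, provably in $T$), and all notions below are understood inside the model. Pairs are coded by $\langle x,y\rangle=(x+y)^2+x$. A $\Pi^1_1$ formula is one of the form $\forall X\,\theta$ with $\theta$ arithmetical. A *countable second countable space* (CSCS) is a triple $(X,(U_i)_{i\in\mathbb N},k)$, where $X\subseteq\mathbb N$, $(U_i)_{i\in\mathbb N}$ is a sequence of subsets of $X$ covering $X$, and $k:X\times\mathbb N\times\mathbb N\to\mathbb N$ is a function such that $x\in U_i\cap U_j$ implies $x\in U_{k(x,i,j)}\subseteq U_i\cap U_j$. A set $G\subseteq X$ is *open* if for each $x\in G$ there is $i$ with $x\in U_i\subseteq G$. The space is *connected* if $A\cap B\neq\emptyset$ for any nonempty open sets $A,B$ with $X=A\cup B$. A linear order is a *well order* if it has no infinite strictly descending sequence. **Theorem.** 1. Over $\mathsf{ACA}_0$, being a connected CSCS is a $\Pi^1_1$-universal property. That is: (a) there is a $\Pi^1_1$ formula $\varphi(X,U,k)$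 that is equivalent over $\mathsf{ACA}_0$ to "$(X,(U_i)_i,k)$ is a connected CSCS"; and (b) for every $\Pi^1_1$ formula $\psi(\vec n,\vec Z)$ there are arithmetical formulas $\theta_X,\theta_U,\theta_k$ such that over $\mathsf{ACA}_0$, for all parameters $\vec n,\vec Z$, the sets $X,U,k$ that they define from $\vec n,\vec Z$ form a CSCS, and this CSCS is connected if and only if $\psi(\vec n,\vec Z)$ holds. 2. Over $\mathsf{ACA}_0$, let $(L,<_L)$ be a linear order with a least element. For $l\in L$ let $V_l$ be the smallest subset of $L$ that contains $l$, is closed downwards, and is closed under immediate successors when they exist. Let $\mathrm{Top}(L)$ be the topology on $L$ generated by the sets $V_l$ $(l\in L)$ and the rays $]a,+\infty[$ $(a\in L)$. Then there is a CSCS with set of points $L$ whose topology is $\mathrm{Top}(L)$, and any such CSCS is connected if and only if $(L,<_L)$ is a well order. 3. Over $\mathsf{RCA}_0$, the following are equivalent (this answers Chan's question positively): (i) $\Pi^1_1$ comprehension; (ii) for every sequence $\big((X^j,(U^j_i)_{i\in\mathbb N},k^j)\big)_{j\in\mathbb N}$ of CSCS, the set $\{j\in\mathbb N: X^j\text{ is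 connected}\}$ exists. -/

import Mathlib

universe u

namespace SOA

/-! ### The language of second order arithmetic and its structures -/

/-- Numerical terms of second order arithmetic. Number variables are de Bruijn indices. -/
inductive Term : Type
  | var (n : ℕ)
  | zero
  | one
  | add (s t : Term)
  | mul (s t : Term)

/-- Increase every variable of a term by one (so that the fresh index `0` does not occur). -/
def Term.shift : Term → Term
  | .var n => .var (n + 1)
  | .zero => .zero
  | .one => .one
  | .add s t => .add s.shift t.shift
  | .mul s t => .mul s.shift t.shift

/-- Formulas of second order arithmetic, with two separate families of de Bruijn indices:
`all` binds the number variable `0`, and `allSet` binds the set variable `0`. -/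
inductive Formula : Type
  | eq (s t : Term)
  | lt (s t : Term)
  | mem (t : Term) (X : ℕ)
  | neg (φ : Formula)
  | imp (φ ψ : Formula)
  | all (φ : Formula)
  | allSet (φ : Formula)

/-- The existential number quantifier. -/
def Formula.ex (φ : Formula) : Formula := .neg (.all (.neg φ))

/-- Bounded (`Σ⁰₀`) formulas: every quantifier is a number quantifier `∀ x < t`
with `x` not in `t` (and so, by negation, `∃ x < t`). -/
inductive IsBounded : Formula → Prop
  | eq (s t : Term) : IsBounded (.eq s t)
  | lt (s t : Term) : IsBounded (.lt s t)
  | mem (t : Term) (X : ℕ) : IsBounded (.mem t X)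
  | neg {φ : Formula} : IsBounded φ → IsBounded (.neg φ)
  | imp {φ ψ : Formula} : IsBounded φ → IsBounded ψ → IsBounded (.imp φ ψ)
  | ball (t : Term) {φ : Formula} : IsBounded φ →
      IsBounded (.all (.imp (.lt (.var 0) t.shift) φ))

/-- Arithmetical formulas: no set quantifiers (free set variables are allowed). -/
inductive IsArithmetical : Formula → Prop
  | eq (s t : Term) : IsArithmetical (.eq s t)
  | lt (s t : Term) : IsArithmetical (.lt s t)
  | mem (t : Term) (X : ℕ) : IsArithmetical (.mem t X)
  | neg {φ : Formula} : IsArithmetical φ → IsArithmetical (.neg φ)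
  | imp {φ ψ : Formula} : IsArithmetical φ → IsArithmetical ψ → IsArithmetical (.imp φ ψ)
  | all {φ : Formula} : IsArithmetical φ → IsArithmetical (.all φ)

/-- `Σ⁰₁` formulas `∃ x θ` with `θ` bounded. -/
def IsSigma01 (φ : Formula) : Prop := ∃ θ, IsBounded θ ∧ φ = .ex θ

/-- `Π⁰₁` formulas `∀ x θ` with `θ` bounded. -/
def IsPi01 (φ : Formula) : Prop := ∃ θ, IsBounded θ ∧ φ = .all θ

/-- `Π¹₁` formulas `∀ X θ` with `θ` arithmetical. -/
def IsPi11 (φ : Formula) : Prop := ∃ θ, IsArithmetical θ ∧ φ = .allSet θ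

/-- Structures for the language of second order arithmetic: a first order part, and a
collection of subsets of it, over which the set variables range. -/
structure Model where
  /-- the numbers of the structure -/
  Num : Type u
  zero : Num
  one : Num
  add : Num → Num → Num
  mul : Num → Num → Num
  lt : Num → Num → Prop
  /-- the sets of the structure -/
  sets : Set (Set Num)

/-- The value of a term under an assignment of the number variables. -/
def Term.eval (A : Model.{u}) (v : ℕ → A.Num) : Term → A.Num
  | .var n => v n
  | .zero => A.zero
  | .one => A.one
  | .add s t => A.add (s.eval A v) (t.eval A v)
  | .mul s t => A.mul (s.eval A v) (t.eval A v)

/-- Extend an assignment: index `0` gets the value `a` and the old indices move up by one. -/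
def push {α : Type u} (a : α) (v : ℕ → α) : ℕ → α
  | 0 => a
  | n + 1 => v n

/-- Satisfaction of a formula in a structure, under assignments `v` of the number variables
and `w` of the set variables. -/
def Formula.Sat (A : Model.{u}) : Formula → (ℕ → A.Num) → (ℕ → A.sets) → Prop
  | .eq s t, v, _ => s.eval A v = t.eval A v
  | .lt s t, v, _ => A.lt (s.eval A v) (t.eval A v)
  | .mem t X, v, w => t.eval A v ∈ (w X).1
  | .neg φ, v, w => ¬ φ.Sat A v w
  | .imp φ ψ, v, w => φ.Sat A v w → ψ.Sat A v w
  | .all φ, v, w => ∀ a : A.Num, φ.Sat A (push a v) w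
  | .allSet φ, v, w => ∀ Y : A.sets, φ.Sat A v (push Y w)

/-! ### The subsystems `RCA₀`, `ACA₀` and `Π¹₁-CA₀`

"Over the theory `T`" is rendered as "in every model of `T`"; by the completeness theorem for
(two-sorted) first order logic this is the same as provability from `T`. -/

namespace Model

/-- The basic axioms of arithmetic together with the induction axiom for sets (and, as always in
first order logic, a nonempty range for the set variables). -/
structure IsBasic (A : Model.{u}) : Prop where
  sets_nonempty : A.sets.Nonempty
  succ_ne_zero : ∀ m, A.add m A.one ≠ A.zero
  succ_inj : ∀ m n, A.add m A.one = A.add n A.one → m = n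
  add_zero : ∀ m, A.add m A.zero = m
  add_succ : ∀ m n, A.add m (A.add n A.one) = A.add (A.add m n) A.one
  mul_zero : ∀ m, A.mul m A.zero = A.zero
  mul_succ : ∀ m n, A.mul m (A.add n A.one) = A.add (A.mul m n) m
  not_lt_zero : ∀ m, ¬ A.lt m A.zero
  lt_succ : ∀ m n, A.lt m (A.add n A.one) ↔ A.lt m n ∨ m = n
  induction : ∀ X ∈ A.sets, A.zero ∈ X → (∀ n, n ∈ X → A.add n A.one ∈ X) → ∀ n, n ∈ X

/-- The comprehension scheme for a class `Γ` of formulas, with arbitrary parameters: the set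
`{n | φ(n)}` exists for every `φ` in `Γ`. -/
def Comprehension (A : Model.{u}) (Γ : Formula → Prop) : Prop :=
  ∀ φ, Γ φ → ∀ (v : ℕ → A.Num) (w : ℕ → A.sets), {n | φ.Sat A (push n v) w} ∈ A.sets

/-- The `Δ⁰₁` comprehension scheme. -/
def Delta01Comprehension (A : Model.{u}) : Prop :=
  ∀ φ ψ, IsSigma01 φ → IsPi01 ψ → ∀ (v : ℕ → A.Num) (w : ℕ → A.sets),
    (∀ n, φ.Sat A (push n v) w ↔ ψ.Sat A (push n v) w) → {n | φ.Sat A (push n v) w} ∈ A.sets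

/-- The `Σ⁰₁` induction scheme. -/
def Sigma01Induction (A : Model.{u}) : Prop :=
  ∀ φ, IsSigma01 φ → ∀ (v : ℕ → A.Num) (w : ℕ → A.sets),
    φ.Sat A (push A.zero v) w →
    (∀ n, φ.Sat A (push n v) w → φ.Sat A (push (A.add n A.one) v) w) →
    ∀ n, φ.Sat A (push n v) w

/-- `A` is a model of `RCA₀`. -/
structure IsRCA0 (A : Model.{u}) : Prop where
  basic : A.IsBasic
  sigma01Induction : A.Sigma01Induction
  delta01Comprehension : A.Delta01Comprehension

/-- `A` is a model of `ACA₀`. -/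
structure IsACA0 (A : Model.{u}) : Prop where
  basic : A.IsBasic
  comprehension : A.Comprehension IsArithmetical

/-- `A` is a model of `Π¹₁-CA₀`. -/
structure IsPi11CA0 (A : Model.{u}) : Prop where
  basic : A.IsBasic
  comprehension : A.Comprehension IsPi11

/-! ### Countable second countable spaces inside a structure -/

variable (A : Model.{u})

/-- The pairing `⟨x, y⟩ = (x + y)² + x`. -/
def pair (x y : A.Num) : A.Num := A.add (A.mul (A.add x y) (A.add x y)) x

/-- The `j`-th member `{x | ⟨j, x⟩ ∈ Y}` of the sequence of sets coded by `Y`. -/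
def sec (Y : Set A.Num) (j : A.Num) : Set A.Num := {x | A.pair j x ∈ Y}

/-- `K` codes a function `k` of three arguments: `k(x, i, j) = n` is `⟨⟨x, ⟨i, j⟩⟩, n⟩ ∈ K`. -/
def Val (K : Set A.Num) (x i j n : A.Num) : Prop := A.pair (A.pair x (A.pair i j)) n ∈ K

/-- `(X, (U_i)_i, k)` is a countable second countable space, where `U_i = sec U i` and `K` codes
the function `k : X × ℕ × ℕ → ℕ`. -/
structure IsCSCS (X U K : Set A.Num) : Prop where
  subset : ∀ i, A.sec U i ⊆ X
  cover : ∀ x ∈ X, ∃ i, x ∈ A.sec U i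
  total : ∀ x ∈ X, ∀ i j, ∃! n, A.Val K x i j n
  inter : ∀ x ∈ X, ∀ i j n, x ∈ A.sec U i → x ∈ A.sec U j → A.Val K x i j n →
    x ∈ A.sec U n ∧ A.sec U n ⊆ A.sec U i ∩ A.sec U j

/-- `G` is an open subset of the space with points `X` and basis `(U_i)_i`. -/
def IsOpenIn (X U G : Set A.Num) : Prop :=
  G ⊆ X ∧ ∀ x ∈ G, ∃ i, x ∈ A.sec U i ∧ A.sec U i ⊆ G

/-- The space with points `X` and basis `(U_i)_i` is connected, in the sense of the structure:
any two nonempty open sets (of the structure) that cover the space meet. -/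
def IsConnectedIn (X U : Set A.Num) : Prop :=
  ∀ G ∈ A.sets, ∀ H ∈ A.sets, A.IsOpenIn X U G → A.IsOpenIn X U H →
    G.Nonempty → H.Nonempty → G ∪ H = X → (G ∩ H).Nonempty

/-- For every sequence of countable second countable spaces, the set of the indices of the
connected ones exists. -/
def ConnectedIndexSets : Prop :=
  ∀ X ∈ A.sets, ∀ U ∈ A.sets, ∀ K ∈ A.sets,
    (∀ j, A.IsCSCS (A.sec X j) (A.sec U j) (A.sec K j)) →
    {j | A.IsConnectedIn (A.sec X j) (A.sec U j)} ∈ A.sets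

/-! ### Linear orders inside a structure and the topology `Top(L)` -/

/-- The relation coded by `R`. -/
def Rel (R : Set A.Num) (x y : A.Num) : Prop := A.pair x y ∈ R

/-- `R` codes a strict linear order of `L`. -/
structure IsLinOrd (L R : Set A.Num) : Prop where
  irrefl : ∀ x ∈ L, ¬ A.Rel R x x
  trans : ∀ x ∈ L, ∀ y ∈ L, ∀ z ∈ L, A.Rel R x y → A.Rel R y z → A.Rel R x z
  total : ∀ x ∈ L, ∀ y ∈ L, A.Rel R x y ∨ x = y ∨ A.Rel R y x

/-- `L` has a least element. -/
def HasLeast (L R : Set A.Num) : Prop := ∃ b ∈ L, ∀ x ∈ L, x = b ∨ A.Rel R b x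

/-- `R` codes a well order of `L`, in the sense of the structure: a linear order for which no
function `f : ℕ → L` of the structure (a set `F` of pairs `⟨n, f(n)⟩`) is strictly descending. -/
def IsWellOrd (L R : Set A.Num) : Prop :=
  A.IsLinOrd L R ∧
    ¬ ∃ F ∈ A.sets, (∀ n, ∃! x, A.pair n x ∈ F) ∧ (∀ n x, A.pair n x ∈ F → x ∈ L) ∧
      ∀ n x y, A.pair n x ∈ F → A.pair (A.add n A.one) y ∈ F → A.Rel R y x

/-- `y` is the immediate successor of `x` in `L`. -/
def IsSuccOf (L R : Set A.Num) (x y : A.Num) : Prop :=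
  y ∈ L ∧ A.Rel R x y ∧ ¬ ∃ z ∈ L, A.Rel R x z ∧ A.Rel R z y

/-- `V_l`: the smallest subset of `L` (among the sets of the structure) that contains `l`, is
closed downwards, and is closed under immediate successors when they exist. -/
def succClosure (L R : Set A.Num) (l : A.Num) : Set A.Num :=
  {x | x ∈ L ∧ ∀ Y ∈ A.sets, Y ⊆ L → l ∈ Y →
    (∀ y ∈ Y, ∀ z ∈ L, A.Rel R z y → z ∈ Y) →
    (∀ y ∈ Y, ∀ z, A.IsSuccOf L R y z → z ∈ Y) → x ∈ Y}

/-- The open ray `]a, +∞[` of `L`. -/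
def ray (L R : Set A.Num) (a : A.Num) : Set A.Num := {x | x ∈ L ∧ A.Rel R a x}

/-- The topology `Top(L)` on `L`, generated by the sets `V_l` and the rays `]a, +∞[`. -/
@[reducible] def topL (L R : Set A.Num) : TopologicalSpace L :=
  TopologicalSpace.generateFrom
    ({G | ∃ l ∈ L, G = Subtype.val ⁻¹' A.succClosure L R l} ∪
      {G | ∃ a ∈ L, G = Subtype.val ⁻¹' A.ray L R a})

/-- The countable second countable space `(X, (U_i)_i, k)` presents the topology `τ` on `X`:
`τ` is generated by the sets `U_i`. -/
def Presents (X U K : Set A.Num) (τ : TopologicalSpace X) : Prop :=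
  A.IsCSCS X U K ∧
    τ = TopologicalSpace.generateFrom {G | ∃ i, G = Subtype.val ⁻¹' A.sec U i}

/-- The set `{n | θ(n)}` defined by `θ` with parameters `v`, `w`. -/
def defSet (θ : Formula) (v : ℕ → A.Num) (w : ℕ → A.sets) : Set A.Num :=
  {n | θ.Sat A (push n v) w}

end Model

/-- Being a connected countable second countable space is `Π¹₁` over `ACA₀`: it is equivalent
there to a `Π¹₁` formula in the set variables `0`, `1`, `2` (for `X`, `U` and `k`). -/
def ConnectedIsPi11 : Prop :=
  ∃ φ, IsPi11 φ ∧ ∀ A : Model.{u}, A.IsACA0 → ∀ (v : ℕ → A.Num) (w : ℕ → A.sets),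
    (φ.Sat A v w ↔ A.IsCSCS (w 0).1 (w 1).1 (w 2).1 ∧ A.IsConnectedIn (w 0).1 (w 1).1)

/-- Every `Π¹₁` formula (with arbitrary number and set parameters) reduces, by an arithmetical
map and over `ACA₀`, to connectedness: a countable second countable space that is connected if
and only if the formula holds is defined arithmetically from the parameters. -/
def ConnectedIsPi11Hard : Prop :=
  ∀ ψ, IsPi11 ψ → ∃ θX θU θK, IsArithmetical θX ∧ IsArithmetical θU ∧ IsArithmetical θK ∧
    ∀ A : Model.{u}, A.IsACA0 → ∀ (v : ℕ → A.Num) (w : ℕ → A.sets),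
      A.IsCSCS (A.defSet θX v w) (A.defSet θU v w) (A.defSet θK v w) ∧
      (ψ.Sat A v w ↔ A.IsConnectedIn (A.defSet θX v w) (A.defSet θU v w))

end SOA

namespace SOA

/-! ### Substitution -/

/-! Well-foundedness is the link between `Π¹₁` truth and connectedness. A descending sequence in `L`
splits `Top(L)`: the points above some term form a union of rays, and the other points form a set
closed downwards and under immediate successors, hence a union of sets `V_l`. Conversely, let `L` be
a well order, `G` a nonempty open set with open complement that misses the least point, and `g` the
least point of `G`. A basic neighbourhood of `g` can avoid the points below `g` only through a ray
`]a, +∞[` where `g` is the immediate successor of `a`; but every neighbourhood of `a` contains this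
successor. In `ACA₀` all of this is available because `V_l` is arithmetical: `x > l` belongs to it
exactly if `]l, x]` is finite (`succClosure_eq_vset`).

For hardness, `∀ Y φ` has to become the well-foundedness of an arithmetical order. A counterexample
`Y` and a strategy recording the choices made in refuting `φ` are coded by one set `Z`. Correctness
of `Z` splits into requirements, each witnessed by a finite part of `Z` (`exists_not_sat_iff`).
Finite parts are compared by `Extends`, and the order consists of finite cliques of this relation,
ordered so that adding a larger element gives a smaller set. Sets without least element yield
unbounded cliques, and these glue to a set `Z` (`isWellOrd_nodes_iff`). The upper bound is easier: a
disconnection is a single set with an arithmetical property.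

In the reversal, index sets must first yield `ACA₀` over `RCA₀`. Take two isolated points `0` and
`1`, and for each witness `y` of `∃ y, Q y j` a point whose neighbourhoods contain both; this space
is connected exactly if a witness exists (`ConnectedIndexSets.exists_mem_sets`). So projections of
boundedly definable relations exist as sets, and number quantifiers can be absorbed one at a time
into set parameters (`ConnectedIndexSets.bounded_sat`). Then the hardness reduction, applied
uniformly in `n`, gives `Π¹₁` comprehension.

All definability claims go through the classes `T`, `D` and `DS`, so that instance search builds the
formulas. -/

/-- Substitution of terms for the number variables of a term. -/
def Term.subst (s : ℕ → Term) : Term → Term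
  | .var n => s n
  | .zero => .zero
  | .one => .one
  | .add a b => .add (a.subst s) (b.subst s)
  | .mul a b => .mul (a.subst s) (b.subst s)

/-- The substitution `s` under a number quantifier. -/
def liftSubst (s : ℕ → Term) : ℕ → Term
  | 0 => .var 0
  | n + 1 => (s n).shift

/-- The renaming `g` under a set quantifier. -/
def liftRen (g : ℕ → ℕ) : ℕ → ℕ
  | 0 => 0
  | n + 1 => g n + 1

/-- Simultaneous substitution of terms for number variables and renaming of set variables. -/
def Formula.subst : Formula → (ℕ → Term) → (ℕ → ℕ) → Formula
  | .eq a b, s, _ => .eq (a.subst s) (b.subst s)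
  | .lt a b, s, _ => .lt (a.subst s) (b.subst s)
  | .mem t X, s, g => .mem (t.subst s) (g X)
  | .neg φ, s, g => .neg (φ.subst s g)
  | .imp φ ψ, s, g => .imp (φ.subst s g) (ψ.subst s g)
  | .all φ, s, g => .all (φ.subst (liftSubst s) g)
  | .allSet φ, s, g => .allSet (φ.subst s (liftRen g))

theorem Term.eval_shift (A : Model.{u}) (t : Term) (v : ℕ → A.Num) (a : A.Num) :
    t.shift.eval A (push a v) = t.eval A v := by
  induction t <;> simp_all [Term.shift, Term.eval, push]

theorem Term.eval_subst (A : Model.{u}) (t : Term) (s : ℕ → Term) (v : ℕ → A.Num) :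
    (t.subst s).eval A v = t.eval A (fun n => (s n).eval A v) := by
  induction t <;> simp_all [Term.subst, Term.eval]

theorem eval_liftSubst (A : Model.{u}) (s : ℕ → Term) (v : ℕ → A.Num) (a : A.Num) :
    (fun n => (liftSubst s n).eval A (push a v)) = push a (fun n => (s n).eval A v) := by
  funext n
  cases n <;> simp [liftSubst, Term.eval, push, Term.eval_shift]

theorem push_comp_liftRen {α : Type u} (g : ℕ → ℕ) (w : ℕ → α) (a : α) :
    (fun n => push a w (liftRen g n)) = push a (fun n => w (g n)) := by
  funext n
  cases n <;> simp [liftRen, push]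

theorem Formula.sat_subst (A : Model.{u}) (φ : Formula) (s : ℕ → Term) (g : ℕ → ℕ)
    (v : ℕ → A.Num) (w : ℕ → A.sets) :
    (φ.subst s g).Sat A v w ↔ φ.Sat A (fun n => (s n).eval A v) (fun n => w (g n)) := by
  induction φ generalizing s g v w with
  | eq | lt | mem => simp [Formula.subst, Formula.Sat, Term.eval_subst]
  | neg φ ih => simp [Formula.subst, Formula.Sat, ih]
  | imp φ ψ ih1 ih2 => simp [Formula.subst, Formula.Sat, ih1, ih2]
  | all φ ih => simp [Formula.subst, Formula.Sat, ih, eval_liftSubst]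
  | allSet φ ih => simp [Formula.subst, Formula.Sat, ih, push_comp_liftRen]

/-- Ensures that the bound of a bounded quantifier is still a shifted term after substitution, so
that bounded formulas are closed under substitution. -/
theorem Term.shift_subst (t : Term) (s : ℕ → Term) :
    t.shift.subst (liftSubst s) = (t.subst s).shift := by
  induction t <;> simp_all [Term.shift, Term.subst, liftSubst]

/-- Classes of formulas that contain the atomic formulas and are closed under negation,
implication and substitution. -/
class FormulaClass (Γ : Formula → Prop) : Prop where
  eq : ∀ s t, Γ (.eq s t)
  lt : ∀ s t, Γ (.lt s t)
  mem : ∀ t X, Γ (.mem t X)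
  neg : ∀ {φ}, Γ φ → Γ (.neg φ)
  imp : ∀ {φ ψ}, Γ φ → Γ ψ → Γ (.imp φ ψ)
  subst : ∀ {φ} (s : ℕ → Term) (g : ℕ → ℕ), Γ φ → Γ (φ.subst s g)

instance : FormulaClass IsBounded where
  eq := .eq
  lt := .lt
  mem := .mem
  neg := .neg
  imp := .imp
  subst {φ} s g h := by
    induction h generalizing s g with
    | eq => exact .eq _ _
    | lt => exact .lt _ _
    | mem => exact .mem _ _
    | neg _ ih => exact .neg (ih s g)
    | imp _ _ ih1 ih2 => exact .imp (ih1 s g) (ih2 s g)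
    | ball t _ ih =>
      simp only [Formula.subst, Term.shift_subst]
      exact .ball _ (ih _ g)

instance : FormulaClass IsArithmetical where
  eq := .eq
  lt := .lt
  mem := .mem
  neg := .neg
  imp := .imp
  subst {φ} s g h := by
    induction h generalizing s g with
    | eq => exact .eq _ _
    | lt => exact .lt _ _
    | mem => exact .mem _ _
    | neg _ ih => exact .neg (ih s g)
    | imp _ _ ih1 ih2 => exact .imp (ih1 s g) (ih2 s g)
    | all _ ih => exact .all (ih _ g)

theorem IsBounded.isArithmetical {φ : Formula} (h : IsBounded φ) : IsArithmetical φ := by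
  induction h with
  | eq => exact .eq _ _
  | lt => exact .lt _ _
  | mem => exact .mem _ _
  | neg _ ih => exact .neg ih
  | imp _ _ ih1 ih2 => exact .imp ih1 ih2
  | ball t _ ih => exact .all (.imp (.lt _ _) ih)

/-! ### Uniform definability over a family of structures -/

/-- A family of structures, with the number and set parameters (depending on the member of the
family) that may be used in definitions. -/
structure Sig where
  I : Type (u + 1)
  M : I → Model.{u}
  C : (∀ i, (M i).Num) → Prop
  S : (∀ i, (M i).sets) → Prop
  exists_S : ∃ X, S X

namespace Sig

/-- Families of functions of the number variables. -/
abbrev Fn (σ : Sig.{u}) := ∀ i, (ℕ → (σ.M i).Num) → (σ.M i).Num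

/-- Families of relations of the number variables. -/
abbrev Pred (σ : Sig.{u}) := ∀ i, (ℕ → (σ.M i).Num) → Prop

/-- Families of sets depending on the number variables. -/
abbrev SetFn (σ : Sig.{u}) := ∀ i, (ℕ → (σ.M i).Num) → Set (σ.M i).Num

/-- Variables and parameters. -/
def Var (σ : Sig.{u}) (x : σ.Fn) : Prop :=
  (∃ k, x = fun _ v => v k) ∨ ∃ c, σ.C c ∧ x = fun i _ => c i

/-- `t` is the value of a term in variables and parameters. -/
class T (σ : Sig.{u}) (t : σ.Fn) : Prop where
  out : ∃ (τ : Term) (x : ℕ → σ.Fn), (∀ j, σ.Var (x j)) ∧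
    ∀ i v, t i v = τ.eval (σ.M i) (fun j => x j i v)

/-- `P` is defined by a formula in `Γ`, with parameters. -/
class D (σ : Sig.{u}) (Γ : Formula → Prop) (P : σ.Pred) : Prop where
  out : ∃ φ, Γ φ ∧ ∃ (x : ℕ → σ.Fn) (w : ℕ → ∀ i, (σ.M i).sets), (∀ j, σ.Var (x j)) ∧
    (∀ j, σ.S (w j)) ∧ ∀ i v, P i v ↔ φ.Sat (σ.M i) (fun j => x j i v) (fun j => w j i)

/-- Membership in `X` is defined by a formula in `Γ`, with parameters. -/
class DS (σ : Sig.{u}) (Γ : Formula → Prop) (X : σ.SetFn) : Prop where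
  out : σ.D Γ (fun i v => v 0 ∈ X i (fun k => v (k + 1)))

variable {σ : Sig.{u}} {Γ : Formula → Prop}

theorem Var.comp {x : σ.Fn} (hx : σ.Var x) {g : ∀ i, (ℕ → (σ.M i).Num) → ℕ → (σ.M i).Num}
    (hg : ∀ k, σ.T (fun i v => g i v k)) : σ.T (fun i v => x i (g i v)) := by
  rcases hx with ⟨k, rfl⟩ | ⟨c, hc, rfl⟩
  · exact hg k
  · exact ⟨.var 0, fun _ i _ => c i, fun _ => .inr ⟨c, hc, rfl⟩, fun _ _ => rfl⟩

instance T.var (k : ℕ) : σ.T (fun _ v => v k) :=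
  ⟨.var 0, fun _ _ v => v k, fun _ => .inl ⟨k, rfl⟩, fun _ _ => rfl⟩

theorem T.const {c : ∀ i, (σ.M i).Num} (hc : σ.C c) : σ.T (fun i _ => c i) :=
  ⟨.var 0, fun _ i _ => c i, fun _ => .inr ⟨c, hc, rfl⟩, fun _ _ => rfl⟩

instance T.zero : σ.T (fun i _ => (σ.M i).zero) :=
  ⟨.zero, fun _ _ v => v 0, fun _ => .inl ⟨0, rfl⟩, fun _ _ => rfl⟩

instance T.one : σ.T (fun i _ => (σ.M i).one) :=
  ⟨.one, fun _ _ v => v 0, fun _ => .inl ⟨0, rfl⟩, fun _ _ => rfl⟩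

/-- Countably many term functions have a common sequence of variables and parameters. -/
theorem exists_terms {t : ℕ → σ.Fn} (ht : ∀ j, σ.T (t j)) :
    ∃ (τ : ℕ → Term) (x : ℕ → σ.Fn), (∀ j, σ.Var (x j)) ∧
      ∀ j i v, t j i v = (τ j).eval (σ.M i) (fun k => x k i v) := by
  choose τ x hx h using fun j => (ht j).out
  -- The `j`-th term receives its own block of variables, the indices `Nat.pair j k`.
  refine ⟨fun j => (τ j).subst fun k => .var (Nat.pair j k),
    fun n => x n.unpair.1 n.unpair.2, fun n => hx _ _, fun j i v => ?_⟩
  rw [h, Term.eval_subst]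
  simp [Term.eval]

theorem T.of_eval (τ : Term) {t : ℕ → σ.Fn} (ht : ∀ j, σ.T (t j)) :
    σ.T (fun i v => τ.eval (σ.M i) (fun j => t j i v)) := by
  obtain ⟨τ', x, hx, h⟩ := exists_terms ht
  refine ⟨τ.subst τ', x, hx, fun i v => ?_⟩
  simp [h, Term.eval_subst]

instance T.add {s t : σ.Fn} [hs : σ.T s] [ht : σ.T t] :
    σ.T (fun i v => (σ.M i).add (s i v) (t i v)) :=
  T.of_eval (.add (.var 0) (.var 1)) (t := fun j => if j = 0 then s else t)
    (fun j => by split <;> assumption)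

instance T.mul {s t : σ.Fn} [hs : σ.T s] [ht : σ.T t] :
    σ.T (fun i v => (σ.M i).mul (s i v) (t i v)) :=
  T.of_eval (.mul (.var 0) (.var 1)) (t := fun j => if j = 0 then s else t)
    (fun j => by split <;> assumption)

instance T.pair {s t : σ.Fn} [hs : σ.T s] [ht : σ.T t] :
    σ.T (fun i v => (σ.M i).pair (s i v) (t i v)) := by
  unfold Model.pair
  infer_instance

theorem T.comp {t : σ.Fn} (ht : σ.T t) {g : ∀ i, (ℕ → (σ.M i).Num) → ℕ → (σ.M i).Num}
    (hg : ∀ k, σ.T (fun i v => g i v k)) : σ.T (fun i v => t i (g i v)) := by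
  obtain ⟨τ, x, hx, h⟩ := ht.out
  simp only [h]
  exact T.of_eval τ (t := fun j i v => x j i (g i v)) fun j => (hx j).comp hg

theorem T.push {a : σ.Fn} {f : ∀ i, (ℕ → (σ.M i).Num) → ℕ → (σ.M i).Num}
    (ha : σ.T a) (hf : ∀ k, σ.T (fun i v => f i v k)) (k : ℕ) :
    σ.T (fun i v => push (a i v) (f i v) k) := by
  cases k with
  | zero => exact ha
  | succ k => exact hf k

theorem D.congr {P Q : σ.Pred} (h : σ.D Γ P) (hPQ : ∀ i v, Q i v ↔ P i v) : σ.D Γ Q := by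
  have : Q = P := by funext i v; exact propext (hPQ i v)
  rwa [this]

theorem D.of_sat [hΓ : FormulaClass Γ] {φ : Formula} (hφ : Γ φ) {t : ℕ → σ.Fn}
    (ht : ∀ j, σ.T (t j)) {w : ℕ → ∀ i, (σ.M i).sets} (hw : ∀ j, σ.S (w j)) :
    σ.D Γ (fun i v => φ.Sat (σ.M i) (fun j => t j i v) (fun j => w j i)) := by
  obtain ⟨τ, x, hx, h⟩ := exists_terms ht
  refine ⟨φ.subst τ id, hΓ.subst _ _ hφ, x, w, hx, hw, fun i v => ?_⟩
  simp [h, Formula.sat_subst]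

theorem D.comp [FormulaClass Γ] {P : σ.Pred} (hP : σ.D Γ P)
    {g : ∀ i, (ℕ → (σ.M i).Num) → ℕ → (σ.M i).Num}
    (hg : ∀ k, σ.T (fun i v => g i v k)) : σ.D Γ (fun i v => P i (g i v)) := by
  obtain ⟨φ, hφ, x, w, hx, hw, h⟩ := hP.out
  exact (D.of_sat hφ (t := fun j i v => x j i (g i v)) (fun j => (hx j).comp hg) hw).congr
    fun i v => h i _

section
variable [hΓ : FormulaClass Γ]

instance D.eq {s t : σ.Fn} [hs : σ.T s] [ht : σ.T t] : σ.D Γ (fun i v => s i v = t i v) := by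
  -- Satisfaction needs values for the set variables even if the formula has none; this is the
  -- purpose of `exists_S`.
  obtain ⟨X, hX⟩ := σ.exists_S
  exact D.of_sat (hΓ.eq (.var 0) (.var 1)) (t := fun j => if j = 0 then s else t)
    (fun j => by split <;> assumption) (w := fun _ => X) fun _ => hX

instance D.lt {s t : σ.Fn} [hs : σ.T s] [ht : σ.T t] :
    σ.D Γ (fun i v => (σ.M i).lt (s i v) (t i v)) := by
  obtain ⟨X, hX⟩ := σ.exists_S
  exact D.of_sat (hΓ.lt (.var 0) (.var 1)) (t := fun j => if j = 0 then s else t)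
    (fun j => by split <;> assumption) (w := fun _ => X) fun _ => hX

theorem DS.set {X : ∀ i, (σ.M i).sets} (hX : σ.S X) : σ.DS Γ (fun i _ => (X i).1) :=
  ⟨D.of_sat (hΓ.mem (.var 0) 0) (t := fun _ _ v => v 0) (fun _ => inferInstance)
    (w := fun _ => X) fun _ => hX⟩

instance D.neg {P : σ.Pred} [hP : σ.D Γ P] : σ.D Γ (fun i v => ¬ P i v) := by
  obtain ⟨φ, hφ, x, w, hx, hw, h⟩ := hP.out
  exact ⟨.neg φ, hΓ.neg hφ, x, w, hx, hw, fun i v => not_congr (h i v)⟩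

instance D.imp {P Q : σ.Pred} [hP : σ.D Γ P] [hQ : σ.D Γ Q] :
    σ.D Γ (fun i v => P i v → Q i v) := by
  obtain ⟨φ, hφ, x, w, hx, hw, h⟩ := hP.out
  obtain ⟨ψ, hψ, y, z, hy, hz, h'⟩ := hQ.out
  -- The two parameter lists are interleaved: even indices for the premise, odd ones for the
  -- conclusion.
  refine ⟨.imp (φ.subst (fun j => .var (2 * j)) (fun j => 2 * j))
    (ψ.subst (fun j => .var (2 * j + 1)) (fun j => 2 * j + 1)),
    hΓ.imp (hΓ.subst _ _ hφ) (hΓ.subst _ _ hψ),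
    fun n => if n % 2 = 0 then x (n / 2) else y (n / 2),
    fun n => if n % 2 = 0 then w (n / 2) else z (n / 2), ?_, ?_, fun i v => ?_⟩
  · intro j; dsimp only; split
    exacts [hx _, hy _]
  · intro j; dsimp only; split
    exacts [hw _, hz _]
  · have e : ∀ j, (2 * j + 1) / 2 = j := by omega
    have e' : ∀ j, (2 * j + 1) % 2 ≠ 0 := by omega
    simp [Formula.Sat, Formula.sat_subst, Term.eval, h, h', e]

instance D.and {P Q : σ.Pred} [hP : σ.D Γ P] [hQ : σ.D Γ Q] :
    σ.D Γ (fun i v => P i v ∧ Q i v) :=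
  D.congr (P := fun i v => ¬ (P i v → ¬ Q i v)) inferInstance fun i v => by tauto

instance D.or {P Q : σ.Pred} [hP : σ.D Γ P] [hQ : σ.D Γ Q] :
    σ.D Γ (fun i v => P i v ∨ Q i v) :=
  D.congr (P := fun i v => ¬ P i v → Q i v) inferInstance fun i v => by tauto

instance D.iff {P Q : σ.Pred} [hP : σ.D Γ P] [hQ : σ.D Γ Q] :
    σ.D Γ (fun i v => P i v ↔ Q i v) :=
  D.congr (P := fun i v => (P i v → Q i v) ∧ (Q i v → P i v)) inferInstance
    fun i v => by tauto

instance D.const (p : Prop) : σ.D Γ (fun _ _ => p) := by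
  by_cases hp : p
  · exact D.congr (P := fun i v => v 0 = v 0) inferInstance fun i v => by simp [hp]
  · exact D.congr (P := fun i v => ¬ v 0 = v 0) inferInstance fun i v => by simp [hp]

instance D.mem {t : σ.Fn} {X : σ.SetFn} [ht : σ.T t] [hX : σ.DS Γ X] :
    σ.D Γ (fun i v => t i v ∈ X i v) :=
  hX.out.comp (g := fun i v => SOA.push (t i v) v) (T.push ht fun k => T.var k)

instance DS.setOf {P : ∀ i, (ℕ → (σ.M i).Num) → (σ.M i).Num → Prop}
    [hP : σ.D Γ (fun i v => P i (fun k => v (k + 1)) (v 0))] :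
    σ.DS Γ (fun i v => {x | P i v x}) := ⟨hP⟩

theorem DS.comp {X : σ.SetFn} (hX : σ.DS Γ X)
    {g : ∀ i, (ℕ → (σ.M i).Num) → ℕ → (σ.M i).Num}
    (hg : ∀ k, σ.T (fun i v => g i v k)) : σ.DS Γ (fun i v => X i (g i v)) :=
  ⟨hX.out.comp (g := fun i v => SOA.push (v 0) (g i fun k => v (k + 1)))
    (T.push (T.var 0) fun k => (hg k).comp fun _ => T.var _)⟩

instance DS.sec {Y : σ.SetFn} {j : σ.Fn} [hY : σ.DS Γ Y] [hj : σ.T j] :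
    σ.DS Γ (fun i v => (σ.M i).sec (Y i v) (j i v)) := by
  have h1 : σ.DS Γ (fun i v => Y i (fun k => v (k + 1))) := hY.comp fun _ => T.var _
  have h2 : σ.T (fun i v => j i (fun k => v (k + 1))) := hj.comp fun _ => T.var _
  unfold Model.sec
  infer_instance

end

/-- Under a new binder a parameter function either reads the bound variable or ignores it. This case
distinction translates functional quantification into de Bruijn indices. -/
theorem Var.push {x : σ.Fn} (hx : σ.Var x) : ∃ (b : Bool) (x' : σ.Fn), σ.Var x' ∧
    ∀ i v a, x i (SOA.push a v) = if b then a else x' i v := by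
  rcases hx with ⟨k, rfl⟩ | ⟨c, hc, rfl⟩
  · cases k with
    | zero => exact ⟨true, fun _ v => v 0, .inl ⟨0, rfl⟩, fun _ _ _ => rfl⟩
    | succ k => exact ⟨false, fun _ v => v k, .inl ⟨k, rfl⟩, fun _ _ _ => rfl⟩
  · exact ⟨false, fun i _ => c i, .inr ⟨c, hc, rfl⟩, fun _ _ _ => rfl⟩

instance D.all {Q : ∀ i, (ℕ → (σ.M i).Num) → (σ.M i).Num → Prop}
    [hQ : σ.D IsArithmetical (fun i v => Q i (fun k => v (k + 1)) (v 0))] :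
    σ.D IsArithmetical (fun i v => ∀ a, Q i v a) := by
  obtain ⟨φ, hφ, x, w, hx, hw, h⟩ := hQ.out
  choose b x' hx' e using fun j => (hx j).push
  refine ⟨.all (φ.subst (fun j => if b j then .var 0 else .var (j + 1)) id),
    .all (FormulaClass.subst _ _ hφ), x', w, hx', hw, fun i v => ?_⟩
  simp only [Formula.Sat, Formula.sat_subst]
  refine forall_congr' fun a => ?_
  have := h i (SOA.push a v)
  simp only [SOA.push] at this
  rw [this]
  simp only [e]
  refine iff_of_eq (congrArg₂ _ (funext fun j => ?_) rfl)
  cases b j <;> rfl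

instance D.ex {Q : ∀ i, (ℕ → (σ.M i).Num) → (σ.M i).Num → Prop}
    [hQ : σ.D IsArithmetical (fun i v => Q i (fun k => v (k + 1)) (v 0))] :
    σ.D IsArithmetical (fun i v => ∃ a, Q i v a) :=
  D.congr (P := fun i v => ¬ ∀ a, ¬ Q i v a) inferInstance fun i v => by simp

instance D.bounded_all {Q : ∀ i, (ℕ → (σ.M i).Num) → (σ.M i).Num → Prop} {t : σ.Fn}
    [ht : σ.T t] [hQ : σ.D IsBounded (fun i v => Q i (fun k => v (k + 1)) (v 0))] :
    σ.D IsBounded (fun i v => ∀ a, (σ.M i).lt a (t i v) → Q i v a) := by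
  obtain ⟨φ, hφ, x, w, hx, hw, h⟩ := hQ.out
  obtain ⟨τ, y, hy, h'⟩ := ht.out
  choose b x' hx' e using fun j => (hx j).push
  -- The bound uses the even indices and the matrix the odd ones; the last `+ 1` passes the new
  -- binder.
  refine ⟨.all (.imp (.lt (.var 0) (τ.subst fun j => .var (2 * j)).shift)
      (φ.subst (fun j => if b j then .var 0 else .var (2 * j + 1 + 1)) id)),
    .ball _ (FormulaClass.subst _ _ hφ),
    fun n => if n % 2 = 0 then y (n / 2) else x' (n / 2), w, ?_, hw, fun i v => ?_⟩
  · intro j; dsimp only; split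
    exacts [hy _, hx' _]
  · simp only [Formula.Sat, Formula.sat_subst, Term.eval_shift, Term.eval_subst]
    refine forall_congr' fun a => imp_congr ?_ ?_
    · simp [Term.eval, SOA.push, h']
    · have := h i (SOA.push a v)
      simp only [SOA.push] at this
      rw [this]
      simp only [e]
      refine iff_of_eq (congrArg₂ _ (funext fun j => ?_) rfl)
      have e' : (2 * j + 1) / 2 = j := by omega
      cases hb : b j <;> simp [Term.eval, SOA.push, e']

instance D.bounded_ex {Q : ∀ i, (ℕ → (σ.M i).Num) → (σ.M i).Num → Prop} {t : σ.Fn}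
    [ht : σ.T t] [hQ : σ.D IsBounded (fun i v => Q i (fun k => v (k + 1)) (v 0))] :
    σ.D IsBounded (fun i v => ∃ a, (σ.M i).lt a (t i v) ∧ Q i v a) :=
  D.congr (P := fun i v => ¬ ∀ a, (σ.M i).lt a (t i v) → ¬ Q i v a) inferInstance
    fun i v => by simp

end Sig

/-! ### Two families of structures -/

/-- A single structure, with arbitrary parameters. -/
@[reducible] def fixSig (A : Model.{u}) (hA : A.sets.Nonempty) : Sig.{u} where
  I := PUnit
  M := fun _ => A
  C := fun _ => True
  S := fun _ => True
  exists_S := ⟨fun _ => ⟨_, hA.choose_spec⟩, trivial⟩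

instance Sig.T.fix_const {A : Model.{u}} {hA : A.sets.Nonempty} (c : A.Num) :
    (fixSig A hA).T (fun _ _ => c) := T.const (σ := fixSig A hA) (c := fun _ => c) trivial

theorem Sig.DS.fix_const {A : Model.{u}} {hA : A.sets.Nonempty} {Γ : Formula → Prop}
    [FormulaClass Γ] {X : Set A.Num} (hX : X ∈ A.sets) :
    (fixSig A hA).DS Γ (fun _ _ => X) :=
  DS.set (σ := fixSig A hA) (X := fun _ => ⟨X, hX⟩) trivial

instance {A : Model.{u}} {hA : A.sets.Nonempty} {Γ : Formula → Prop} [FormulaClass Γ]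
    {X : Set A.Num} [hX : Fact (X ∈ A.sets)] : (fixSig A hA).DS Γ (fun _ _ => X) :=
  Sig.DS.fix_const hX.out

/-- The general way to obtain sets: definability of membership is left to instance search. Variables
other than the element itself do not matter, so they are set to zero. -/
theorem Model.Comprehension.mem_sets {A : Model.{u}} {Γ : Formula → Prop} [FormulaClass Γ]
    (h : A.Comprehension Γ) (hA : A.sets.Nonempty) {X : Set A.Num}
    (hX : (fixSig A hA).DS Γ (fun _ _ => X)) : X ∈ A.sets := by
  obtain ⟨φ, hφ, x, w, hx, -, hs⟩ := hX.out.out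
  choose b x' hx' e using fun j => (hx j).push
  have := h _ (FormulaClass.subst (fun j => if b j then .var 0 else .var (j + 1)) id hφ)
    (fun j => x' j ⟨⟩ fun _ => A.zero) (fun j => w j ⟨⟩)
  convert this using 1
  ext n
  have := hs ⟨⟩ (push n fun _ => A.zero)
  simp only [push] at this
  rw [this]
  simp only [e, Set.mem_ofPred_eq, Formula.sat_subst]
  refine iff_of_eq (congrArg₂ _ (funext fun j => ?_) rfl)
  cases b j <;> rfl

/-- A structure with an assignment of the variables. -/
structure Assignment where
  A : Model.{u}
  V : ℕ → A.Num
  W : ℕ → A.sets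

/-- All structures, with the values of the variables as parameters. -/
@[reducible] def uniSig : Sig.{u} where
  I := Assignment
  M := fun i => i.A
  C := fun c => ∃ k, c = fun i => i.V k
  S := fun X => ∃ k, X = fun i => i.W k
  exists_S := ⟨_, 0, rfl⟩

instance Sig.T.uni_const (k : ℕ) : uniSig.{u}.T (fun i _ => i.V k) :=
  T.const (σ := uniSig) ⟨k, rfl⟩

instance Sig.DS.uni_const {Γ : Formula → Prop} [FormulaClass Γ] (k : ℕ) :
    uniSig.{u}.DS Γ (fun i _ => (i.W k).1) :=
  DS.set (σ := uniSig) (X := fun i => i.W k) ⟨k, rfl⟩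

/-- When the free variables are evaluated by the assignment itself, each parameter is the value of
some variable, so all parameters can be renamed to variables and one formula serves all structures.
-/
theorem Sig.D.exists_formula {P : uniSig.{u}.Pred} (hP : uniSig.D IsArithmetical P) :
    ∃ φ, IsArithmetical φ ∧ ∀ (A : Model.{u}) V W,
      P ⟨A, V, W⟩ V ↔ φ.Sat A V W := by
  obtain ⟨φ, hφ, x, w, hx, hw, h⟩ := hP.out
  have : ∀ j, ∃ k, ∀ i : Assignment.{u}, x j i i.V = i.V k := by
    intro j
    rcases hx j with ⟨k, h⟩ | ⟨_, ⟨k, rfl⟩, h⟩ <;> exact ⟨k, fun i => by rw [h]⟩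
  choose r hr using this
  choose g hg using hw
  refine ⟨φ.subst (fun j => .var (r j)) g, FormulaClass.subst _ _ hφ, fun A V W => ?_⟩
  rw [h, Formula.sat_subst]
  refine iff_of_eq (congrArg₂ _ (funext fun j => ?_) (funext fun j => ?_))
  · exact hr j ⟨A, V, W⟩
  · rw [hg]

end SOA

namespace SOA

/-! ### Arithmetic in structures with bounded comprehension -/

namespace Model

/-- Structures with the basic axioms, the induction axiom and bounded comprehension. -/
class Ind (A : Model.{u}) : Prop where
  basic : A.IsBasic
  comp : A.Comprehension IsBounded

/-- Models of `ACA₀`. -/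
class ACA (A : Model.{u}) : Prop where
  out : A.IsACA0

instance (A : Model.{u}) [h : A.ACA] : A.Ind where
  basic := h.out.basic
  comp := fun φ hφ => h.out.comprehension φ hφ.isArithmetical

instance (A : Model.{u}) : Zero A.Num := ⟨A.zero⟩
instance (A : Model.{u}) : One A.Num := ⟨A.one⟩
instance (A : Model.{u}) : Add A.Num := ⟨A.add⟩
instance (A : Model.{u}) : Mul A.Num := ⟨A.mul⟩
instance (A : Model.{u}) : LT A.Num := ⟨A.lt⟩
instance (A : Model.{u}) : LE A.Num := ⟨fun a b => a < b ∨ a = b⟩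

end Model

namespace Sig
variable {σ : Sig.{u}} {Γ : Formula → Prop}

instance T.zero' : σ.T (fun _ _ => 0) := T.zero
instance T.one' : σ.T (fun _ _ => 1) := T.one
instance T.add' {s t : σ.Fn} [σ.T s] [σ.T t] : σ.T (fun i v => s i v + t i v) :=
  T.add (s := s) (t := t)
instance T.mul' {s t : σ.Fn} [σ.T s] [σ.T t] : σ.T (fun i v => s i v * t i v) :=
  T.mul (s := s) (t := t)
instance D.lt' [FormulaClass Γ] {s t : σ.Fn} [σ.T s] [σ.T t] :
    σ.D Γ (fun i v => s i v < t i v) := D.lt (s := s) (t := t)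
instance D.le' [FormulaClass Γ] {s t : σ.Fn} [σ.T s] [σ.T t] :
    σ.D Γ (fun i v => s i v ≤ t i v) :=
  inferInstanceAs (σ.D Γ (fun i v => s i v < t i v ∨ s i v = t i v))
instance D.bounded_all' {Q : ∀ i, (ℕ → (σ.M i).Num) → (σ.M i).Num → Prop} {t : σ.Fn}
    [σ.T t] [σ.D IsBounded (fun i v => Q i (fun k => v (k + 1)) (v 0))] :
    σ.D IsBounded (fun i v => ∀ a, a < t i v → Q i v a) := D.bounded_all (t := t)
instance D.bounded_ex' {Q : ∀ i, (ℕ → (σ.M i).Num) → (σ.M i).Num → Prop} {t : σ.Fn}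
    [σ.T t] [σ.D IsBounded (fun i v => Q i (fun k => v (k + 1)) (v 0))] :
    σ.D IsBounded (fun i v => ∃ a, a < t i v ∧ Q i v a) := D.bounded_ex (t := t)

end Sig

namespace Model

theorem mem_sec {A : Model.{u}} {Y : Set A.Num} {j x : A.Num} :
    x ∈ A.sec Y j ↔ A.pair j x ∈ Y := Iff.rfl

variable (A : Model.{u}) [hA : A.Ind]

/-- The structure `A` with all its parameters. -/
abbrev fix : Sig.{u} := fixSig A hA.basic.sets_nonempty

variable {A}

theorem mem_sets_of_bounded {X : Set A.Num} (h : A.fix.DS IsBounded (fun _ _ => X)) :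
    X ∈ A.sets := hA.comp.mem_sets _ h

theorem mem_sets {A : Model.{u}} [hA : A.ACA] {X : Set A.Num}
    (h : A.fix.DS IsArithmetical (fun _ _ => X)) : X ∈ A.sets :=
  hA.out.comprehension.mem_sets _ h

theorem set_induction {P : A.Num → Prop} (h : {n | P n} ∈ A.sets) (h0 : P 0)
    (hs : ∀ n, P n → P (n + 1)) (n : A.Num) : P n :=
  hA.basic.induction _ h h0 hs n

theorem bounded_induction {P : A.Num → Prop} (h0 : P 0) (hs : ∀ n, P n → P (n + 1))
    (n : A.Num) [h : A.fix.DS IsBounded (fun _ _ => {n | P n})] : P n :=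
  set_induction (mem_sets_of_bounded h) h0 hs n

protected theorem add_zero' (a : A.Num) : a + 0 = a := hA.basic.add_zero a
protected theorem add_succ' (a b : A.Num) : a + (b + 1) = a + b + 1 := hA.basic.add_succ a b
protected theorem mul_zero' (a : A.Num) : a * 0 = 0 := hA.basic.mul_zero a
protected theorem mul_succ' (a b : A.Num) : a * (b + 1) = a * b + a := hA.basic.mul_succ a b
protected theorem zero_add' (a : A.Num) : 0 + a = a :=
  bounded_induction (P := fun a => 0 + a = a) (Model.add_zero' 0)
    (fun n h => by rw [Model.add_succ', h]) a
protected theorem add_assoc' (a b c : A.Num) : a + b + c = a + (b + c) :=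
  bounded_induction (P := fun c => a + b + c = a + (b + c))
    (by rw [Model.add_zero', Model.add_zero'])
    (fun n h => by rw [Model.add_succ', h, Model.add_succ', Model.add_succ']) c
protected theorem succ_add' (a b : A.Num) : a + 1 + b = a + b + 1 :=
  bounded_induction (P := fun b => a + 1 + b = a + b + 1)
    (by rw [Model.add_zero', Model.add_zero'])
    (fun n h => by rw [Model.add_succ', h, Model.add_succ']) b
protected theorem add_comm' (a b : A.Num) : a + b = b + a :=
  bounded_induction (P := fun b => a + b = b + a)
    (by rw [Model.add_zero', Model.zero_add'])
    (fun n h => by rw [Model.add_succ', h, Model.succ_add']) b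
protected theorem zero_mul' (a : A.Num) : 0 * a = 0 :=
  bounded_induction (P := fun a => 0 * a = 0) (Model.mul_zero' 0)
    (fun n h => by rw [Model.mul_succ', h, Model.add_zero']) a

instance : AddCommMonoid A.Num where
  add_assoc := Model.add_assoc'
  zero_add := Model.zero_add'
  add_zero := Model.add_zero'
  add_comm := Model.add_comm'
  nsmul := nsmulRec

protected theorem succ_mul' (a b : A.Num) : (a + 1) * b = a * b + b :=
  bounded_induction (P := fun b => (a + 1) * b = a * b + b)
    (by rw [Model.mul_zero', Model.mul_zero', Model.add_zero'])
    (fun n h => by rw [Model.mul_succ', h, Model.mul_succ']; abel) b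
protected theorem mul_comm' (a b : A.Num) : a * b = b * a :=
  bounded_induction (P := fun b => a * b = b * a)
    (by rw [Model.mul_zero', Model.zero_mul'])
    (fun n h => by rw [Model.mul_succ', h, Model.succ_mul']) b
protected theorem mul_add' (a b c : A.Num) : a * (b + c) = a * b + a * c :=
  bounded_induction (P := fun c => a * (b + c) = a * b + a * c)
    (by rw [Model.mul_zero', add_zero, add_zero])
    (fun n h => by rw [Model.add_succ', Model.mul_succ', h, Model.mul_succ', add_assoc]) c
protected theorem mul_assoc' (a b c : A.Num) : a * b * c = a * (b * c) :=
  bounded_induction (P := fun c => a * b * c = a * (b * c))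
    (by rw [Model.mul_zero', Model.mul_zero', Model.mul_zero'])
    (fun n h => by rw [Model.mul_succ', h, Model.mul_succ', Model.mul_add']) c
protected theorem mul_one' (a : A.Num) : a * 1 = a := by
  rw [← zero_add (1 : A.Num), Model.mul_succ', Model.mul_zero', zero_add]

noncomputable instance : CommSemiring A.Num where
  left_distrib := Model.mul_add'
  right_distrib a b c := by
    rw [Model.mul_comm', Model.mul_add', Model.mul_comm' c, Model.mul_comm' c]
  zero_mul := Model.zero_mul'
  mul_zero := Model.mul_zero'
  mul_assoc := Model.mul_assoc'
  one_mul a := by rw [Model.mul_comm', Model.mul_one']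
  mul_one := Model.mul_one'
  mul_comm := Model.mul_comm'

protected theorem not_lt_zero' (a : A.Num) : ¬ a < 0 := hA.basic.not_lt_zero a
protected theorem lt_succ' (a b : A.Num) : a < b + 1 ↔ a ≤ b := hA.basic.lt_succ a b
protected theorem lt_trans' (a b c : A.Num) : a < b → b < c → a < c :=
  bounded_induction (P := fun c => a < b → b < c → a < c)
    (fun _ h => absurd h (Model.not_lt_zero' _))
    (fun n h h1 h2 => by
      rw [Model.lt_succ'] at *
      rcases h2 with h2 | rfl
      exacts [.inl (h h1 h2), .inl h1]) c
protected theorem succ_lt_succ (a b : A.Num) : a < b → a + 1 < b + 1 :=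
  bounded_induction (P := fun b => a < b → a + 1 < b + 1)
    (fun h => absurd h (Model.not_lt_zero' _))
    (fun n h h1 => by
      rw [Model.lt_succ'] at h1 ⊢
      rcases h1 with h1 | rfl
      exacts [.inl (h h1), .inr rfl]) b
protected theorem zero_le' (a : A.Num) : 0 ≤ a :=
  bounded_induction (P := fun a => 0 ≤ a) (.inr rfl)
    (fun _ h => .inl ((Model.lt_succ' _ _).2 h)) a
protected theorem lt_irrefl' (a : A.Num) : ¬ a < a :=
  bounded_induction (P := fun a => ¬ a < a) (Model.not_lt_zero' 0)
    (fun n h h1 => by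
      rw [Model.lt_succ'] at h1
      have h2 : n < n + 1 := (Model.lt_succ' _ _).2 (.inr rfl)
      rcases h1 with h1 | h1
      · exact h (Model.lt_trans' _ _ _ h2 h1)
      · rw [h1] at h2; exact h h2) a
protected theorem lt_or_le (a b : A.Num) : a < b ∨ b ≤ a :=
  bounded_induction (P := fun a => a < b ∨ b ≤ a)
    (by rcases Model.zero_le' b with h | h
        exacts [.inl h, .inr (.inr h.symm)])
    (fun n h => by
      rcases h with h | h
      · have := Model.succ_lt_succ _ _ h
        rw [Model.lt_succ'] at this
        rcases this with h | h
        exacts [.inl h, .inr (.inr h.symm)]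
      · exact .inr (.inl ((Model.lt_succ' _ _).2 h))) a

noncomputable instance : LinearOrder A.Num where
  le_refl a := .inr rfl
  le_trans a b c := by
    rintro (h | rfl) (h' | rfl)
    exacts [.inl (Model.lt_trans' _ _ _ h h'), .inl h, .inl h', .inr rfl]
  lt_iff_le_not_ge a b := by
    constructor
    · refine fun h => ⟨.inl h, ?_⟩
      rintro (h' | rfl)
      exacts [Model.lt_irrefl' _ (Model.lt_trans' _ _ _ h h'), Model.lt_irrefl' _ h]
    · rintro ⟨h | rfl, h'⟩
      exacts [h, absurd (.inr rfl) h']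
  le_antisymm a b := by
    rintro (h | rfl) (h' | h')
    exacts [(Model.lt_irrefl' _ (Model.lt_trans' _ _ _ h h')).elim, h'.symm, rfl, rfl]
  le_total a b := (Model.lt_or_le a b).elim (fun h => .inl (.inl h)) .inr
  toDecidableLE := Classical.decRel _

protected theorem add_lt_add' (a b c : A.Num) (h : a < b) : a + c < b + c :=
  bounded_induction (P := fun c => a + c < b + c) (by simpa using h)
    (fun n h => by
      rw [Model.add_succ', Model.add_succ']
      exact Model.succ_lt_succ _ _ h) c

instance : IsOrderedCancelAddMonoid A.Num where
  add_le_add_left a b h c := by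
    rcases h.lt_or_eq with h | rfl
    exacts [(Model.add_lt_add' _ _ _ h).le, le_rfl]
  le_of_add_le_add_left a b c h := by
    by_contra h'
    have := Model.add_lt_add' _ _ a (not_le.1 h')
    rw [add_comm _ a, add_comm _ a] at this
    exact absurd h (not_le.2 this)

instance : CanonicallyOrderedAdd A.Num where
  exists_add_of_le {a b} h := by
    -- The bound on `c` is added only to make the induction formula bounded.
    have : ∀ b, a < b + 1 → ∃ c, c < b + 1 ∧ b = a + c := fun b =>
      bounded_induction (P := fun b => a < b + 1 → ∃ c, c < b + 1 ∧ b = a + c)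
        (fun h => by
          have : a = 0 := le_antisymm ((Model.lt_succ' _ _).1 h) (Model.zero_le' _)
          exact ⟨0, (Model.lt_succ' _ _).2 le_rfl, by rw [this, add_zero]⟩)
        (fun n ih h => by
          rcases ((Model.lt_succ' _ _).1 h) with h | rfl
          · obtain ⟨c, hc, e⟩ := ih h
            exact ⟨c + 1, Model.succ_lt_succ _ _ hc, by rw [Model.add_succ', ← e]⟩
          · exact ⟨0, (Model.lt_succ' _ _).2 (Model.zero_le' _), by rw [add_zero]⟩) b
    obtain ⟨c, -, e⟩ := this b ((Model.lt_succ' _ _).2 h)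
    exact ⟨c, e⟩
  le_add_self a b := by
    have := add_le_add_left (Model.zero_le' b) a
    simpa using this
  le_self_add a b := by
    have := add_le_add_left (Model.zero_le' b) a
    simpa [add_comm] using this

instance : Nontrivial A.Num :=
  ⟨(0 : A.Num), 1, fun h => hA.basic.succ_ne_zero 0 (by
    change (0 : A.Num) + 1 = 0
    rw [zero_add, ← h])⟩

protected theorem mul_lt_mul' {a b c : A.Num} (h : a < b) (hc : 0 < c) : a * c < b * c := by
  obtain ⟨d, rfl⟩ := exists_add_of_le ((Model.lt_succ' _ _).1 (Model.succ_lt_succ _ _ h))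
  obtain ⟨e, rfl⟩ := exists_add_of_le
    ((Model.lt_succ' _ _).1 (by simpa using Model.succ_lt_succ _ _ hc) : 1 ≤ c)
  have e1 : (a + 1 + d) * (1 + e) = a * (1 + e) + (d * (1 + e) + e + 1) := by ring
  rw [e1, Model.add_succ', Model.lt_succ']
  exact le_self_add

instance : IsStrictOrderedRing A.Num where
  zero_le_one := zero_le
  mul_lt_mul_of_pos_left a ha b c h := by
    simpa only [mul_comm a] using Model.mul_lt_mul' h ha
  mul_lt_mul_of_pos_right a ha b c h := Model.mul_lt_mul' h ha

theorem lt_add_one_iff {a b : A.Num} : a < b + 1 ↔ a ≤ b := Model.lt_succ' a b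

theorem add_one_le_iff {a b : A.Num} : a + 1 ≤ b ↔ a < b := by
  rw [← not_lt, lt_add_one_iff, not_le]

theorem eq_zero_or_succ (a : A.Num) : a = 0 ∨ ∃ b, a = b + 1 := by
  rcases (zero_le (a := a)).eq_or_lt with h | h
  · exact .inl h.symm
  · obtain ⟨c, rfl⟩ := exists_add_of_le (add_one_le_iff.2 h)
    exact .inr ⟨c, by rw [zero_add, add_comm]⟩

theorem le_mul_self (a : A.Num) : a ≤ a * a := by
  rcases eq_zero_or_succ a with rfl | ⟨b, rfl⟩
  · simp
  · exact le_mul_of_one_le_left (zero_le) le_add_self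

theorem add_le_pair (x y : A.Num) : x + y ≤ A.pair x y :=
  (le_mul_self _).trans le_self_add

theorem left_le_pair (x y : A.Num) : x ≤ A.pair x y := le_self_add.trans (add_le_pair x y)

theorem right_le_pair (x y : A.Num) : y ≤ A.pair x y := le_add_self.trans (add_le_pair x y)

/-- The pair `(x + y)² + x` lies strictly below `(x + y + 1)²`, so a pair determines the sum of its
components; this gives injectivity. -/
theorem pair_lt_pair {x y x' y' : A.Num} (h : x + y < x' + y') : A.pair x y < A.pair x' y' := by
  have h1 : (x + y + 1) * (x + y + 1) ≤ (x' + y') * (x' + y') := by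
    have := add_one_le_iff.2 h
    exact mul_le_mul' this this
  have h2 : A.pair x y < (x + y + 1) * (x + y + 1) := by
    have e : (x + y + 1) * (x + y + 1) = A.pair x y + (x + y + y + 1) := by
      change _ = (x + y) * (x + y) + x + _
      ring
    rw [e]
    exact lt_add_of_pos_right _ (lt_of_lt_of_le zero_lt_one le_add_self)
  exact h2.trans_le (h1.trans le_self_add)

@[simp] theorem pair_inj {x y x' y' : A.Num} : A.pair x y = A.pair x' y' ↔ x = x' ∧ y = y' := by
  refine ⟨fun h => ?_, fun h => by rw [h.1, h.2]⟩
  have e : x + y = x' + y' := by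
    rcases lt_trichotomy (x + y) (x' + y') with h' | h' | h'
    · exact absurd h (pair_lt_pair h').ne
    · exact h'
    · exact absurd h (pair_lt_pair h').ne'
  have hx : x = x' := by
    change (x + y) * (x + y) + x = (x' + y') * (x' + y') + x' at h
    rw [e] at h
    exact add_left_cancel h
  subst hx
  exact ⟨rfl, add_left_cancel e⟩

theorem exists_least {X : Set A.Num} (hX : X ∈ A.sets) (h : X.Nonempty) :
    ∃ n ∈ X, ∀ m < n, m ∉ X := by
  by_contra! hc
  obtain ⟨n, hn⟩ := h
  have := Fact.mk hX
  have key : ∀ n : A.Num, ∀ m, m < n → m ∉ X := fun n =>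
    bounded_induction (P := fun n => ∀ m, m < n → m ∉ X)
      (fun m hm => absurd hm (Model.not_lt_zero' m))
      (fun n ih m hm hmX => by
        obtain ⟨k, hk, hkX⟩ := hc m hmX
        exact ih k (hk.trans_le (lt_add_one_iff.1 hm)) hkX) n
  exact key (n + 1) n (lt_add_one_iff.2 le_rfl) hn

end Model

namespace Sig

/-- Bounded quantification over the components of a pair. -/
instance D.exists_pair {A : Model.{u}} [A.Ind]
    {Q : PUnit.{u+2} → (ℕ → A.Num) → A.Num → A.Num → Prop} {t : A.fix.Fn} [ht : A.fix.T t]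
    [hQ : A.fix.D IsBounded (fun i v => Q i (fun k => v (k + 1 + 1)) (v 1) (v 0))] :
    A.fix.D IsBounded (fun i v => ∃ j x, t i v = A.pair j x ∧ Q i v j x) := by
  have h1 : A.fix.T (fun i v => t i (fun k => v (k + 1 + 1))) := ht.comp fun _ => T.var _
  have h2 : A.fix.T (fun i v => t i (fun k => v (k + 1))) := ht.comp fun _ => T.var _
  refine D.congr (P := fun i v => ∃ j, j < t i v + 1 ∧ ∃ x, x < t i v + 1 ∧
    (t i v = A.pair j x ∧ Q i v j x)) ?_ fun i v => ?_
  · infer_instance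
  · constructor
    · rintro ⟨j, x, h, hQ⟩
      exact ⟨j, Model.lt_add_one_iff.2 (h ▸ Model.left_le_pair _ _), x,
        Model.lt_add_one_iff.2 (h ▸ Model.right_le_pair _ _), h, hQ⟩
    · rintro ⟨j, -, x, -, h, hQ⟩
      exact ⟨j, x, h, hQ⟩

end Sig

end SOA

namespace SOA

/-! ### Finite sets and recursion in models of `ACA₀` -/

namespace Model

/-- `x` is an element of the finite set coded by `c`. -/
def El {A : Model.{u}} (x c : A.Num) : Prop :=
  ∃ a d m, c = A.pair (A.pair a d) m ∧ x < m ∧ ∃ k, a = (1 + (x + 1) * d) * k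

end Model

instance Sig.D.el {σ : Sig.{u}} {s t : σ.Fn} [hs : σ.T s] [ht : σ.T t] :
    σ.D IsArithmetical (fun i v => Model.El (s i v) (t i v)) := by
  have h : σ.D IsArithmetical (fun i v => Model.El (v 0) (v 1)) := by
    unfold Model.El
    infer_instance
  exact h.comp (g := fun i v => SOA.push (s i v) (SOA.push (t i v) v))
    (T.push hs (T.push ht fun _ => T.var _))

namespace Model

section Ind
variable {A : Model.{u}} [hA : A.Ind]

theorem El.lt {x c : A.Num} (h : El x c) : x < c := by
  obtain ⟨a, d, m, rfl, h, -⟩ := h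
  exact h.trans_le (right_le_pair _ _)

/-- There is no subtraction: the quotients of `b` and `b + c` are compared, and their difference is
the quotient of `c`. The divisor zero is separate because it cannot be cancelled. -/
theorem dvd_of_dvd_add {a b c : A.Num} (h : a ∣ b + c) (hb : a ∣ b) : a ∣ c := by
  obtain ⟨k, rfl⟩ := hb
  obtain ⟨l, hl⟩ := h
  rcases (zero_le (a := a)).eq_or_lt with rfl | ha
  · simp only [zero_mul, zero_add] at hl
    simp [hl]
  · have : k ≤ l := le_of_mul_le_mul_left (hl ▸ le_self_add) ha
    obtain ⟨j, rfl⟩ := exists_add_of_le this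
    rw [mul_add] at hl
    exact ⟨j, add_left_cancel hl⟩

/-- The moduli `1 + (x + 1) d` for `x < m` are coprime if `d` is divisible by `1, …, m`. -/
theorem dvd_of_dvd_mul_modulus {m d x y c : A.Num} (hd : ∀ e, e + 1 ≤ m → e + 1 ∣ d)
    (hx : x < m) (hy : y < m) (hxy : x ≠ y) (h : 1 + (x + 1) * d ∣ c * (1 + (y + 1) * d)) :
    1 + (x + 1) * d ∣ c := by
  set p := 1 + (x + 1) * d with hp
  -- Since `e + 1` divides `d`, the modulus `p` is `1` modulo `e + 1`; hence `e + 1` is invertible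
  -- modulo `p`.
  have key : ∀ e, e + 1 ≤ m → p ∣ c * (e + 1) → p ∣ c := by
    intro e he h
    obtain ⟨f, rfl⟩ := hd e he
    have h1 : p ∣ c * p := dvd_mul_left _ _
    have h2 : c * p = c * (e + 1) * ((x + 1) * f) + c := by rw [hp]; ring
    exact dvd_of_dvd_add (h2 ▸ h1) (h.mul_right _)
  rcases lt_or_gt_of_ne hxy with h' | h'
  · obtain ⟨e, rfl⟩ := exists_add_of_le (add_one_le_iff.2 h')
    refine key e ((?_ : e + 1 ≤ x + 1 + e).trans hy.le) ?_
    · rw [add_comm x, add_assoc, add_comm, add_comm x e, ← add_assoc, add_comm 1 e]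
      exact le_self_add
    -- With `q` the other modulus and `y = x + 1 + e`, the combination `(y + 1) p - (x + 1) q`
    -- eliminates `d` and leaves `y - x = e + 1`.
    · have h1 : c * p * (x + 1 + e + 1) =
        c * (1 + (x + 1 + e + 1) * d) * (x + 1) + c * (e + 1) := by rw [hp]; ring
      exact dvd_of_dvd_add (h1 ▸ ((dvd_mul_left p c).mul_right _)) (h.mul_right _)
  · obtain ⟨e, rfl⟩ := exists_add_of_le (add_one_le_iff.2 h')
    refine key e ((?_ : e + 1 ≤ y + 1 + e).trans hx.le) ?_
    · rw [add_comm y, add_assoc, add_comm, add_comm y e, ← add_assoc, add_comm 1 e]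
      exact le_self_add
    · have h1 : c * (1 + (y + 1) * d) * (y + 1 + e + 1) =
        c * p * (y + 1) + c * (e + 1) := by rw [hp]; ring
      exact dvd_of_dvd_add (h1 ▸ (h.mul_right _)) ((dvd_mul_left p c).mul_right _)

end Ind

variable {A : Model.{u}} [hA : A.ACA]

theorem arith_induction {P : A.Num → Prop} (h0 : P 0) (hs : ∀ n, P n → P (n + 1))
    (n : A.Num) [h : A.fix.DS IsArithmetical (fun _ _ => {n | P n})] : P n :=
  set_induction (mem_sets h) h0 hs n

theorem exists_pos_dvd (m : A.Num) : ∃ d, 0 < d ∧ ∀ e, e + 1 ≤ m → e + 1 ∣ d := by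
  refine arith_induction (P := fun m => ∃ d : A.Num, 0 < d ∧ ∀ e, e + 1 ≤ m → ∃ k, d = (e + 1) * k)
    ⟨1, zero_lt_one, fun e he => absurd he (not_le.2 (lt_add_one_iff.2 zero_le))⟩
    (fun n ih => ?_) m
  obtain ⟨d, hd, h⟩ := ih
  refine ⟨(n + 1) * d, mul_pos (lt_add_one_iff.2 zero_le) hd, fun e he => ?_⟩
  rcases he.lt_or_eq with he | he
  · obtain ⟨k, rfl⟩ := h e (lt_add_one_iff.1 he)
    exact ⟨(n + 1) * k, by ring⟩
  · exact ⟨d, by rw [he]⟩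

/-- Every bounded set of the structure is coded by a number. -/
theorem exists_code {X : Set A.Num} (hX : X ∈ A.sets) (m : A.Num) :
    ∃ c, ∀ x, El x c ↔ x ∈ X ∧ x < m := by
  have := Fact.mk hX
  obtain ⟨d, hd, hdvd⟩ := exists_pos_dvd m
  -- The witness `a` is the product of the moduli of the elements of `X` below `n`; `d` is fixed by
  -- `m`, so that all moduli involved are coprime.
  have key : ∀ n, n ≤ m → ∃ a, ∀ x, x < m →
      ((∃ k, a = (1 + (x + 1) * d) * k) ↔ x ∈ X ∧ x < n) := fun n => by
    refine arith_induction (P := fun n => n ≤ m → ∃ a, ∀ x, x < m →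
      ((∃ k, a = (1 + (x + 1) * d) * k) ↔ x ∈ X ∧ x < n)) (fun _ => ⟨1, fun x hx => ?_⟩)
      (fun n ih hn => ?_) n
    · simp only [Model.not_lt_zero', and_false, iff_false]
      rintro ⟨k, hk⟩
      have h1 : 1 + (x + 1) * d ≤ 1 := by
        rcases eq_zero_or_succ k with rfl | ⟨k, rfl⟩
        · simp at hk
        · rw [mul_add, mul_one] at hk
          exact le_add_self.trans hk.ge
      exact absurd h1 (not_le.2 (lt_add_of_pos_right _ (mul_pos (lt_add_one_iff.2 zero_le) hd)))
    · obtain ⟨a, ha⟩ := ih ((lt_add_one_iff.2 le_rfl).le.trans hn)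
      have hnm : n < m := add_one_le_iff.1 hn
      by_cases hnX : n ∈ X
      · refine ⟨a * (1 + (n + 1) * d), fun x hx => ?_⟩
        by_cases hxn : x = n
        · subst hxn
          exact ⟨fun _ => ⟨hnX, lt_add_one_iff.2 le_rfl⟩, fun _ => ⟨a, mul_comm _ _⟩⟩
        · have h1 : (∃ k, a * (1 + (n + 1) * d) = (1 + (x + 1) * d) * k) ↔
              ∃ k, a = (1 + (x + 1) * d) * k :=
            ⟨fun h => dvd_of_dvd_mul_modulus hdvd hx hnm hxn h,
              fun h => Dvd.dvd.mul_right h _⟩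
          rw [h1, ha x hx, lt_add_one_iff]
          exact and_congr_right fun _ => ⟨le_of_lt, fun h => lt_of_le_of_ne h hxn⟩
      · refine ⟨a, fun x hx => ?_⟩
        rw [ha x hx, lt_add_one_iff]
        refine and_congr_right fun hxX => ⟨le_of_lt, fun h => lt_of_le_of_ne h ?_⟩
        rintro rfl
        exact hnX hxX
  obtain ⟨a, ha⟩ := key m le_rfl
  refine ⟨A.pair (A.pair a d) m, fun x => ⟨?_, fun h => ⟨a, d, m, rfl, h.2, (ha x h.2).2 h⟩⟩⟩
  rintro ⟨a', d', m', h, hx, hk⟩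
  simp only [pair_inj] at h
  obtain ⟨⟨rfl, rfl⟩, rfl⟩ := h
  exact (ha x hx).1 hk

/-- Iteration of a function of the structure. -/
theorem exists_iterate {G : Set A.Num} (hG : G ∈ A.sets) (hfun : ∀ x, ∃! y, A.pair x y ∈ G)
    (x₀ : A.Num) : ∃ F ∈ A.sets, (∀ n, ∃! x, A.pair n x ∈ F) ∧ A.pair 0 x₀ ∈ F ∧
      ∀ n x y, A.pair n x ∈ F → A.pair (n + 1) y ∈ F → A.pair x y ∈ G := by
  have := Fact.mk hG
  -- `App c n`: the finite set `c` is single-valued and contains the first `n` steps of the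
  -- iteration. Any two such `c` agree up to `n`.
  set App : A.Num → A.Num → Prop := fun c n =>
    (∀ i x x', El (A.pair i x) c → El (A.pair i x') c → x = x') ∧ El (A.pair 0 x₀) c ∧
    ∀ i, i < n → ∃ x y, El (A.pair i x) c ∧ El (A.pair (i + 1) y) c ∧ A.pair x y ∈ G with hApp
  have mono : ∀ c m n, m ≤ n → App c n → App c m := fun c m n hmn h =>
    ⟨h.1, h.2.1, fun i hi => h.2.2 i (hi.trans_le hmn)⟩
  have uniq : ∀ c c' n, App c n → App c' n → ∀ i, i ≤ n → ∀ x x', El (A.pair i x) c →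
      El (A.pair i x') c' → x = x' := fun c c' n h h' i => by
    refine arith_induction (P := fun i => i ≤ n → ∀ x x', El (A.pair i x) c →
      El (A.pair i x') c' → x = x') (fun _ x x' hx hx' => ?_) (fun i ih hi z z' hz hz' => ?_) i
    · exact (h.1 _ _ _ hx h.2.1).trans (h'.1 _ _ _ h'.2.1 hx')
    · obtain ⟨x, y, hx, hy, hxy⟩ := h.2.2 i (add_one_le_iff.1 hi)
      obtain ⟨x', y', hx', hy', hxy'⟩ := h'.2.2 i (add_one_le_iff.1 hi)
      obtain rfl := ih ((lt_add_one_iff.2 le_rfl).le.trans hi) _ _ hx hx'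
      rw [h.1 _ _ _ hz hy, h'.1 _ _ _ hz' hy']
      exact (hfun x).unique hxy hxy'
  have ex : ∀ n, ∃ c, App c n ∧ ∃ x, El (A.pair n x) c := fun n => by
    refine arith_induction (P := fun n => ∃ c, App c n ∧ ∃ x, El (A.pair n x) c) ?_ ?_ n
    · have h1 : {p | p = A.pair 0 x₀} ∈ A.sets := mem_sets inferInstance
      obtain ⟨c, hc⟩ := exists_code h1 (A.pair 0 x₀ + 1)
      have hc' : ∀ x, El x c ↔ x = A.pair 0 x₀ := fun x => by
        rw [hc]
        exact ⟨fun h => h.1, fun h => ⟨h, h ▸ lt_add_one_iff.2 le_rfl⟩⟩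
      refine ⟨c, ⟨fun i x x' h h' => ?_, (hc' _).2 rfl,
        fun i hi => absurd hi (Model.not_lt_zero' i)⟩, x₀, (hc' _).2 rfl⟩
      simp only [hc', pair_inj] at h h'
      exact h.2.trans h'.2.symm
    · rintro n ⟨c, hc, x, hx⟩
      obtain ⟨y, hy, -⟩ := hfun x
      -- The old code is cut off after index `n`: it may contain other entries there, which would
      -- spoil uniqueness.
      have h1 : {p | p = A.pair (n + 1) y ∨ ∃ i z, i ≤ n ∧ p = A.pair i z ∧ El p c} ∈ A.sets :=
        mem_sets inferInstance
      obtain ⟨c', hc'⟩ := exists_code h1 (A.pair (n + 1) y + c + 1)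
      have e : ∀ i z, El (A.pair i z) c' ↔
          (i = n + 1 ∧ z = y) ∨ (i ≤ n ∧ El (A.pair i z) c) := fun i z => by
        rw [hc']
        constructor
        · rintro ⟨h | ⟨i', z', hi, h, h'⟩, -⟩
          · exact .inl (pair_inj.1 h)
          · obtain ⟨rfl, rfl⟩ := pair_inj.1 h
            exact .inr ⟨hi, h'⟩
        · rintro (⟨rfl, rfl⟩ | ⟨hi, h⟩)
          · refine ⟨.inl rfl, lt_add_one_iff.2 le_self_add⟩
          · exact ⟨.inr ⟨i, z, hi, rfl, h⟩, lt_add_one_iff.2 (h.lt.le.trans le_add_self)⟩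
      have hn : ∀ i, i ≤ n → i ≠ n + 1 := fun i hi => (lt_add_one_iff.2 hi).ne
      refine ⟨c', ⟨fun i z z' h h' => ?_, (e _ _).2 (.inr ⟨zero_le, hc.2.1⟩), fun i hi => ?_⟩,
        y, (e _ _).2 (.inl ⟨rfl, rfl⟩)⟩
      · rw [e] at h h'
        rcases h with ⟨h1, h2⟩ | ⟨h1, h2⟩ <;> rcases h' with ⟨h3, h4⟩ | ⟨h3, h4⟩
        · exact h2.trans h4.symm
        · exact absurd h1 (hn _ h3)
        · exact absurd h3 (hn _ h1)
        · exact hc.1 _ _ _ h2 h4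
      · rcases (lt_add_one_iff.1 hi).lt_or_eq with hi | rfl
        · obtain ⟨z, z', hz, hz', hG⟩ := hc.2.2 i hi
          exact ⟨z, z', (e _ _).2 (.inr ⟨hi.le, hz⟩),
            (e _ _).2 (.inr ⟨add_one_le_iff.2 hi, hz'⟩), hG⟩
        · exact ⟨x, y, (e _ _).2 (.inr ⟨le_rfl, hx⟩), (e _ _).2 (.inl ⟨rfl, rfl⟩), hy⟩
  have hF : {p | ∃ n x, p = A.pair n x ∧ ∃ c, App c n ∧ El p c} ∈ A.sets := mem_sets inferInstance
  have hF' : ∀ n x, A.pair n x ∈ {p | ∃ n x, p = A.pair n x ∧ ∃ c, App c n ∧ El p c} ↔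
      ∃ c, App c n ∧ El (A.pair n x) c := fun n x => by
    constructor
    · rintro ⟨n', x', h, c, hc⟩
      obtain ⟨rfl, rfl⟩ := pair_inj.1 h
      exact ⟨c, hc⟩
    · exact fun h => ⟨n, x, rfl, h⟩
  refine ⟨_, hF, fun n => ?_, ?_, fun n x y hx hy => ?_⟩
  · obtain ⟨c, hc, x, hx⟩ := ex n
    refine ⟨x, (hF' _ _).2 ⟨c, hc, hx⟩, fun y hy => ?_⟩
    obtain ⟨c', hc', hy⟩ := (hF' _ _).1 hy
    exact uniq c' c n hc' hc n le_rfl _ _ hy hx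
  · obtain ⟨c, hc, -⟩ := ex 0
    exact (hF' _ _).2 ⟨c, hc, hc.2.1⟩
  · obtain ⟨c, hc, hx⟩ := (hF' _ _).1 hx
    obtain ⟨c', hc', hy⟩ := (hF' _ _).1 hy
    obtain ⟨x', y', h1, h2, h3⟩ := hc'.2.2 n (lt_add_one_iff.2 le_rfl)
    rw [hc'.1 _ _ _ hy h2, uniq c c' n hc (mono _ _ _ (lt_add_one_iff.2 le_rfl).le hc') n le_rfl
      _ _ hx h1]
    exact h3

/-! ### Well orders -/

/-- In a model of `ACA₀`, a linear order is a well order if and only if every nonempty subset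
has a least element. -/
theorem isWellOrd_iff {L R : Set A.Num} (hL : L ∈ A.sets) (hR : R ∈ A.sets)
    (hlin : A.IsLinOrd L R) : A.IsWellOrd L R ↔
      ∀ S ∈ A.sets, S ⊆ L → S.Nonempty → ∃ x ∈ S, ∀ y ∈ S, ¬ A.Rel R y x := by
  have := Fact.mk hL
  have := Fact.mk hR
  constructor
  · rintro ⟨-, h⟩ S hS hSL hne
    by_contra! hc
    have := Fact.mk hS
    refine h ?_
    -- From a point of `S`, go to the point of `S` below it with the least number; outside `S` the
    -- function is the identity, only to be total. Its iteration is a descending sequence.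
    have hG : {p | ∃ x y, p = A.pair x y ∧ ((x ∉ S ∧ y = x) ∨
        (x ∈ S ∧ y ∈ S ∧ A.pair y x ∈ R ∧ ∀ z, z < y → ¬ (z ∈ S ∧ A.pair z x ∈ R)))} ∈ A.sets :=
      mem_sets inferInstance
    set G := {p | ∃ x y, p = A.pair x y ∧ ((x ∉ S ∧ y = x) ∨
        (x ∈ S ∧ y ∈ S ∧ A.pair y x ∈ R ∧ ∀ z, z < y → ¬ (z ∈ S ∧ A.pair z x ∈ R)))}
    have hG' : ∀ x y, A.pair x y ∈ G ↔ ((x ∉ S ∧ y = x) ∨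
        (x ∈ S ∧ y ∈ S ∧ A.pair y x ∈ R ∧ ∀ z, z < y → ¬ (z ∈ S ∧ A.pair z x ∈ R))) := by
      intro x y
      constructor
      · rintro ⟨x', y', h, h'⟩
        obtain ⟨rfl, rfl⟩ := pair_inj.1 h
        exact h'
      · exact fun h => ⟨x, y, rfl, h⟩
    obtain ⟨x₀, hx₀⟩ := hne
    obtain ⟨F, hF, hfun, h0, hstep⟩ := exists_iterate hG (fun x => by
      by_cases hx : x ∈ S
      · have h1 : {y | y ∈ S ∧ A.pair y x ∈ R} ∈ A.sets := mem_sets inferInstance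
        obtain ⟨y, hy, hmin⟩ := exists_least h1 (hc x hx)
        refine ⟨y, (hG' _ _).2 (.inr ⟨hx, hy.1, hy.2, hmin⟩), fun z hz => ?_⟩
        rcases (hG' _ _).1 hz with hz | hz
        · exact absurd hx hz.1
        · rcases lt_trichotomy z y with h | h | h
          · exact absurd ⟨hz.2.1, hz.2.2.1⟩ (hmin z h)
          · exact h
          · exact absurd hy (hz.2.2.2 y h)
      · exact ⟨x, (hG' _ _).2 (.inl ⟨hx, rfl⟩), fun z hz => by
          rcases (hG' _ _).1 hz with hz | hz
          exacts [hz.2, absurd hz.1 hx]⟩) x₀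
    have := Fact.mk hF
    have hFS : ∀ n x, A.pair n x ∈ F → x ∈ S := fun n => by
      refine arith_induction (P := fun n => ∀ x, A.pair n x ∈ F → x ∈ S) (fun x hx => ?_)
        (fun n ih x hx => ?_) n
      · rwa [(hfun 0).unique hx h0]
      · obtain ⟨y, hy, -⟩ := hfun n
        rcases (hG' _ _).1 (hstep n y x hy hx) with h | h
        · exact absurd (ih y hy) h.1
        · exact h.2.1
    refine ⟨F, hF, hfun, fun n x hx => hSL (hFS n x hx), fun n x y hx hy => ?_⟩
    rcases (hG' _ _).1 (hstep n x y hx hy) with h | h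
    · exact absurd (hFS n x hx) h.1
    · exact h.2.2.1
  · refine fun h => ⟨hlin, ?_⟩
    rintro ⟨F, hF, hfun, hFL, hdesc⟩
    have := Fact.mk hF
    have h1 : {x | ∃ n, A.pair n x ∈ F} ∈ A.sets := mem_sets inferInstance
    obtain ⟨x, ⟨n, hx⟩, hmin⟩ := h _ h1 (fun x ⟨n, hx⟩ => hFL n x hx)
      ⟨_, 0, (hfun 0).choose_spec.1⟩
    obtain ⟨y, hy, -⟩ := hfun (n + 1)
    exact hmin y ⟨_, hy⟩ (hdesc n x y hx hy)

end Model
end SOA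

namespace SOA
namespace Model

/-! ### The topology of a linear order -/

section defs
variable (A : Model.{u})

/-- An arithmetical description of `V_l`: the points `x ≤ l`, and the points `x > l` for which
`]l, x]` is finite. -/
def vset (L R : Set A.Num) (l : A.Num) : Set A.Num :=
  {x | x ∈ L ∧ (A.pair x l ∈ R ∨ x = l ∨ (A.pair l x ∈ R ∧
    ∃ b, ∀ y, y ∈ L → A.pair l y ∈ R → (A.pair y x ∈ R ∨ y = x) → y < b))}

/-- The basic open set with index `⟨l, 0⟩` is `V_l`, and the one with index `⟨l, a + 1⟩` is
the intersection of `V_l` and the ray `]a, +∞[`. -/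
def topBase (L R : Set A.Num) (i : A.Num) : Set A.Num :=
  {x | ∃ l e, i = A.pair l e ∧ l ∈ L ∧ x ∈ A.vset L R l ∧
    (e = 0 ∨ ∃ a, e = a + 1 ∧ a ∈ L ∧ A.pair a x ∈ R)}

/-- The code of the sequence of basic open sets. -/
def topU (L R : Set A.Num) : Set A.Num := {z | ∃ i x, z = A.pair i x ∧ x ∈ A.topBase L R i}

/-- `n` is the index of a basic neighbourhood of `x` that is included in `U_i ∩ U_j`. -/
def IsRefinement (U : Set A.Num) (x i j n : A.Num) : Prop :=
  x ∈ A.sec U n ∧ ∀ y, y ∈ A.sec U n → y ∈ A.sec U i ∧ y ∈ A.sec U j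

/-- The value at `x`, `i`, `j` of the function that chooses the least refinement. -/
def IsLeastRefinement (U : Set A.Num) (x i j n : A.Num) : Prop :=
  (A.IsRefinement U x i j n ∧ ∀ m, m < n → ¬ A.IsRefinement U x i j m) ∨
    (n = 0 ∧ ∀ m, ¬ A.IsRefinement U x i j m)

/-- The code of the function that chooses the least refinement. -/
def topK (U : Set A.Num) : Set A.Num :=
  {z | ∃ x i j n, z = A.pair (A.pair x (A.pair i j)) n ∧ A.IsLeastRefinement U x i j n}

end defs
end Model

namespace Sig
variable {σ : Sig.{u}}

instance DS.topU {L R : ∀ i, Set (σ.M i).Num} [hL : σ.DS IsArithmetical (fun i _ => L i)]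
    [hR : σ.DS IsArithmetical (fun i _ => R i)] :
    σ.DS IsArithmetical (fun i _ => (σ.M i).topU (L i) (R i)) := by
  unfold Model.topU Model.topBase Model.vset
  infer_instance

set_option synthInstance.maxHeartbeats 200000 in
set_option synthInstance.maxSize 1000 in
instance DS.topK {U : ∀ i, Set (σ.M i).Num} [hU : σ.DS IsArithmetical (fun i _ => U i)] :
    σ.DS IsArithmetical (fun i _ => (σ.M i).topK (U i)) := by
  unfold Model.topK Model.IsLeastRefinement Model.IsRefinement
  infer_instance

end Sig

namespace Model

/-! ### Correctness of the arithmetical basis of `Top(L)` -/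

theorem sec_topU {A : Model.{u}} [A.Ind] {L R : Set A.Num} (i : A.Num) :
    A.sec (A.topU L R) i = A.topBase L R i := by
  ext x
  rw [mem_sec]
  constructor
  · rintro ⟨i', x', h, hx⟩
    obtain ⟨rfl, rfl⟩ := pair_inj.1 h
    exact hx
  · exact fun h => ⟨i, x, rfl, h⟩

theorem val_topK {A : Model.{u}} [A.Ind] {U : Set A.Num} {x i j n : A.Num} :
    A.Val (A.topK U) x i j n ↔ A.IsLeastRefinement U x i j n := by
  constructor
  · rintro ⟨x', i', j', n', h, hx⟩
    simp only [pair_inj] at h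
    obtain ⟨⟨rfl, rfl, rfl⟩, rfl⟩ := h
    exact hx
  · exact fun h => ⟨x, i, j, n, rfl, h⟩

/-- Choosing least refinements turns a basis into a countable second countable space. -/
theorem isCSCS_topK {A : Model.{u}} [A.ACA] {X U : Set A.Num} (hU : U ∈ A.sets)
    (hsub : ∀ i, A.sec U i ⊆ X) (hcov : ∀ x ∈ X, ∃ i, x ∈ A.sec U i)
    (hbase : ∀ x i j, x ∈ A.sec U i → x ∈ A.sec U j → ∃ n, A.IsRefinement U x i j n) :
    A.IsCSCS X U (A.topK U) := by
  have := Fact.mk hU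
  refine ⟨hsub, hcov, fun x _ i j => ?_, fun x _ i j n hi hj h => ?_⟩
  · simp only [val_topK]
    by_cases h : ∃ n, A.IsRefinement U x i j n
    · have h1 : {n | A.IsRefinement U x i j n} ∈ A.sets := mem_sets (by
        unfold Model.IsRefinement
        infer_instance)
      obtain ⟨n, hn, hmin⟩ := exists_least h1 h
      refine ⟨n, .inl ⟨hn, hmin⟩, ?_⟩
      rintro m (⟨h1, h2⟩ | ⟨-, h2⟩)
      · rcases lt_trichotomy m n with h' | h' | h'
        · exact absurd h1 (hmin m h')
        · exact h'
        · exact absurd hn (h2 n h')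
      · exact absurd hn (h2 n)
    · push Not at h
      refine ⟨0, .inr ⟨rfl, h⟩, ?_⟩
      rintro m (⟨h1, -⟩ | ⟨h1, -⟩)
      · exact absurd h1 (h m)
      · exact h1
  · rw [val_topK] at h
    rcases h with ⟨h, -⟩ | ⟨-, h⟩
    · exact h
    · obtain ⟨n, hn⟩ := hbase x i j hi hj
      exact absurd hn (h n)

variable {A : Model.{u}} [hA : A.ACA] {L R : Set A.Num}

/-- A bounded nonempty subset of a linear order has a least element. -/
theorem IsLinOrd.exists_least_of_bounded (hR : R ∈ A.sets)
    (hlin : A.IsLinOrd L R) {S : Set A.Num} (hS : S ∈ A.sets) (hSL : S ⊆ L) (hne : S.Nonempty)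
    {b : A.Num} (hb : ∀ x ∈ S, x < b) : ∃ x ∈ S, ∀ y ∈ S, ¬ A.Rel R y x := by
  have := Fact.mk hR
  have := Fact.mk hS
  -- Induction on a numerical cut-off: a minimum among the elements numbered below `n` is compared
  -- with the single new candidate `n`.
  have key : ∀ b, (∃ x, x ∈ S ∧ x < b) →
      ∃ x, x ∈ S ∧ ∀ y, y ∈ S → y < b → ¬ A.pair y x ∈ R := fun b => by
    refine arith_induction (P := fun b => (∃ x, x ∈ S ∧ x < b) →
      ∃ x, x ∈ S ∧ ∀ y, y ∈ S → y < b → ¬ A.pair y x ∈ R) ?_ ?_ b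
    · rintro ⟨x, -, hx⟩
      exact absurd hx (Model.not_lt_zero' x)
    · rintro n ih ⟨x, hx, hxn⟩
      by_cases h : ∃ x, x ∈ S ∧ x < n
      · obtain ⟨z, hz, hmin⟩ := ih h
        by_cases hn : n ∈ S ∧ A.pair n z ∈ R
        · refine ⟨n, hn.1, fun y hy hyn hyR => ?_⟩
          rcases (lt_add_one_iff.1 hyn).lt_or_eq with h' | rfl
          · exact hmin y hy h' (hlin.trans _ (hSL hy) _ (hSL hn.1) _ (hSL hz) hyR hn.2)
          · exact hlin.irrefl _ (hSL hy) hyR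
        · refine ⟨z, hz, fun y hy hyn hyR => ?_⟩
          rcases (lt_add_one_iff.1 hyn).lt_or_eq with h' | rfl
          · exact hmin y hy h' hyR
          · exact hn ⟨hy, hyR⟩
      · push Not at h
        have : x = n := le_antisymm (lt_add_one_iff.1 hxn) (h x hx)
        subst this
        refine ⟨x, hx, fun y hy hyn hyR => ?_⟩
        have : y = x := le_antisymm (lt_add_one_iff.1 hyn) (h y hy)
        exact hlin.irrefl _ (hSL hx) (this ▸ hyR)
  obtain ⟨x, hx⟩ := hne
  obtain ⟨x, hx, h⟩ := key b ⟨x, hx, hb x hx⟩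
  exact ⟨x, hx, fun y hy => h y hy (hb y hy)⟩

/-- A bounded nonempty subset of a linear order has a greatest element. -/
theorem IsLinOrd.exists_greatest_of_bounded (hR : R ∈ A.sets)
    (hlin : A.IsLinOrd L R) {S : Set A.Num} (hS : S ∈ A.sets) (hSL : S ⊆ L) (hne : S.Nonempty)
    {b : A.Num} (hb : ∀ x ∈ S, x < b) : ∃ x ∈ S, ∀ y ∈ S, ¬ A.Rel R x y := by
  have := Fact.mk hR
  set R' : Set A.Num := {p | ∃ x y, p = A.pair x y ∧ A.pair y x ∈ R} with hR'
  have h1 : R' ∈ A.sets := mem_sets inferInstance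
  have e : ∀ x y, A.Rel R' x y ↔ A.Rel R y x := fun x y => by
    constructor
    · rintro ⟨x', y', h, h'⟩
      obtain ⟨rfl, rfl⟩ := pair_inj.1 h
      exact h'
    · exact fun h => ⟨x, y, rfl, h⟩
  have hlin' : A.IsLinOrd L R' := by
    refine ⟨fun x hx => ?_, fun x hx y hy z hz => ?_, fun x hx y hy => ?_⟩
    · rw [e]; exact hlin.irrefl x hx
    · simp only [e]; exact fun h h' => hlin.trans z hz y hy x hx h' h
    · simp only [e]
      rcases hlin.total x hx y hy with h | h | h
      exacts [.inr (.inr h), .inr (.inl h), .inl h]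
  simpa only [e] using hlin'.exists_least_of_bounded h1 hS hSL hne hb

theorem IsLinOrd.asymm {A : Model.{u}} {L R : Set A.Num} (hlin : A.IsLinOrd L R) {x y : A.Num}
    (hx : x ∈ L) (hy : y ∈ L) (h : A.Rel R x y) : ¬ A.Rel R y x :=
  fun h' => hlin.irrefl x hx (hlin.trans x hx y hy x hx h h')

/-- The arithmetical description of `V_l` is correct. -/
theorem succClosure_eq_vset (hL : L ∈ A.sets) (hR : R ∈ A.sets) (hlin : A.IsLinOrd L R)
    {l : A.Num} (hl : l ∈ L) : A.succClosure L R l = A.vset L R l := by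
  have := Fact.mk hL
  have := Fact.mk hR
  ext x
  constructor
  · rintro ⟨hx, h⟩
    -- The described set is itself one of the sets over which the closure is intersected; it remains
    -- to check its closure properties.
    refine h _ (mem_sets (by unfold Model.vset; infer_instance)) (fun y hy => hy.1)
      ⟨hl, .inr (.inl rfl)⟩ ?_ ?_
    · rintro y ⟨hy, h | rfl | ⟨h, b, hb⟩⟩ z hz hzy
      · exact ⟨hz, .inl (hlin.trans _ hz _ hy _ hl hzy h)⟩
      · exact ⟨hz, .inl hzy⟩
      · rcases hlin.total z hz l hl with h' | h' | h'
        · exact ⟨hz, .inl h'⟩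
        · exact ⟨hz, .inr (.inl h')⟩
        · refine ⟨hz, .inr (.inr ⟨h', b, fun w hw hlw hwz => hb w hw hlw (.inl ?_)⟩)⟩
          rcases hwz with hwz | rfl
          exacts [hlin.trans _ hw _ hz _ hy hwz hzy, hzy]
    · rintro y ⟨hy, h⟩ z ⟨hz, hyz, hno⟩
      rcases hlin.total z hz l hl with h' | h' | h'
      · exact ⟨hz, .inl h'⟩
      · exact ⟨hz, .inr (.inl h')⟩
      · refine ⟨hz, .inr (.inr ⟨h', ?_⟩)⟩
        rcases h with h | rfl | ⟨h, b, hb⟩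
        · exact absurd ⟨l, hl, h, h'⟩ hno
        · refine ⟨z + 1, fun w hw hlw hwz => ?_⟩
          rcases hwz with hwz | rfl
          · exact absurd ⟨w, hw, hlw, hwz⟩ hno
          · exact lt_add_one_iff.2 le_rfl
        · refine ⟨b + z + 1, fun w hw hlw hwz => ?_⟩
          rcases hwz with hwz | rfl
          · refine (hb w hw hlw ?_).trans (lt_add_one_iff.2 le_self_add)
            rcases hlin.total w hw y hy with h1 | h1 | h1
            exacts [.inl h1, .inr h1, absurd ⟨w, hw, h1, hwz⟩ hno]
          · exact lt_add_one_iff.2 le_add_self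
  · rintro ⟨hx, h⟩
    refine ⟨hx, fun Y hY hYL hlY hdown hsucc => ?_⟩
    rcases h with h | rfl | ⟨h, b, hb⟩
    · exact hdown l hlY x hx h
    · exact hlY
    -- Finiteness of `]l, x]` gives a least point `y` of it outside `Y`, and a greatest point `z` of
    -- `[l, y[`. Then `z` is in `Y` and `y` is its immediate successor, a contradiction.
    · by_contra hxY
      have := Fact.mk hY
      have h1 : {y | y ∈ L ∧ A.pair l y ∈ R ∧ (A.pair y x ∈ R ∨ y = x) ∧ y ∉ Y} ∈ A.sets :=
        mem_sets inferInstance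
      obtain ⟨y, ⟨hy, hly, hyx, hyY⟩, hmin⟩ := hlin.exists_least_of_bounded hR h1
        (fun y hy => hy.1) ⟨x, hx, h, .inr rfl, hxY⟩ (fun y hy => hb y hy.1 hy.2.1 hy.2.2.1)
      have h2 : {z | z ∈ L ∧ (A.pair l z ∈ R ∨ z = l) ∧ A.pair z y ∈ R} ∈ A.sets :=
        mem_sets inferInstance
      obtain ⟨z, ⟨hz, hlz, hzy⟩, hmax⟩ := hlin.exists_greatest_of_bounded hR h2
        (b := b + l + 1) (fun y hy => hy.1) ⟨l, hl, .inr rfl, hly⟩ (fun z hz => by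
          obtain ⟨hz, hlz | rfl, hzy⟩ := hz
          · refine (hb z hz hlz (.inl ?_)).trans (lt_add_one_iff.2 le_self_add)
            rcases hyx with hyx | rfl
            exacts [hlin.trans _ hz _ hy _ hx hzy hyx, hzy]
          · exact lt_add_one_iff.2 le_add_self)
      have hzY : z ∈ Y := by
        by_contra hzY
        rcases hlz with hlz | rfl
        · refine hmin z ⟨hz, hlz, .inl ?_, hzY⟩ hzy
          rcases hyx with hyx | rfl
          exacts [hlin.trans _ hz _ hy _ hx hzy hyx, hzy]
        · exact hzY hlY
      refine hyY (hsucc z hzY y ⟨hy, hzy, ?_⟩)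
      rintro ⟨w, hw, hzw, hwy⟩
      refine hmax w ⟨hw, .inl ?_, hwy⟩ hzw
      rcases hlz with hlz | rfl
      exacts [hlin.trans _ hl _ hz _ hw hlz hzw, hzw]

theorem mem_vset_self {A : Model.{u}} {L R : Set A.Num} {l : A.Num} (hl : l ∈ L) :
    l ∈ A.vset L R l := ⟨hl, .inr (.inl rfl)⟩

theorem vset_subset (hL : L ∈ A.sets) (hR : R ∈ A.sets) (hlin : A.IsLinOrd L R)
    {l : A.Num} (hl : l ∈ L) {Y : Set A.Num} (hY : Y ∈ A.sets) (hYL : Y ⊆ L) (hlY : l ∈ Y)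
    (hdown : ∀ y ∈ Y, ∀ z ∈ L, A.Rel R z y → z ∈ Y)
    (hsucc : ∀ y ∈ Y, ∀ z, A.IsSuccOf L R y z → z ∈ Y) : A.vset L R l ⊆ Y := by
  rw [← succClosure_eq_vset hL hR hlin hl]
  exact fun x hx => hx.2 Y hY hYL hlY hdown hsucc

theorem vset_down (hL : L ∈ A.sets) (hR : R ∈ A.sets) (hlin : A.IsLinOrd L R)
    {l : A.Num} (hl : l ∈ L) {y z : A.Num} (hy : y ∈ A.vset L R l) (hz : z ∈ L)
    (hzy : A.Rel R z y) : z ∈ A.vset L R l := by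
  rw [← succClosure_eq_vset hL hR hlin hl] at hy ⊢
  exact ⟨hz, fun Y hY hYL hlY hdown hsucc =>
    hdown y (hy.2 Y hY hYL hlY hdown hsucc) z hz hzy⟩

theorem vset_succ (hL : L ∈ A.sets) (hR : R ∈ A.sets) (hlin : A.IsLinOrd L R)
    {l : A.Num} (hl : l ∈ L) {y z : A.Num} (hy : y ∈ A.vset L R l)
    (hyz : A.IsSuccOf L R y z) : z ∈ A.vset L R l := by
  rw [← succClosure_eq_vset hL hR hlin hl] at hy ⊢
  exact ⟨hyz.1, fun Y hY hYL hlY hdown hsucc =>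
    hsucc y (hy.2 Y hY hYL hlY hdown hsucc) z hyz⟩

theorem vset_mono (hL : L ∈ A.sets) (hR : R ∈ A.sets) (hlin : A.IsLinOrd L R)
    {l l' : A.Num} (hl : l ∈ L) (hl' : l' ∈ L) (h : A.Rel R l l') :
    A.vset L R l ⊆ A.vset L R l' := by
  have := Fact.mk hL
  have := Fact.mk hR
  refine vset_subset hL hR hlin hl (mem_sets (by unfold Model.vset; infer_instance))
    (fun y hy => hy.1) (vset_down hL hR hlin hl' (mem_vset_self hl') hl h)
    (fun y hy z hz => vset_down hL hR hlin hl' hy hz) (fun y hy z => vset_succ hL hR hlin hl' hy)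

theorem topU_mem_sets (hL : L ∈ A.sets) (hR : R ∈ A.sets) : A.topU L R ∈ A.sets := by
  have := Fact.mk hL
  have := Fact.mk hR
  exact mem_sets (Sig.DS.topU (σ := A.fix))

theorem topK_mem_sets {U : Set A.Num} (hU : U ∈ A.sets) : A.topK U ∈ A.sets := by
  have := Fact.mk hU
  exact mem_sets (Sig.DS.topK (σ := A.fix))

theorem exists_vset_inter (hL : L ∈ A.sets) (hR : R ∈ A.sets) (hlin : A.IsLinOrd L R)
    {l l' x : A.Num} (hl : l ∈ L) (hl' : l' ∈ L) (h : x ∈ A.vset L R l)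
    (h' : x ∈ A.vset L R l') : ∃ m ∈ L, x ∈ A.vset L R m ∧
      A.vset L R m ⊆ A.vset L R l ∧ A.vset L R m ⊆ A.vset L R l' := by
  rcases hlin.total l hl l' hl' with h1 | rfl | h1
  · exact ⟨l, hl, h, subset_rfl, vset_mono hL hR hlin hl hl' h1⟩
  · exact ⟨l, hl, h, subset_rfl, subset_rfl⟩
  · exact ⟨l', hl', h', vset_mono hL hR hlin hl' hl h1, subset_rfl⟩

theorem isCSCS_top (hL : L ∈ A.sets) (hR : R ∈ A.sets) (hlin : A.IsLinOrd L R) :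
    A.IsCSCS L (A.topU L R) (A.topK (A.topU L R)) := by
  refine isCSCS_topK (topU_mem_sets hL hR) (fun i x hx => ?_) (fun x hx => ?_)
    (fun x i j hi hj => ?_)
  · rw [sec_topU] at hx
    obtain ⟨l, e, -, -, h, -⟩ := hx
    exact h.1
  · refine ⟨A.pair x 0, ?_⟩
    rw [sec_topU]
    exact ⟨x, 0, rfl, hx, mem_vset_self hx, .inl rfl⟩
  · unfold IsRefinement
    simp only [sec_topU] at hi hj ⊢
    obtain ⟨l, e, rfl, hl, hx, he⟩ := hi
    obtain ⟨l', e', rfl, hl', hx', he'⟩ := hj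
    obtain ⟨m, hm, hxm, h1, h2⟩ := exists_vset_inter hL hR hlin hl hl' hx hx'
    -- The second index component of an intersection: two rays intersect in the one with the larger
    -- endpoint, and `0` stands for no ray.
    have key : ∃ f, (f = 0 ∨ ∃ a, f = a + 1 ∧ a ∈ L ∧ A.pair a x ∈ R) ∧ ∀ y ∈ L,
        (f = 0 ∨ ∃ a, f = a + 1 ∧ a ∈ L ∧ A.pair a y ∈ R) →
        (e = 0 ∨ ∃ a, e = a + 1 ∧ a ∈ L ∧ A.pair a y ∈ R) ∧
        (e' = 0 ∨ ∃ a, e' = a + 1 ∧ a ∈ L ∧ A.pair a y ∈ R) := by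
      rcases he with rfl | ⟨a, rfl, ha, hax⟩
      · exact ⟨e', he', fun y _ h => ⟨.inl rfl, h⟩⟩
      rcases he' with rfl | ⟨a', rfl, ha', hax'⟩
      · exact ⟨_, .inr ⟨a, rfl, ha, hax⟩, fun y _ h => ⟨h, .inl rfl⟩⟩
      have hne : ∀ a : A.Num, a + 1 ≠ 0 := fun a => (lt_add_one_iff.2 zero_le).ne'
      rcases hlin.total a ha a' ha' with h | rfl | h
      · refine ⟨_, .inr ⟨a', rfl, ha', hax'⟩, fun y hy hf => ⟨.inr ⟨a, rfl, ha, ?_⟩, hf⟩⟩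
        obtain h0 | ⟨b, hb, -, hby⟩ := hf
        · exact absurd h0 (hne _)
        · obtain rfl := add_right_cancel hb
          exact hlin.trans _ ha _ ha' _ hy h hby
      · exact ⟨_, .inr ⟨a, rfl, ha, hax⟩, fun y _ h => ⟨h, h⟩⟩
      · refine ⟨_, .inr ⟨a, rfl, ha, hax⟩, fun y hy hf => ⟨hf, .inr ⟨a', rfl, ha', ?_⟩⟩⟩
        obtain h0 | ⟨b, hb, -, hby⟩ := hf
        · exact absurd h0 (hne _)
        · obtain rfl := add_right_cancel hb
          exact hlin.trans _ ha' _ ha _ hy h hby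
    obtain ⟨f, hf, hf'⟩ := key
    refine ⟨A.pair m f, ⟨m, f, rfl, hm, hxm, hf⟩, ?_⟩
    rintro y ⟨m', f', h, -, hym, hyf⟩
    obtain ⟨rfl, rfl⟩ := pair_inj.1 h
    have := hf' y hym.1 hyf
    exact ⟨⟨l, e, rfl, hl, h1 hym, this.1⟩, ⟨l', e', rfl, hl', h2 hym, this.2⟩⟩

theorem topology_eq_generateFrom_topU (hL : L ∈ A.sets) (hR : R ∈ A.sets)
    (hlin : A.IsLinOrd L R) : A.topL L R = TopologicalSpace.generateFrom
      {G : Set L | ∃ i, G = Subtype.val ⁻¹' A.sec (A.topU L R) i} := by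
  apply le_antisymm
  · refine le_generateFrom ?_
    rintro G ⟨i, rfl⟩
    rw [sec_topU]
    let _ := A.topL L R
    by_cases hi : ∃ l e, i = A.pair l e ∧ l ∈ L ∧ (e = 0 ∨ ∃ a, e = a + 1 ∧ a ∈ L)
    · obtain ⟨l, e, rfl, hl, he⟩ := hi
      have hV : IsOpen (Subtype.val ⁻¹' A.vset L R l : Set L) := by
        rw [← succClosure_eq_vset hL hR hlin hl]
        exact TopologicalSpace.isOpen_generateFrom_of_mem (.inl ⟨l, hl, rfl⟩)
      rcases he with rfl | ⟨a, rfl, ha⟩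
      · convert hV using 2
        ext x
        constructor
        · rintro ⟨l', e, h, -, hx, -⟩
          rwa [(pair_inj.1 h).1]
        · exact fun h => ⟨l, 0, rfl, hl, h, .inl rfl⟩
      · have hr : IsOpen (Subtype.val ⁻¹' A.ray L R a : Set L) :=
          TopologicalSpace.isOpen_generateFrom_of_mem (.inr ⟨a, ha, rfl⟩)
        convert hV.inter hr using 1
        ext x
        constructor
        · rintro ⟨l', e, h, -, hx, h'⟩
          obtain ⟨rfl, rfl⟩ := pair_inj.1 h
          refine ⟨hx, x.2, ?_⟩
          rcases h' with h' | ⟨a', h', -, hax⟩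
          · exact absurd h' (lt_add_one_iff.2 zero_le).ne'
          · obtain rfl := add_right_cancel h'
            exact hax
        · exact fun h => ⟨l, _, rfl, hl, h.1, .inr ⟨a, rfl, ha, h.2.2⟩⟩
    -- Numbers that are not proper indices yield the empty set.
    · convert isOpen_empty using 1
      ext x
      simp only [Set.mem_preimage, Set.mem_empty_iff_false, iff_false]
      rintro ⟨l, e, h, hl, -, he⟩
      refine hi ⟨l, e, h, hl, ?_⟩
      rcases he with he | ⟨a, h, ha, -⟩
      exacts [.inl he, .inr ⟨a, h, ha⟩]
  · refine le_generateFrom ?_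
    let _ := TopologicalSpace.generateFrom
      {G : Set L | ∃ i, G = Subtype.val ⁻¹' A.sec (A.topU L R) i}
    have hopen : ∀ i, IsOpen (Subtype.val ⁻¹' A.sec (A.topU L R) i : Set L) := fun i =>
      TopologicalSpace.isOpen_generateFrom_of_mem ⟨i, rfl⟩
    simp only [sec_topU] at hopen
    rintro G (⟨l, hl, rfl⟩ | ⟨a, ha, rfl⟩)
    · rw [succClosure_eq_vset hL hR hlin hl]
      convert hopen (A.pair l 0) using 2
      ext x
      constructor
      · exact fun h => ⟨l, 0, rfl, hl, h, .inl rfl⟩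
      · rintro ⟨l', e, h, -, hx, -⟩
        rwa [(pair_inj.1 h).1]
    -- A ray is the union of its intersections with the sets `V_l`, since each point `x` lies in
    -- `V_x`.
    · convert isOpen_iUnion (fun l : L => hopen (A.pair l (a + 1))) using 1
      ext x
      simp only [Set.mem_preimage, Set.mem_iUnion]
      constructor
      · exact fun h => ⟨x, x, _, rfl, x.2, mem_vset_self x.2, .inr ⟨a, rfl, ha, h.2⟩⟩
      · rintro ⟨l, l', e, h, -, -, h'⟩
        obtain ⟨rfl, rfl⟩ := pair_inj.1 h
        rcases h' with h' | ⟨a', h', -, hax⟩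
        · exact absurd h' (lt_add_one_iff.2 zero_le).ne'
        · obtain rfl := add_right_cancel h'
          exact ⟨x.2, hax⟩

theorem presents_top (hL : L ∈ A.sets) (hR : R ∈ A.sets) (hlin : A.IsLinOrd L R) :
    A.Presents L (A.topU L R) (A.topK (A.topU L R)) (A.topL L R) :=
  ⟨isCSCS_top hL hR hlin, topology_eq_generateFrom_topU hL hR hlin⟩

/-- The open sets of a countable second countable space are the open sets of the topology that
it presents. -/
theorem Presents.isOpenIn_iff {A : Model.{u}} {X U K : Set A.Num} {τ : TopologicalSpace X}
    (h : A.Presents X U K τ) {G : Set A.Num} :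
    A.IsOpenIn X U G ↔ G ⊆ X ∧ @IsOpen X τ (Subtype.val ⁻¹' G) := by
  obtain ⟨h, rfl⟩ := h
  let _ := TopologicalSpace.generateFrom {G : Set X | ∃ i, G = Subtype.val ⁻¹' A.sec U i}
  have hb : TopologicalSpace.IsTopologicalBasis
      {G : Set X | ∃ i, G = Subtype.val ⁻¹' A.sec U i} := by
    refine ⟨?_, ?_, rfl⟩
    · rintro _ ⟨i, rfl⟩ _ ⟨j, rfl⟩ x ⟨hi, hj⟩
      obtain ⟨n, hn, -⟩ := h.total x x.2 i j
      obtain ⟨h1, h2⟩ := h.inter x x.2 i j n hi hj hn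
      exact ⟨_, ⟨n, rfl⟩, h1, fun y hy => h2 hy⟩
    · refine Set.eq_univ_of_forall fun x => ?_
      obtain ⟨i, hi⟩ := h.cover x x.2
      exact ⟨_, ⟨i, rfl⟩, hi⟩
  rw [hb.isOpen_iff]
  refine and_congr_right fun hG => ⟨fun H x hx => ?_, fun H x hx => ?_⟩
  · obtain ⟨i, h1, h2⟩ := H x hx
    exact ⟨_, ⟨i, rfl⟩, h1, fun y hy => h2 hy⟩
  · obtain ⟨_, ⟨i, rfl⟩, h1, h2⟩ := H ⟨x, hG hx⟩ hx
    exact ⟨i, h1, fun y hy => h2 (a := ⟨y, h.subset i hy⟩) hy⟩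

/-- Connectedness in the structure depends only on which sets are open, and the function `k` makes
the `U_i` a genuine basis. So it suffices to study one presentation of `Top(L)`. -/
theorem Presents.isConnectedIn_iff {A : Model.{u}} {X U K U' K' : Set A.Num}
    {τ : TopologicalSpace X} (h : A.Presents X U K τ) (h' : A.Presents X U' K' τ) :
    A.IsConnectedIn X U ↔ A.IsConnectedIn X U' := by
  unfold IsConnectedIn
  simp only [h.isOpenIn_iff, h'.isOpenIn_iff]

/-! ### Connectedness of `Top(L)` and well-foundedness of `L` -/

theorem isOpenIn_topU_iff {A : Model.{u}} [A.Ind] {L R G : Set A.Num} :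
    A.IsOpenIn L (A.topU L R) G ↔ G ⊆ L ∧ ∀ x ∈ G, ∃ i, x ∈ A.topBase L R i ∧
      A.topBase L R i ⊆ G := by
  simp only [IsOpenIn, sec_topU]

theorem isConnectedIn_top_of_isWellOrd (hL : L ∈ A.sets) (hR : R ∈ A.sets)
    (hlin : A.IsLinOrd L R) (hleast : A.HasLeast L R) (hwo : A.IsWellOrd L R) :
    A.IsConnectedIn L (A.topU L R) := by
  rw [isWellOrd_iff hL hR hlin] at hwo
  obtain ⟨b, hb, hbmin⟩ := hleast
  have key : ∀ G ∈ A.sets, ∀ H ∈ A.sets, A.IsOpenIn L (A.topU L R) G →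
      A.IsOpenIn L (A.topU L R) H → G.Nonempty → b ∈ H → G ∪ H = L → (G ∩ H).Nonempty := by
    intro G hG H hH hGo hHo hGne hbH hGH
    rw [isOpenIn_topU_iff] at hGo hHo
    by_contra hne
    have hdisj : ∀ x, x ∈ G → x ∉ H := fun x hx hx' => hne ⟨x, hx, hx'⟩
    obtain ⟨g, hg, hmin⟩ := hwo G hG hGo.1 hGne
    have hgL := hGo.1 hg
    have hbelow : ∀ y ∈ L, A.Rel R y g → y ∈ H := fun y hy hyg => by
      rw [← hGH] at hy
      exact hy.resolve_left fun hyG => hmin y hyG hyg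
    have hbg : A.Rel R b g := by
      rcases hbmin g hgL with rfl | h
      · exact absurd hbH (hdisj _ hg)
      · exact h
    obtain ⟨_, ⟨l, e, rfl, hl, hgl, he⟩, hsub⟩ := hGo.2 g hg
    -- `V_l` contains everything below `g`, and these points are in `H`; so it must be the ray that
    -- excludes all of them.
    have hnot : ∀ y ∈ L, A.Rel R y g →
        ¬ (e = 0 ∨ ∃ a, e = a + 1 ∧ a ∈ L ∧ A.pair a y ∈ R) := fun y hy hyg h =>
      hdisj y (hsub ⟨l, e, rfl, hl, vset_down hL hR hlin hl hgl hy hyg, h⟩) (hbelow y hy hyg)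
    rcases he with rfl | ⟨a, rfl, ha, hag⟩
    · exact hnot b hb hbg (.inl rfl)
    · have hsucc : A.IsSuccOf L R a g := ⟨hgL, hag, by
        rintro ⟨z, hz, haz, hzg⟩
        exact hnot z hz hzg (.inr ⟨a, rfl, ha, haz⟩)⟩
      -- A basic neighbourhood of `a` inside `H` contains the successor `g`: `V_l'` is closed under
      -- successors, and a ray through `a` passes through `g`.
      obtain ⟨_, ⟨l', e', rfl, hl', hal, he'⟩, hsub'⟩ := hHo.2 a (hbelow a ha hag)
      refine hdisj g hg (hsub' ⟨l', e', rfl, hl', vset_succ hL hR hlin hl' hal hsucc, ?_⟩)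
      rcases he' with h | ⟨c, h, hc, hca⟩
      · exact .inl h
      · exact .inr ⟨c, h, hc, hlin.trans _ hc _ ha _ hgL hca hag⟩
  intro G hG H hH hGo hHo hGne hHne hGH
  have hb' := hb
  rw [← hGH] at hb'
  rcases hb' with hb' | hb'
  · rw [Set.inter_comm]
    exact key H hH G hG hHo hGo hHne hb' (by rw [Set.union_comm, hGH])
  · exact key G hG H hH hGo hHo hGne hb' hGH

theorem isWellOrd_of_isConnectedIn_top (hL : L ∈ A.sets) (hR : R ∈ A.sets)
    (hlin : A.IsLinOrd L R) (hleast : A.HasLeast L R)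
    (hconn : A.IsConnectedIn L (A.topU L R)) : A.IsWellOrd L R := by
  refine ⟨hlin, ?_⟩
  rintro ⟨F, hF, hfun, hFL, hdesc⟩
  have := Fact.mk hL
  have := Fact.mk hR
  have := Fact.mk hF
  obtain ⟨b, hb, hbmin⟩ := hleast
  have hG : {x | x ∈ L ∧ ∃ n y, A.pair n y ∈ F ∧ A.pair y x ∈ R} ∈ A.sets :=
    mem_sets inferInstance
  have hH : {x | x ∈ L ∧ ¬ ∃ n y, A.pair n y ∈ F ∧ A.pair y x ∈ R} ∈ A.sets :=
    mem_sets inferInstance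
  refine (hconn _ hG _ hH ?_ ?_ ?_ ?_ ?_).elim fun x hx => hx.2.2 hx.1.2
  · rw [isOpenIn_topU_iff]
    refine ⟨fun x hx => hx.1, ?_⟩
    rintro x ⟨hx, n, y, hny, hyx⟩
    have hy := hFL _ _ hny
    refine ⟨A.pair x (y + 1), ⟨x, _, rfl, hx, mem_vset_self hx, .inr ⟨y, rfl, hy, hyx⟩⟩, ?_⟩
    rintro z ⟨l, e, h, -, hz, h'⟩
    obtain ⟨rfl, rfl⟩ := pair_inj.1 h
    rcases h' with h' | ⟨a, h', -, haz⟩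
    · exact absurd h' (lt_add_one_iff.2 zero_le).ne'
    · obtain rfl := add_right_cancel h'
      exact ⟨hz.1, n, _, hny, haz⟩
  · rw [isOpenIn_topU_iff]
    refine ⟨fun x hx => hx.1, fun x hx => ⟨A.pair x 0,
      ⟨x, _, rfl, hx.1, mem_vset_self hx.1, .inl rfl⟩, ?_⟩⟩
    rintro z ⟨l, e, h, -, hz, -⟩
    obtain ⟨rfl, rfl⟩ := pair_inj.1 h
    refine vset_subset hL hR hlin hx.1 hH (fun y hy => hy.1) hx ?_ ?_ hz
    · rintro y ⟨hy, hno⟩ w hw hwy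
      refine ⟨hw, ?_⟩
      rintro ⟨n, v, hnv, hvw⟩
      exact hno ⟨n, v, hnv, hlin.trans _ (hFL _ _ hnv) _ hw _ hy hvw hwy⟩
    · rintro y ⟨hy, hno⟩ w ⟨hw, hyw, hbetween⟩
      refine ⟨hw, ?_⟩
      rintro ⟨n, v, hnv, hvw⟩
      obtain ⟨v', hnv', -⟩ := hfun (n + 1)
      have hv := hFL _ _ hnv
      have hv' := hFL _ _ hnv'
      have hvv' := hdesc n v v' hnv hnv'
      -- If the term `v` is below the immediate successor of `y`, then `v ≤ y`, so the next term
      -- `v'` is strictly below `y`.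
      refine hno ⟨_, v', hnv', ?_⟩
      rcases hlin.total v hv y hy with h | rfl | h
      · exact hlin.trans _ hv' _ hv _ hy hvv' h
      · exact hvv'
      · exact absurd ⟨v, hv, h, hvw⟩ hbetween
  · obtain ⟨v, hv, -⟩ := hfun 0
    obtain ⟨v', hv', -⟩ := hfun (0 + 1)
    exact ⟨v, hFL _ _ hv, _, v', hv', hdesc _ _ _ hv hv'⟩
  · refine ⟨b, hb, ?_⟩
    rintro ⟨n, y, hny, hyb⟩
    have hy := hFL _ _ hny
    rcases hbmin y hy with rfl | h
    · exact hlin.irrefl _ hy hyb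
    · exact hlin.asymm hy hb hyb h
  · ext x
    constructor
    · rintro (h | h) <;> exact h.1
    · intro h
      by_cases h' : ∃ n y, A.pair n y ∈ F ∧ A.pair y x ∈ R
      exacts [.inl ⟨h, h'⟩, .inr ⟨h, h'⟩]

theorem isConnectedIn_top_iff (hL : L ∈ A.sets) (hR : R ∈ A.sets)
    (hlin : A.IsLinOrd L R) (hleast : A.HasLeast L R) :
    A.IsConnectedIn L (A.topU L R) ↔ A.IsWellOrd L R :=
  ⟨isWellOrd_of_isConnectedIn_top hL hR hlin hleast,
    isConnectedIn_top_of_isWellOrd hL hR hlin hleast⟩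

end Model
end SOA

namespace SOA

/-! ### Forcing an arithmetical formula by partial information -/

namespace Model

/-- `Frc A w B φ b v PY NY P N`: the formula `φ` is verified (`b = true`) or refuted
(`b = false`) by the information that the set variable `0` includes `PY` and is disjoint from
`NY`, and by a strategy of which `P` and `N` are the positive and the negative information.
Universal requirements are restricted to `B`. -/
def Frc (A : Model.{u}) (w : ℕ → Set A.Num) (B : Set A.Num) : Formula → Bool → (ℕ → A.Num) →
    Set A.Num → Set A.Num → Set A.Num → Set A.Num → Prop
  | .eq s t, b, v, _, _, _, _ => s.eval A v = t.eval A v ↔ b = true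
  | .lt s t, b, v, _, _, _, _ => A.lt (s.eval A v) (t.eval A v) ↔ b = true
  | .mem t 0, true, v, PY, _, _, _ => t.eval A v ∈ PY
  | .mem t 0, false, v, _, NY, _, _ => t.eval A v ∈ NY
  | .mem t (X + 1), b, v, _, _, _, _ => t.eval A v ∈ w X ↔ b = true
  | .neg φ, b, v, PY, NY, P, N => Frc A w B φ (!b) v PY NY P N
  | .imp φ ψ, true, v, PY, NY, P, N =>
    (A.pair (1 + 1) 0 ∈ P ∧ Frc A w B φ false v PY NY (A.sec P 0) (A.sec N 0)) ∨
      (A.pair (1 + 1) 0 ∈ N ∧ Frc A w B ψ true v PY NY (A.sec P 1) (A.sec N 1))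
  | .imp φ ψ, false, v, PY, NY, P, N =>
    Frc A w B φ true v PY NY (A.sec P 0) (A.sec N 0) ∧
      Frc A w B ψ false v PY NY (A.sec P 1) (A.sec N 1)
  | .all φ, true, v, PY, NY, P, N =>
    ∀ x, x ∈ B → Frc A w B φ true (push x v) PY NY (A.sec P (x + 1)) (A.sec N (x + 1))
  | .all φ, false, v, PY, NY, P, N => (∃ x, x ∈ A.sec P 0) ∧
    ∀ x, x ∈ B → x ∈ A.sec N 0 ∨ (x ∈ A.sec P 0 ∧
      Frc A w B φ false (push x v) PY NY (A.sec P (x + 1)) (A.sec N (x + 1)))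
  | .allSet _, _, _, _, _, _, _ => False

theorem sec_mono {A : Model.{u}} {P Q : Set A.Num} (h : P ⊆ Q) (j : A.Num) :
    A.sec P j ⊆ A.sec Q j := fun _ hx => h hx

theorem sec_compl {A : Model.{u}} (P : Set A.Num) (j : A.Num) :
    A.sec Pᶜ j = (A.sec P j)ᶜ := rfl

/-- All four information sets occur only positively, and `B` only restricts universal requirements.
Keeping negative information as a separate positive set is what makes this possible. -/
theorem Frc.mono {A : Model.{u}} {w : ℕ → Set A.Num} {B B' : Set A.Num} (hB : B' ⊆ B)
    {φ : Formula} {b : Bool} {v : ℕ → A.Num} {PY NY P N PY' NY' P' N' : Set A.Num}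
    (h : A.Frc w B φ b v PY NY P N) (hPY : PY ⊆ PY') (hNY : NY ⊆ NY') (hP : P ⊆ P')
    (hN : N ⊆ N') : A.Frc w B' φ b v PY' NY' P' N' := by
  induction φ generalizing b v P N P' N' with
  | eq | lt => exact h
  | mem t X =>
    cases X with
    | zero =>
      cases b
      exacts [hNY h, hPY h]
    | succ X => exact h
  | neg φ ih => exact ih (b := !b) h hP hN
  | imp φ ψ ih1 ih2 =>
    cases b with
    | false => exact ⟨ih1 h.1 (sec_mono hP _) (sec_mono hN _),
        ih2 h.2 (sec_mono hP _) (sec_mono hN _)⟩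
    | true =>
      rcases h with h | h
      · exact .inl ⟨hP h.1, ih1 h.2 (sec_mono hP _) (sec_mono hN _)⟩
      · exact .inr ⟨hN h.1, ih2 h.2 (sec_mono hP _) (sec_mono hN _)⟩
  | all φ ih =>
    cases b with
    | false => exact ⟨h.1.imp fun x hx => hP hx, fun x hx => (h.2 x (hB hx)).imp (fun h => hN h)
        fun h => ⟨hP h.1, ih h.2 (sec_mono hP _) (sec_mono hN _)⟩⟩
    | true => exact fun x hx => ih (h x (hB hx)) (sec_mono hP _) (sec_mono hN _)
  | allSet φ ih => exact h.elim

end Model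

namespace Sig
variable {σ : Sig.{u}}

theorem DS.weaken {Γ : Formula → Prop} [FormulaClass Γ] {X : σ.SetFn} (hX : σ.DS Γ X) :
    σ.DS Γ (fun i v => X i (fun k => v (k + 1))) := hX.comp fun _ => T.var _

/-- The recursion defining `Frc` runs over `φ` outside the structures, so for fixed `φ` it unfolds
to one arithmetical formula, the same for all structures of the family. -/
theorem D.frc {w : ∀ i, ℕ → Set (σ.M i).Num}
    (hw : ∀ j, σ.DS IsArithmetical (fun i _ => w i j)) {φ : Formula} (hφ : IsArithmetical φ)
    (b : Bool) {f : ∀ i, (ℕ → (σ.M i).Num) → ℕ → (σ.M i).Num}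
    (hf : ∀ k, σ.T (fun i v => f i v k)) {B PY NY P N : σ.SetFn}
    (hB : σ.DS IsArithmetical B) (hPY : σ.DS IsArithmetical PY) (hNY : σ.DS IsArithmetical NY)
    (hP : σ.DS IsArithmetical P) (hN : σ.DS IsArithmetical N) :
    σ.D IsArithmetical (fun i v => (σ.M i).Frc (w i) (B i v) φ b (f i v)
      (PY i v) (NY i v) (P i v) (N i v)) := by
  induction hφ generalizing b f B PY NY P N with
  | eq s t =>
    have h1 := T.of_eval s hf
    have h2 := T.of_eval t hf
    unfold Model.Frc
    infer_instance
  | lt s t =>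
    have h1 := T.of_eval s hf
    have h2 := T.of_eval t hf
    unfold Model.Frc
    infer_instance
  | mem t X =>
    have h1 := T.of_eval t hf
    cases X with
    | zero => cases b <;> (unfold Model.Frc; infer_instance)
    | succ X =>
      have := hw X
      unfold Model.Frc
      infer_instance
  | neg _ ih => exact ih (!b) hf hB hPY hNY hP hN
  | imp _ _ ih1 ih2 =>
    have h1 := fun b => ih1 b hf hB hPY hNY (P := fun i v => (σ.M i).sec (P i v) 0)
      (N := fun i v => (σ.M i).sec (N i v) 0) inferInstance inferInstance
    have h2 := fun b => ih2 b hf hB hPY hNY (P := fun i v => (σ.M i).sec (P i v) 1)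
      (N := fun i v => (σ.M i).sec (N i v) 1) inferInstance inferInstance
    cases b <;> (unfold Model.Frc; infer_instance)
  | all _ ih =>
    have hP' := hP.weaken
    have hN' := hN.weaken
    have hB' := hB.weaken
    have h1 := fun b => ih b (f := fun i v => SOA.push (v 0) (f i fun k => v (k + 1)))
      (T.push (T.var 0) fun k => (hf k).comp fun _ => T.var _) hB' hPY.weaken hNY.weaken
      (P := fun i v => (σ.M i).sec (P i fun k => v (k + 1)) (v 0 + 1))
      (N := fun i v => (σ.M i).sec (N i fun k => v (k + 1)) (v 0 + 1))
      inferInstance inferInstance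
    cases b <;> (unfold Model.Frc; infer_instance)

end Sig

namespace Model

/-- With `N` the complement of `P`, every choice of the strategy is decided, and the requirements
verify each choice by recursion on `φ`. -/
theorem Frc.sound {A : Model.{u}} {w : ℕ → A.sets} {Y : A.sets} {φ : Formula} {b : Bool}
    {v : ℕ → A.Num} {Z : Set A.Num}
    (h : A.Frc (fun j => (w j).1) Set.univ φ b v Y.1 Y.1ᶜ Z Zᶜ) :
    φ.Sat A v (push Y w) ↔ b = true := by
  induction φ generalizing b v Z with
  | eq | lt => exact h
  | mem t X =>
    cases X with
    | zero =>
      cases b with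
      | false =>
        have h' : t.eval A v ∉ Y.1 := h
        simpa [Formula.Sat, push] using h'
      | true =>
        have h' : t.eval A v ∈ Y.1 := h
        simpa [Formula.Sat, push] using h'
    | succ X => exact h
  | neg φ ih =>
    have h' := ih (b := !b) h
    cases b <;> simpa [Formula.Sat] using h'
  | imp φ ψ ih1 ih2 =>
    cases b with
    | false =>
      have h1 := ih1 (sec_compl Z 0 ▸ h.1)
      have h2 := ih2 (sec_compl Z 1 ▸ h.2)
      simp only [Formula.Sat, h1, h2]
      simp
    | true =>
      rcases h with h | h
      · have h1 := ih1 (sec_compl Z 0 ▸ h.2)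
        simp [Formula.Sat, h1]
      · have h2 := ih2 (sec_compl Z 1 ▸ h.2)
        simp [Formula.Sat, h2]
  | all φ ih =>
    cases b with
    | false =>
      obtain ⟨⟨x, hx⟩, h⟩ := h
      rcases h x trivial with h | ⟨-, h⟩
      · exact absurd hx h
      · have h1 := ih (sec_compl Z _ ▸ h)
        simp only [Formula.Sat, iff_false, Bool.false_eq_true]
        exact fun h' => by simpa using h1.1 (h' x)
    | true =>
      simp only [Formula.Sat, iff_true]
      exact fun x => (ih (sec_compl Z _ ▸ h x trivial)).2 rfl
  | allSet φ ih => exact h.elim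

/-- The canonical strategy for the arithmetical formula `φ`. -/
def canon (A : Model.{u}) (w : ℕ → A.sets) : Formula → (ℕ → A.Num) → Set A.Num
  | .neg φ, v => canon A w φ v
  | .imp φ ψ, v => {z | (∃ y, z = A.pair 0 y ∧ y ∈ canon A w φ v) ∨
      (∃ y, z = A.pair 1 y ∧ y ∈ canon A w ψ v) ∨ (z = A.pair (1 + 1) 0 ∧ ¬ φ.Sat A v w)}
  | .all φ, v => {z | (∃ x, z = A.pair 0 x ∧ ¬ φ.Sat A (push x v) w) ∨
      ∃ x y, z = A.pair (x + 1) y ∧ y ∈ canon A w φ (push x v)}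
  | .eq _ _, _ => ∅
  | .lt _ _, _ => ∅
  | .mem _ _, _ => ∅
  | .allSet _, _ => ∅

end Model

theorem Sig.DS.canon {A : Model.{u}} [hA : A.ACA] (w : ℕ → A.sets) {φ : Formula}
    (hφ : IsArithmetical φ) {f : PUnit.{u+2} → (ℕ → A.Num) → ℕ → A.Num}
    (hf : ∀ k, A.fix.T (fun i v => f i v k)) :
    A.fix.DS IsArithmetical (fun i v => A.canon w φ (f i v)) := by
  have h0 : A.fix.DS IsArithmetical (fun _ _ => (∅ : Set A.Num)) :=
    ⟨D.congr (P := fun _ _ => False) inferInstance fun _ _ => by simp⟩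
  induction hφ generalizing f with
  | eq | lt | mem => exact h0
  | neg _ ih => exact ih hf
  | imp hφ _ ih1 ih2 =>
    have hf1 : ∀ k, A.fix.T (fun i v => f i (fun k => v (k + 1)) k) :=
      fun k => (hf k).comp fun _ => T.var _
    have hf2 : ∀ k, A.fix.T (fun i v => f i (fun k => v (k + 1 + 1)) k) :=
      fun k => (hf k).comp fun _ => T.var _
    have h1 := ih1 hf2
    have h2 := ih2 hf2
    have h3 := D.of_sat (σ := A.fix) hφ hf1 (w := fun j _ => w j) fun _ => trivial
    unfold Model.canon
    infer_instance
  | all hφ ih =>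
    have h1 := ih (f := fun i v => SOA.push (v 1) (f i fun k => v (k + 1 + 1 + 1)))
      (T.push (T.var 1) fun k => (hf k).comp fun _ => T.var _)
    have h3 := D.of_sat (σ := A.fix) hφ
      (t := fun k i v => SOA.push (v 0) (f i fun k => v (k + 1 + 1)) k)
      (T.push (T.var 0) fun k => (hf k).comp fun _ => T.var _) (w := fun j _ => w j)
      fun _ => trivial
    unfold Model.canon
    infer_instance

namespace Model

/-- The canonical strategy makes true choices: it takes the premise of an implication exactly if the
premise fails, and collects all counterexamples to a universal formula. -/
theorem Frc.complete {A : Model.{u}} [A.Ind] {w : ℕ → A.sets} {Y : A.sets} {φ : Formula}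
    (hφ : IsArithmetical φ) {b : Bool} {v : ℕ → A.Num} (h : φ.Sat A v (push Y w) ↔ b = true) :
    A.Frc (fun j => (w j).1) Set.univ φ b v Y.1 Y.1ᶜ (A.canon (push Y w) φ v)
      (A.canon (push Y w) φ v)ᶜ := by
  have n01 : (0 : A.Num) ≠ 1 := zero_ne_one
  have n02 : (0 : A.Num) ≠ 1 + 1 := (add_pos_of_nonneg_of_pos zero_le zero_lt_one).ne
  have n12 : (1 : A.Num) ≠ 1 + 1 := (lt_add_one_iff.2 le_rfl).ne
  have n0s : ∀ x : A.Num, (0 : A.Num) ≠ x + 1 := fun x => (lt_add_one_iff.2 zero_le).ne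
  induction hφ generalizing b v with
  | eq | lt => exact h
  | mem t X =>
    cases X with
    | zero =>
      cases b with
      | false =>
        have h' : ¬ t.eval A v ∈ Y.1 := fun h' => by simpa using h.1 h'
        exact h'
      | true => exact h.2 rfl
    | succ X => exact h
  | neg _ ih =>
    refine ih (b := !b) ?_
    cases b <;> simpa [Formula.Sat] using h
  | @imp φ ψ _ _ ih1 ih2 =>
    set Z := A.canon (push Y w) (φ.imp ψ) v with hZ
    have e0 : A.sec Z 0 = A.canon (push Y w) φ v := by
      ext y
      simp only [hZ, mem_sec, canon, Set.mem_ofPred_eq, pair_inj]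
      simp [n01, n02]
    have e1 : A.sec Z 1 = A.canon (push Y w) ψ v := by
      ext y
      simp only [hZ, mem_sec, canon, Set.mem_ofPred_eq, pair_inj]
      simp [n01.symm, n12]
    have e2 : A.pair (1 + 1) 0 ∈ Z ↔ ¬ φ.Sat A v (push Y w) := by
      simp only [hZ, canon, Set.mem_ofPred_eq, pair_inj]
      simp [n12.symm, n02.symm]
    unfold Frc
    cases b with
    | false =>
      simp only [Formula.Sat, Bool.false_eq_true, iff_false, Classical.not_imp] at h
      simp only [sec_compl, e0, e1]
      exact ⟨ih1 (by simp [h.1]), ih2 (by simp [h.2])⟩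
    | true =>
      simp only [Formula.Sat, iff_true] at h
      simp only [sec_compl, e0, e1]
      by_cases hs : φ.Sat A v (push Y w)
      · exact .inr ⟨fun h' => e2.1 h' hs, ih2 (by simp [h hs])⟩
      · exact .inl ⟨e2.2 hs, ih1 (by simp [hs])⟩
  | @all φ _ ih =>
    set Z := A.canon (push Y w) (.all φ) v with hZ
    have e0 : ∀ x, x ∈ A.sec Z 0 ↔ ¬ φ.Sat A (push x v) (push Y w) := fun x => by
      simp only [hZ, mem_sec, canon, Set.mem_ofPred_eq, pair_inj]
      simp [n0s]
    have e1 : ∀ x, A.sec Z (x + 1) = A.canon (push Y w) φ (push x v) := fun x => by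
      ext y
      simp only [hZ, mem_sec, canon, Set.mem_ofPred_eq, pair_inj]
      simp [(n0s _).symm]
    unfold Frc
    cases b with
    | false =>
      simp only [Formula.Sat, Bool.false_eq_true, iff_false, not_forall] at h
      simp only [sec_compl, e1, Set.mem_compl_iff, e0, not_not]
      refine ⟨h, fun x _ => ?_⟩
      by_cases hs : φ.Sat A (push x v) (push Y w)
      · exact .inl hs
      · exact .inr ⟨hs, ih (by simp [hs])⟩
    | true =>
      simp only [Formula.Sat, iff_true] at h
      simp only [sec_compl, e1]
      exact fun x _ => ih (by simp [h x])

theorem setOf_lt_subset {A : Model.{u}} [A.Ind] {m n : A.Num} (h : m ≤ n) :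
    {x | x < m} ⊆ {x | x < n} := fun _ hx => lt_of_lt_of_le hx h

/-! ### Limits, finite stages and the Kleene normal form -/

/-- If all bounded requirements are satisfied, then so are the unbounded ones. -/
theorem Frc.limit {A : Model.{u}} [A.Ind] {w : ℕ → Set A.Num} {φ : Formula} {b : Bool}
    {v : ℕ → A.Num} {PY NY P N : Set A.Num} (hPN : ∀ z ∈ P, z ∉ N)
    (h : ∀ n, A.Frc w {x | x < n} φ b v PY NY P N) : A.Frc w Set.univ φ b v PY NY P N := by
  induction φ generalizing b v P N with
  | eq | lt => exact h 0
  | mem t X =>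
    cases X with
    | zero =>
      cases b
      exacts [h 0, h 0]
    | succ X => exact h 0
  | neg φ ih => exact ih (b := !b) hPN h
  | imp φ ψ ih1 ih2 =>
    cases b with
    | false => exact ⟨ih1 (fun z hz => hPN _ hz) fun n => (h n).1,
        ih2 (fun z hz => hPN _ hz) fun n => (h n).2⟩
    | true =>
      -- The bit `⟨2, 0⟩` fixes the disjunct once and for all; without it the chosen side could vary
      -- with `n`.
      by_cases hz : A.pair (1 + 1) 0 ∈ P
      · exact .inl ⟨hz, ih1 (fun z hz => hPN _ hz)
          fun n => ((h n).resolve_right fun h' => hPN _ hz h'.1).2⟩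
      · refine .inr ⟨((h 0).resolve_left fun h' => hz h'.1).1, ih2 (fun z hz => hPN _ hz)
          fun n => ((h n).resolve_left fun h' => hz h'.1).2⟩
  | all φ ih =>
    cases b with
    | false =>
      -- The strategy names a nonempty set of counterexamples and all its members must be correct. A
      -- single existential witness could change with `n`, whereas this requirement passes to the
      -- limit.
      refine ⟨(h 0).1, fun x _ => ?_⟩
      by_cases hx : x ∈ A.sec N 0
      · exact .inl hx
      · have h1 := fun n => ((h (n + x + 1)).2 x (lt_add_one_iff.2 le_add_self)).resolve_left hx
        exact .inr ⟨(h1 0).1, ih (fun z hz => hPN _ hz) fun n => (h1 n).2.mono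
          (setOf_lt_subset (le_self_add.trans (lt_add_one_iff.2 le_rfl).le))
          subset_rfl subset_rfl subset_rfl subset_rfl⟩
    | true =>
      refine fun x _ => ih (fun z hz => hPN _ hz) fun n =>
        (h (n + x + 1) x (lt_add_one_iff.2 le_add_self)).mono
          (setOf_lt_subset (le_self_add.trans (lt_add_one_iff.2 le_rfl).le))
          subset_rfl subset_rfl subset_rfl subset_rfl
  | allSet φ ih => exact (h 0).elim

variable {A : Model.{u}} [hA : A.ACA]

/-- Collection for arithmetical relations. -/
theorem exists_bound {Q : A.Num → A.Num → Prop}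
    (hQ : A.fix.D IsArithmetical (fun _ v => Q (v 0) (v 1)))
    (hmono : ∀ x l m, l ≤ m → Q x l → Q x m) (h : ∀ x, ∃ l, Q x l) (n : A.Num) :
    ∃ l, ∀ x, x < n → Q x l := by
  have : ∀ {s t : A.fix.Fn} [A.fix.T s] [A.fix.T t],
      A.fix.D IsArithmetical (fun i v => Q (s i v) (t i v)) := fun {s t} hs ht =>
    hQ.comp (g := fun i v => SOA.push (s i v) (SOA.push (t i v) v))
      (Sig.T.push hs (Sig.T.push ht fun _ => Sig.T.var _))
  refine arith_induction (P := fun n => ∃ l, ∀ x, x < n → Q x l)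
    ⟨0, fun x hx => absurd hx (Model.not_lt_zero' x)⟩ ?_ n
  rintro n ⟨l, hl⟩
  obtain ⟨m, hm⟩ := h n
  refine ⟨l + m, fun x hx => ?_⟩
  rcases (lt_add_one_iff.1 hx).lt_or_eq with hx | rfl
  · exact hmono _ _ _ le_self_add (hl x hx)
  · exact hmono _ _ _ le_add_self hm

/-- Forcing is witnessed at a finite stage. -/
theorem Frc.exists_stage {w : ℕ → Set A.Num}
    (hw : ∀ j, w j ∈ A.sets) {φ : Formula} (hφ : IsArithmetical φ) (n : A.Num) {b : Bool}
    {v : ℕ → A.Num} {PY NY P N : A.Num → Set A.Num}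
    (mPY : Monotone PY) (mNY : Monotone NY) (mP : Monotone P) (mN : Monotone N)
    (dPY : A.fix.DS IsArithmetical (fun _ v => PY (v 0)))
    (dNY : A.fix.DS IsArithmetical (fun _ v => NY (v 0)))
    (dP : A.fix.DS IsArithmetical (fun _ v => P (v 0)))
    (dN : A.fix.DS IsArithmetical (fun _ v => N (v 0)))
    (h : A.Frc w Set.univ φ b v {z | ∃ l, z ∈ PY l} {z | ∃ l, z ∈ NY l}
      {z | ∃ l, z ∈ P l} {z | ∃ l, z ∈ N l}) :
    ∃ l, A.Frc w {x | x < n} φ b v (PY l) (NY l) (P l) (N l) := by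
  have hw' : ∀ j, A.fix.DS IsArithmetical (fun _ _ => w j) := fun j => Sig.DS.fix_const (hw j)
  have dsec : ∀ {P : A.Num → Set A.Num}, A.fix.DS IsArithmetical (fun _ v => P (v 0)) → ∀ x,
      A.fix.DS IsArithmetical (fun _ v => A.sec (P (v 0)) x) := fun h x => inferInstance
  have msec : ∀ {P : A.Num → Set A.Num}, Monotone P → ∀ x, Monotone (fun l => A.sec (P l) x) :=
    fun h x l m hlm => sec_mono (h hlm) x
  have d1 : ∀ {P : A.Num → Set A.Num}, A.fix.DS IsArithmetical (fun _ v => P (v 0)) →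
      A.fix.DS IsArithmetical (fun _ v => P (v 1)) :=
    fun h => h.comp (g := fun _ v k => v (k + 1)) fun _ => Sig.T.var _
  have dB : A.fix.DS IsArithmetical (fun _ _ => {x | x < n}) := inferInstance
  induction hφ generalizing b v P N with
  | eq | lt => exact ⟨0, h⟩
  | mem t X =>
    cases X with
    | zero => cases b <;> exact h
    | succ X => exact ⟨0, h⟩
  | neg _ ih => exact ih (b := !b) mP mN dP dN h
  | imp _ _ ih1 ih2 =>
    cases b with
    | false =>
      obtain ⟨l, hl⟩ := ih1 (msec mP 0) (msec mN 0) (dsec dP 0) (dsec dN 0) h.1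
      obtain ⟨m, hm⟩ := ih2 (msec mP 1) (msec mN 1) (dsec dP 1) (dsec dN 1) h.2
      exact ⟨l + m, hl.mono subset_rfl (mPY le_self_add) (mNY le_self_add)
          (msec mP 0 le_self_add) (msec mN 0 le_self_add),
        hm.mono subset_rfl (mPY le_add_self) (mNY le_add_self)
          (msec mP 1 le_add_self) (msec mN 1 le_add_self)⟩
    | true =>
      rcases h with ⟨⟨m, hm⟩, h⟩ | ⟨⟨m, hm⟩, h⟩
      · obtain ⟨l, hl⟩ := ih1 (msec mP 0) (msec mN 0) (dsec dP 0) (dsec dN 0) h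
        exact ⟨l + m, .inl ⟨mP le_add_self hm, hl.mono subset_rfl (mPY le_self_add)
          (mNY le_self_add) (msec mP 0 le_self_add) (msec mN 0 le_self_add)⟩⟩
      · obtain ⟨l, hl⟩ := ih2 (msec mP 1) (msec mN 1) (dsec dP 1) (dsec dN 1) h
        exact ⟨l + m, .inr ⟨mN le_add_self hm, hl.mono subset_rfl (mPY le_self_add)
          (mNY le_self_add) (msec mP 1 le_self_add) (msec mN 1 le_self_add)⟩⟩
  | @all φ hφ ih =>
    have dQ : ∀ b, A.fix.D IsArithmetical (fun _ u => A.Frc w {x | x < n} φ b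
        (push (u 0) v) (PY (u 1)) (NY (u 1)) (A.sec (P (u 1)) (u 0 + 1))
        (A.sec (N (u 1)) (u 0 + 1))) := fun b => by
      have h1 := d1 dP
      have h2 := d1 dN
      exact Sig.D.frc (σ := A.fix) (w := fun _ => w) hw' hφ b (f := fun _ u => push (u 0) v)
        (Sig.T.push (Sig.T.var 0) fun k => Sig.T.fix_const _) dB (d1 dPY) (d1 dNY)
        (P := fun _ u => A.sec (P (u 1)) (u 0 + 1)) (N := fun _ u => A.sec (N (u 1)) (u 0 + 1))
        inferInstance inferInstance
    have hmono : ∀ b x l m, l ≤ m →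
        A.Frc w {x | x < n} φ b (push x v) (PY l) (NY l) (A.sec (P l) (x + 1))
          (A.sec (N l) (x + 1)) →
        A.Frc w {x | x < n} φ b (push x v) (PY m) (NY m) (A.sec (P m) (x + 1))
          (A.sec (N m) (x + 1)) := fun b x l m hlm h =>
      h.mono subset_rfl (mPY hlm) (mNY hlm) (msec mP _ hlm) (msec mN _ hlm)
    cases b with
    | false =>
      obtain ⟨⟨x, l, hx⟩, h⟩ := h
      -- Only the points below `n` impose requirements, so collection gives one stage for all of
      -- them; stages are monotone.
      obtain ⟨m, hm⟩ := exists_bound (Q := fun x l => x ∈ A.sec (N l) 0 ∨ (x ∈ A.sec (P l) 0 ∧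
        A.Frc w {x | x < n} φ false (push x v) (PY l) (NY l) (A.sec (P l) (x + 1))
          (A.sec (N l) (x + 1)))) (by
            have h1 := d1 dP
            have h2 := d1 dN
            have h3 := dQ false
            infer_instance)
          (fun x l m hlm h => h.imp (fun h => mN hlm h)
            fun h => ⟨mP hlm h.1, hmono _ _ _ _ hlm h.2⟩)
          (fun x => by
            rcases h x trivial with ⟨l, hl⟩ | ⟨⟨l, hl⟩, h⟩
            · exact ⟨l, .inl hl⟩
            · obtain ⟨m, hm⟩ := ih (msec mP (x + 1)) (msec mN (x + 1)) (dsec dP (x + 1))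
                (dsec dN (x + 1)) h
              exact ⟨l + m, .inr ⟨mP le_self_add hl, hmono _ _ _ _ le_add_self hm⟩⟩) n
      exact ⟨l + m, ⟨x, mP le_self_add hx⟩, fun x hx => (hm x hx).imp
        (fun h => mN le_add_self h)
        fun h => ⟨mP le_add_self h.1, hmono _ _ _ _ le_add_self h.2⟩⟩
    | true => exact exists_bound (dQ true) (hmono true) (fun x =>
        ih (msec mP (x + 1)) (msec mN (x + 1)) (dsec dP (x + 1)) (dsec dN (x + 1))
          (h x trivial)) n

/-- The requirements up to `n` on a set that codes a counterexample to `φ` together with a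
strategy. -/
def Refutes (A : Model.{u}) (w : ℕ → Set A.Num) (φ : Formula) (v : ℕ → A.Num) (n : A.Num)
    (P N : Set A.Num) : Prop :=
  A.Frc w {x | x < n} φ false v (A.sec P 0) (A.sec N 0) (A.sec P 1) (A.sec N 1)

/-- Kleene normal form: a counterexample to an arithmetical formula exists if and only if there
is a set whose finite parts satisfy all requirements. -/
theorem exists_not_sat_iff {φ : Formula} (hφ : IsArithmetical φ) (v : ℕ → A.Num)
    (w : ℕ → A.sets) : (∃ Y : A.sets, ¬ φ.Sat A v (push Y w)) ↔
      ∃ Z ∈ A.sets, ∀ n, ∃ l, A.Refutes (fun j => (w j).1) φ v n {z | z < l ∧ z ∈ Z}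
        {z | z < l ∧ z ∉ Z} := by
  constructor
  · rintro ⟨Y, hY⟩
    have dY : A.fix.DS IsArithmetical (fun _ _ => Y.1) := Sig.DS.fix_const Y.2
    have dC : A.fix.DS IsArithmetical (fun _ _ => A.canon (push Y w) φ v) :=
      Sig.DS.canon _ hφ fun _ => Sig.T.fix_const _
    -- Section `0` of `Z` is the counterexample, section `1` the canonical strategy.
    have hZ : {z | (∃ y, z = A.pair 0 y ∧ y ∈ Y.1) ∨
        ∃ y, z = A.pair 1 y ∧ y ∈ A.canon (push Y w) φ v} ∈ A.sets := mem_sets inferInstance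
    set Z := {z | (∃ y, z = A.pair 0 y ∧ y ∈ Y.1) ∨
        ∃ y, z = A.pair 1 y ∧ y ∈ A.canon (push Y w) φ v} with hZdef
    have e0 : A.sec Z 0 = Y.1 := by
      ext y
      simp only [hZdef, mem_sec, Set.mem_ofPred_eq, pair_inj]
      simp
    have e1 : A.sec Z 1 = A.canon (push Y w) φ v := by
      ext y
      simp only [hZdef, mem_sec, Set.mem_ofPred_eq, pair_inj]
      simp
    have := Fact.mk hZ
    refine ⟨Z, hZ, fun n => ?_⟩
    refine Frc.exists_stage (fun j => (w j).2) hφ n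
      (PY := fun l => A.sec {z | z < l ∧ z ∈ Z} 0) (NY := fun l => A.sec {z | z < l ∧ z ∉ Z} 0)
      (P := fun l => A.sec {z | z < l ∧ z ∈ Z} 1) (N := fun l => A.sec {z | z < l ∧ z ∉ Z} 1)
      ?_ ?_ ?_ ?_ inferInstance inferInstance inferInstance inferInstance ?_
    any_goals
      intro l m hlm
      apply sec_mono
      rintro z ⟨h1, h2⟩
      exact ⟨h1.trans_le hlm, h2⟩
    have h1 : ∀ j, {z | ∃ l, z ∈ A.sec {z | z < l ∧ z ∈ Z} j} = A.sec Z j := fun j => by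
      ext y
      exact ⟨fun ⟨l, h⟩ => h.2, fun h => ⟨A.pair j y + 1, lt_add_one_iff.2 le_rfl, h⟩⟩
    have h2 : ∀ j, {z | ∃ l, z ∈ A.sec {z | z < l ∧ z ∉ Z} j} = (A.sec Z j)ᶜ := fun j => by
      ext y
      exact ⟨fun ⟨l, h⟩ => h.2, fun h => ⟨A.pair j y + 1, lt_add_one_iff.2 le_rfl, h⟩⟩
    rw [h1, h2, h1, h2, e0, e1]
    exact Frc.complete hφ (by simp [hY])
  · rintro ⟨Z, hZ, h⟩
    have := Fact.mk hZ
    have hY : A.sec Z 0 ∈ A.sets := mem_sets inferInstance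
    refine ⟨⟨_, hY⟩, ?_⟩
    have h1 : A.Frc (fun j => (w j).1) Set.univ φ false v (A.sec Z 0) (A.sec Z 0)ᶜ
        (A.sec Z 1) (A.sec Z 1)ᶜ := Frc.limit (fun z hz hz' => hz' hz) fun n => by
      obtain ⟨l, hl⟩ := h n
      exact hl.mono subset_rfl (fun z hz => hz.2) (fun z hz => hz.2) (fun z hz => hz.2)
        (fun z hz => hz.2)
    have h2 := Frc.sound (Y := ⟨_, hY⟩) h1
    simpa using h2

end Model
end SOA

namespace SOA
namespace Model

/-! ### Linear orders of finite sets -/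

section defs
variable {A : Model.{u}}

/-- The coded finite set `s` is `{0}`, or it is a set of positive numbers any two of which are
in the relation `E`. -/
def IsNode (E : A.Num → A.Num → Prop) (s : A.Num) : Prop :=
  (∀ x, El x s ↔ x = 0) ∨ (¬ El 0 s ∧ ∀ a b, El a s → El b s → a < b → E a b)

/-- The least codes of the finite sets with the property `IsNode`. -/
def nodes (E : A.Num → A.Num → Prop) : Set A.Num :=
  {s | IsNode E s ∧ ∀ t, t < s → ∃ x, ¬ (El x t ↔ El x s)}

/-- The least element of the symmetric difference of `s` and `t` belongs to `s`. -/
def LexLt (s t : A.Num) : Prop :=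
  ∃ d, El d s ∧ ¬ El d t ∧ ∀ x, x < d → (El x s ↔ El x t)

variable (A) in
/-- The code of the relation `LexLt`. -/
def lex : Set A.Num := {p | ∃ s t, p = A.pair s t ∧ LexLt s t}

/-- The number `⟨l, c⟩` stands for the part below `l` of the set coded by `c`; the part `b`
extends the part `a = ⟨l, c⟩` and satisfies the requirements up to `l`. -/
def Extends (Q : A.Num → Set A.Num → Set A.Num → Prop) (a b : A.Num) : Prop :=
  ∃ l c l' c', a = A.pair l c ∧ b = A.pair l' c' ∧ l < l' ∧ (∀ z, z < l → (El z c ↔ El z c')) ∧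
    Q l {z | z < l' ∧ El z c'} {z | z < l' ∧ ¬ El z c'}

end defs
end Model

namespace Sig
variable {σ : Sig.{u}}

instance DS.lex : σ.DS IsArithmetical (fun i _ => (σ.M i).lex) := by
  unfold Model.lex Model.LexLt
  infer_instance

theorem DS.nodes {E : ∀ i, (σ.M i).Num → (σ.M i).Num → Prop}
    (hE : σ.D IsArithmetical (fun i v => E i (v 0) (v 1))) :
    σ.DS IsArithmetical (fun i _ => Model.nodes (E i)) := by
  have : ∀ {s t : σ.Fn} [σ.T s] [σ.T t],
      σ.D IsArithmetical (fun i v => E i (s i v) (t i v)) := fun {s t} hs ht =>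
    hE.comp (g := fun i v => SOA.push (s i v) (SOA.push (t i v) v))
      (T.push hs (T.push ht fun _ => T.var _))
  unfold Model.nodes Model.IsNode
  infer_instance

end Sig

namespace Model
variable {A : Model.{u}} [hA : A.ACA] {E : A.Num → A.Num → Prop}

theorem rel_lex {A : Model.{u}} [A.Ind] {s t : A.Num} : A.Rel A.lex s t ↔ LexLt s t := by
  constructor
  · rintro ⟨s', t', h, h'⟩
    obtain ⟨rfl, rfl⟩ := pair_inj.1 h
    exact h'
  · exact fun h => ⟨s, t, rfl, h⟩

theorem lex_mem_sets : A.lex ∈ A.sets := mem_sets (Sig.DS.lex (σ := A.fix))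

theorem LexLt.irrefl {A : Model.{u}} {s : A.Num} : ¬ LexLt s s := fun ⟨_, h, h', _⟩ => h' h

theorem LexLt.trans {A : Model.{u}} [A.Ind] {s t r : A.Num} (h : LexLt s t) (h' : LexLt t r) :
    LexLt s r := by
  obtain ⟨d, hs, ht, hd⟩ := h
  obtain ⟨e, ht', hr, he⟩ := h'
  rcases lt_trichotomy d e with h | rfl | h
  · exact ⟨d, hs, fun h' => ht ((he d h).2 h'),
      fun x hx => (hd x hx).trans (he x (hx.trans h))⟩
  · exact absurd ht' ht
  · exact ⟨e, (hd e h).2 ht', hr, fun x hx => (hd x (hx.trans h)).trans (he x hx)⟩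

theorem lexLt_trichotomy (s t : A.Num) : LexLt s t ∨ (∀ x, El x s ↔ El x t) ∨ LexLt t s := by
  by_cases h : ∃ x, ¬ (El x s ↔ El x t)
  · have h1 : {x | ¬ (El x s ↔ El x t)} ∈ A.sets := mem_sets inferInstance
    obtain ⟨d, hd, hmin⟩ := exists_least h1 h
    have hmin' : ∀ x, x < d → (El x s ↔ El x t) := fun x hx => not_not.1 (hmin x hx)
    by_cases hs : El d s
    · exact .inl ⟨d, hs, fun ht => hd (iff_of_true hs ht), hmin'⟩
    · refine .inr (.inr ⟨d, ?_, hs, fun x hx => (hmin' x hx).symm⟩)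
      by_contra ht
      exact hd (iff_of_false hs ht)
  · push Not at h
    exact .inr (.inl h)

/-- The purpose of taking least codes: the order compares extensions, so it is total only if
different nodes have different elements. -/
theorem nodes_ext {s t : A.Num} (hs : s ∈ nodes E) (ht : t ∈ nodes E)
    (h : ∀ x, El x s ↔ El x t) : s = t := by
  rcases lt_trichotomy s t with h' | h' | h'
  · obtain ⟨x, hx⟩ := ht.2 s h'
    exact absurd (h x) hx
  · exact h'
  · obtain ⟨x, hx⟩ := hs.2 t h'
    exact absurd (h x).symm hx

theorem isLinOrd_nodes : A.IsLinOrd (nodes E) A.lex where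
  irrefl s _ h := (rel_lex.1 h).irrefl
  trans s _ t _ r _ h h' := rel_lex.2 ((rel_lex.1 h).trans (rel_lex.1 h'))
  total s hs t ht := by
    simp only [rel_lex]
    exact (lexLt_trichotomy s t).imp_right (Or.imp_left (nodes_ext hs ht))

/-- Every bounded set of the structure with the property `IsNode` is coded by a node. -/
theorem exists_node {X : Set A.Num} (hX : X ∈ A.sets) {m : A.Num} (hm : ∀ x ∈ X, x < m)
    (h : (∀ x, x ∈ X ↔ x = 0) ∨ (0 ∉ X ∧ ∀ a ∈ X, ∀ b ∈ X, a < b → E a b)) :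
    ∃ s ∈ nodes E, ∀ x, El x s ↔ x ∈ X := by
  have := Fact.mk hX
  obtain ⟨c, hc⟩ := exists_code hX m
  have hc' : ∀ x, El x c ↔ x ∈ X := fun x => by
    rw [hc]
    exact ⟨fun h => h.1, fun h => ⟨h, hm x h⟩⟩
  have h1 : {s | ∀ x, El x s ↔ x ∈ X} ∈ A.sets := mem_sets inferInstance
  obtain ⟨s, hs, hmin⟩ := exists_least h1 ⟨c, hc'⟩
  have hs' : ∀ x, El x s ↔ x ∈ X := hs
  refine ⟨s, ⟨?_, fun t ht => ?_⟩, hs'⟩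
  · unfold IsNode
    simp only [hs']
    exact h.imp_right fun h => ⟨h.1, fun a b ha hb => h.2 a ha b hb⟩
  · by_contra! hx
    exact hmin t ht fun x => (hx x).trans (hs' x)

/-- The node `{0}` exists for this purpose: all other nodes omit `0`, so they first differ from it
at `0`. -/
theorem hasLeast_nodes : A.HasLeast (nodes E) A.lex := by
  have h1 : {x | x = (0 : A.Num)} ∈ A.sets := mem_sets inferInstance
  obtain ⟨b, hb, hb'⟩ := exists_node (E := E) h1 (m := 1)
    (fun x hx => by rw [show x = 0 from hx]; exact zero_lt_one) (.inl fun x => Iff.rfl)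
  have hb0 : ∀ x, El x b ↔ x = 0 := hb'
  refine ⟨b, hb, fun s hs => ?_⟩
  rcases hs.1 with h | h
  · exact .inl (nodes_ext hs hb fun x => (h x).trans (hb0 x).symm)
  · exact .inr (rel_lex.2 ⟨0, (hb0 0).2 rfl, h.1, fun x hx => absurd hx (Model.not_lt_zero' x)⟩)

/-- If a nonempty set of nodes has no least element, then there is an unbounded set of positive
numbers any two of which are in the relation `E`. -/
theorem exists_unbounded_of_no_least {S : Set A.Num} (hS : S ∈ A.sets) (hSE : S ⊆ nodes E)
    (hne : S.Nonempty) (hno : ∀ s ∈ S, ∃ t ∈ S, LexLt t s) :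
    ∃ P ∈ A.sets, (∀ a ∈ P, ∀ b ∈ P, a < b → E a b) ∧ ∀ m, ∃ a ∈ P, m ≤ a := by
  have := Fact.mk hS
  have hlt : ∀ {s : A.Num}, {t | t ∈ S ∧ (LexLt t s ∨ t = s)} ∈ A.sets := by
    intro s
    unfold LexLt
    exact mem_sets inferInstance
  -- `P` is the limit of `S` downwards: the numbers that belong to all members of `S` from some
  -- member on.
  have hP : {x | ∃ s, s ∈ S ∧ ∀ t, t ∈ S → (LexLt t s ∨ t = s) → El x t} ∈ A.sets := by
    unfold LexLt
    exact mem_sets inferInstance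
  set P := {x | ∃ s, s ∈ S ∧ ∀ t, t ∈ S → (LexLt t s ∨ t = s) → El x t} with hPdef
  have le_trans' : ∀ {s t r : A.Num}, (LexLt s t ∨ s = t) → (LexLt t r ∨ t = r) →
      (LexLt s r ∨ s = r) := by
    rintro s t r (h | rfl) (h' | rfl)
    exacts [.inl (h.trans h'), .inl h, .inl h', .inr rfl]
  -- Below each `m`, the members of `S` become constant from some `s` downwards.
  have stable : ∀ m, ∃ s, s ∈ S ∧ ∀ t, t ∈ S → (LexLt t s ∨ t = s) → ∀ x, x < m →
      (El x t ↔ El x s) := fun m => by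
    refine arith_induction (P := fun m => ∃ s, s ∈ S ∧ ∀ t, t ∈ S → (LexLt t s ∨ t = s) →
      ∀ x, x < m → (El x t ↔ El x s)) ?_ ?_ m (h := by unfold LexLt; infer_instance)
    · obtain ⟨s, hs⟩ := hne
      exact ⟨s, hs, fun t _ _ x hx => absurd hx (Model.not_lt_zero' x)⟩
    · rintro m ⟨s, hs, hst⟩
      by_cases h : ∃ t, t ∈ S ∧ (LexLt t s ∨ t = s) ∧ El m t
      · obtain ⟨t, ht, hts, hmt⟩ := h
        -- Once `m` has been acquired it is never lost: members below `t` agree with it below `m`,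
        -- and a first difference at `m` could only add `m`.
        refine ⟨t, ht, fun r hr hrt x hx => ?_⟩
        rcases (lt_add_one_iff.1 hx).lt_or_eq with hx | rfl
        · exact (hst r hr (le_trans' hrt hts) x hx).trans (hst t ht hts x hx).symm
        · refine ⟨fun _ => hmt, fun _ => ?_⟩
          by_contra hxr
          rcases hrt with ⟨d, hd, hd', hdx⟩ | rfl
          · rcases lt_trichotomy d x with h | rfl | h
            · exact hd' (((hst r hr (le_trans' (.inl ⟨d, hd, hd', hdx⟩) hts) d h).trans
                (hst t ht hts d h).symm).1 hd)
            · exact hxr hd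
            · exact hxr ((hdx x h).2 hmt)
          · exact hxr hmt
      · push Not at h
        refine ⟨s, hs, fun t ht hts x hx => ?_⟩
        rcases (lt_add_one_iff.1 hx).lt_or_eq with hx | rfl
        · exact hst t ht hts x hx
        · exact iff_of_false (h t ht hts) (h s hs (.inr rfl))
  have mem_P : ∀ {m s x}, s ∈ S → (∀ t, t ∈ S → (LexLt t s ∨ t = s) → ∀ x, x < m →
      (El x t ↔ El x s)) → x < m → x ∈ P → El x s := by
    rintro m s x hs hst hx ⟨r, hr, hr'⟩
    rcases lexLt_trichotomy s r with h | h | h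
    · exact hr' s hs (.inl h)
    · exact (h x).2 (hr' r hr (.inr rfl))
    · exact (hst r hr (.inl h) x hx).1 (hr' r hr (.inr rfl))
  refine ⟨P, hP, fun a ha b hb hab => ?_, fun m => ?_⟩
  · obtain ⟨s, hs, hst⟩ := stable (b + 1)
    have hbs := mem_P hs hst (lt_add_one_iff.2 le_rfl) hb
    have has := mem_P hs hst (lt_add_one_iff.2 hab.le) ha
    rcases (hSE hs).1 with h | h
    · have h1 := (h b).1 hbs
      rw [h1] at hab
      exact absurd hab (Model.not_lt_zero' a)
    · exact h.2 a b has hbs hab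
  · by_contra! hm
    obtain ⟨s, hs, hst⟩ := stable m
    have h1 : {d | m ≤ d ∧ ∃ t, t ∈ S ∧ (LexLt t s ∨ t = s) ∧ El d t} ∈ A.sets := by
      unfold LexLt
      exact mem_sets inferInstance
    have hlex : ∀ {t}, t ∈ S → (LexLt t s ∨ t = s) → ∀ r, r ∈ S → LexLt r t →
        ∃ d, m ≤ d ∧ El d r ∧ ¬ El d t ∧ ∀ x, x < d → (El x r ↔ El x t) := by
      rintro t ht hts r hr ⟨d, hd, hd', hdx⟩
      refine ⟨d, ?_, hd, hd', hdx⟩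
      by_contra! hdm
      exact hd' ((hst t ht hts d hdm).2
        ((hst r hr (le_trans' (.inl ⟨d, hd, hd', hdx⟩) hts) d hdm).1 hd))
    obtain ⟨r, hr, hrs⟩ := hno s hs
    obtain ⟨d₀, hd₀m, hd₀, -⟩ := hlex hs (.inr rfl) r hr hrs
    -- Below `s` every descent adds an element at or above `m`. The least such element that ever
    -- occurs is kept from then on, so it belongs to `P` and contradicts the bound.
    obtain ⟨d, ⟨hdm, t, ht, hts, hdt⟩, hmin⟩ := exists_least h1 ⟨d₀, hd₀m, r, hr, .inl hrs, hd₀⟩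
    refine absurd (hm d ⟨t, ht, fun q hq hqt => ?_⟩) (not_lt.2 hdm)
    rcases hqt with hqt | rfl
    · obtain ⟨e, hem, heq, het, hex⟩ := hlex ht hts q hq hqt
      rcases lt_trichotomy e d with h | rfl | h
      · exact absurd ⟨hem, q, hq, le_trans' (.inl hqt) hts, heq⟩ (hmin e h)
      · exact heq
      · exact (hex d h).2 hdt
    · exact hdt

variable {Q : A.Num → Set A.Num → Set A.Num → Prop}

/-- The linear order of the nodes of the relation `Extends Q` is ill-founded if and only if there
is a set whose finite parts satisfy all requirements. -/
theorem isWellOrd_nodes_iff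
    (hQ : A.fix.D IsArithmetical (fun _ v => Extends Q (v 0) (v 1)))
    (hmono : ∀ n m P P' N N', m ≤ n → P ⊆ P' → N ⊆ N' → Q n P N → Q m P' N') :
    A.IsWellOrd (nodes (Extends Q)) A.lex ↔
      ¬ ∃ Z ∈ A.sets, ∀ n, ∃ l, Q n {z | z < l ∧ z ∈ Z} {z | z < l ∧ z ∉ Z} := by
  have hL : nodes (Extends Q) ∈ A.sets := mem_sets (Sig.DS.nodes (σ := A.fix)
    (E := fun _ => Extends Q) hQ)
  rw [isWellOrd_iff hL lex_mem_sets isLinOrd_nodes, ← not_iff_not, not_not]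
  push Not
  constructor
  · rintro ⟨S, hS, hSL, hne, hno⟩
    simp only [rel_lex] at hno
    obtain ⟨P, hP, hPE, hPunb⟩ := exists_unbounded_of_no_least hS hSL hne hno
    have := Fact.mk hP
    -- The members of the clique are coherent approximations, and `Z` is their union.
    have hZ : {z | ∃ l c, A.pair l c ∈ P ∧ z < l ∧ El z c} ∈ A.sets := mem_sets inferInstance
    have hcoh : ∀ l c l' c', A.pair l c ∈ P → A.pair l' c' ∈ P → A.pair l c < A.pair l' c' →
        l < l' ∧ (∀ z, z < l → (El z c ↔ El z c')) ∧
          Q l {z | z < l' ∧ El z c'} {z | z < l' ∧ ¬ El z c'} := by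
      intro l c l' c' h h' hlt
      obtain ⟨l1, c1, l2, c2, e1, e2, h⟩ := hPE _ h _ h' hlt
      obtain ⟨rfl, rfl⟩ := pair_inj.1 e1
      obtain ⟨rfl, rfl⟩ := pair_inj.1 e2
      exact h
    have hpair : ∀ a ∈ P, ∃ l c, a = A.pair l c := fun a ha => by
      obtain ⟨b, hb, hab⟩ := hPunb (a + 1)
      obtain ⟨l, c, l', c', e, -⟩ := hPE a ha b hb (add_one_le_iff.1 hab)
      exact ⟨l, c, e⟩
    have hnext : ∀ l c, A.pair l c ∈ P → ∃ l' c', A.pair l' c' ∈ P ∧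
        A.pair l c < A.pair l' c' := fun l c h => by
      obtain ⟨b, hb, hab⟩ := hPunb (A.pair l c + 1)
      obtain ⟨l', c', rfl⟩ := hpair b hb
      exact ⟨l', c', hb, add_one_le_iff.1 hab⟩
    have hlarge : ∀ n, ∃ l c, A.pair l c ∈ P ∧ n ≤ l := fun n => by
      refine arith_induction (P := fun n => ∃ l c, A.pair l c ∈ P ∧ n ≤ l) ?_ ?_ n
      · obtain ⟨a, ha, -⟩ := hPunb 0
        obtain ⟨l, c, rfl⟩ := hpair a ha
        exact ⟨l, c, ha, zero_le⟩
      · rintro n ⟨l, c, h, hn⟩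
        obtain ⟨l', c', h', hlt⟩ := hnext l c h
        exact ⟨l', c', h', add_one_le_iff.2 (hn.trans_lt (hcoh _ _ _ _ h h' hlt).1)⟩
    refine ⟨_, hZ, fun n => ?_⟩
    obtain ⟨l, c, h, hn⟩ := hlarge n
    obtain ⟨l', c', h', hlt⟩ := hnext l c h
    have hagree : ∀ z, z < l' → (El z c' ↔ z ∈ {z | ∃ l c, A.pair l c ∈ P ∧ z < l ∧ El z c}) := by
      intro z hz
      refine ⟨fun hzc => ⟨l', c', h', hz, hzc⟩, ?_⟩
      rintro ⟨l1, c1, h1, hz1, hzc1⟩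
      rcases lt_trichotomy (A.pair l1 c1) (A.pair l' c') with h2 | h2 | h2
      · exact ((hcoh _ _ _ _ h1 h' h2).2.1 z hz1).1 hzc1
      · obtain ⟨rfl, rfl⟩ := pair_inj.1 h2
        exact hzc1
      · exact ((hcoh _ _ _ _ h' h1 h2).2.1 z hz).2 hzc1
    -- The member after `⟨l, c⟩` meets the requirements up to `l`, and `n ≤ l`.
    exact ⟨l', hmono _ _ _ _ _ _ hn (fun z hz => ⟨hz.1, (hagree z hz.1).1 hz.2⟩)
      (fun z hz => ⟨hz.1, fun hz' => hz.2 ((hagree z hz.1).2 hz')⟩)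
      (hcoh _ _ _ _ h h' hlt).2.2⟩
  · rintro ⟨Z, hZ, h⟩
    have := Fact.mk hL
    have := Fact.mk hZ
    -- Cliques made of true approximations to `Z`. Excluding the element `0` removes the artificial
    -- least node.
    have hS : {s | s ∈ nodes (Extends Q) ∧ ∀ a, El a s → a ≠ 0 ∧ ∃ l c, a = A.pair l c ∧
        ∀ z, z < l → (El z c ↔ z ∈ Z)} ∈ A.sets := mem_sets inferInstance
    refine ⟨_, hS, fun s hs => hs.1, ?_, ?_⟩
    · have h1 : {x : A.Num | False} ∈ A.sets := mem_sets inferInstance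
      obtain ⟨s, hs, hs'⟩ := exists_node (E := Extends Q) h1 (m := 0) (fun x hx => hx.elim)
        (.inr ⟨fun h => h, fun a ha => ha.elim⟩)
      exact ⟨s, hs, fun a ha => ((hs' a).1 ha).elim⟩
    · rintro s ⟨hs, hsZ⟩
      obtain ⟨l₀, hl₀⟩ := h s
      -- Large enough for two purposes: above the stage `l₀` that meets the requirements up to `s`,
      -- and above the code `s`, hence above all its elements and their lengths. Appending `⟨l, c⟩`
      -- then gives a smaller clique.
      set l := l₀ + s + 1 with hl
      have hsl : s < l := lt_add_one_iff.2 le_add_self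
      obtain ⟨c, hc⟩ := exists_code hZ l
      have hlb : l ≤ A.pair l c := left_le_pair _ _
      have h1 : {x | El x s ∨ x = A.pair l c} ∈ A.sets := mem_sets inferInstance
      have hlt : ∀ x, El x s → x < A.pair l c := fun x hx => hx.lt.trans (hsl.trans_le hlb)
      have hpos : (0 : A.Num) < A.pair l c := (lt_of_le_of_lt zero_le hsl).trans_le hlb
      have h0 : ¬ El 0 s := fun h0 => (hsZ 0 h0).1 rfl
      obtain ⟨t, ht, ht'⟩ := exists_node (E := Extends Q) h1 (m := A.pair l c + 1) (by
          rintro x (hx | rfl)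
          · exact lt_add_one_iff.2 (hlt x hx).le
          · exact lt_add_one_iff.2 le_rfl) (.inr ⟨by
            rintro (h | h)
            · exact h0 h
            · exact hpos.ne h, by
          rintro a (ha | rfl) b (hb | rfl) hab
          · rcases hs.1 with h' | h'
            · exact absurd ((h' 0).2 rfl) h0
            · exact h'.2 a b ha hb hab
          · obtain ⟨-, k, e, rfl, hk⟩ := hsZ a ha
            have hks : k < s := (left_le_pair _ _).trans_lt ha.lt
            refine ⟨k, e, l, c, rfl, rfl, hks.trans hsl, fun z hz => ?_, ?_⟩
            · rw [hk z hz, hc]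
              exact ⟨fun h => ⟨h, hz.trans (hks.trans hsl)⟩, fun h => h.1⟩
            · have hll : l₀ < l := lt_add_one_iff.2 le_self_add
              refine hmono _ _ _ _ _ _ hks.le (fun z hz => ?_) (fun z hz => ?_) hl₀
              · exact ⟨hz.1.trans hll, (hc z).2 ⟨hz.2, hz.1.trans hll⟩⟩
              · exact ⟨hz.1.trans hll, fun h => hz.2 ((hc z).1 h).1⟩
          · exact absurd hab (hlt b hb).not_gt
          · exact absurd hab (lt_irrefl _)⟩)
      refine ⟨t, ⟨ht, fun a ha => ?_⟩, rel_lex.2 ⟨A.pair l c, (ht' _).2 (.inr rfl),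
        fun h => lt_irrefl _ (hlt _ h), fun x hx => ?_⟩⟩
      · rcases (ht' a).1 ha with ha | rfl
        · exact hsZ a ha
        · exact ⟨hpos.ne', l, c, rfl, fun z hz =>
            ⟨fun h => ((hc z).1 h).1, fun h => (hc z).2 ⟨h, hz⟩⟩⟩
      · rw [ht']
        exact ⟨fun h => h.resolve_right hx.ne, .inl⟩

end Model
end SOA

namespace SOA

/-! ### Connectedness is `Π¹₁`-universal -/

namespace Sig
variable {σ : Sig.{u}}

theorem D.extends_refutes {w : ∀ i, ℕ → Set (σ.M i).Num}
    (hw : ∀ j, σ.DS IsArithmetical (fun i _ => w i j)) {φ : Formula} (hφ : IsArithmetical φ)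
    {f : ∀ i, ℕ → (σ.M i).Num} (hf : ∀ k, σ.T (fun i _ => f i k)) :
    σ.D IsArithmetical (fun i v =>
      Model.Extends ((σ.M i).Refutes (w i) φ (f i)) (v 0) (v 1)) := by
  have := D.frc hw hφ false (f := fun i _ => f i) hf (B := fun i v => {x | x < v 3})
    (PY := fun i v => (σ.M i).sec {z | z < v 1 ∧ Model.El z (v 0)} 0)
    (NY := fun i v => (σ.M i).sec {z | z < v 1 ∧ ¬ Model.El z (v 0)} 0)
    (P := fun i v => (σ.M i).sec {z | z < v 1 ∧ Model.El z (v 0)} 1)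
    (N := fun i v => (σ.M i).sec {z | z < v 1 ∧ ¬ Model.El z (v 0)} 1)
    inferInstance inferInstance inferInstance inferInstance inferInstance
  unfold Model.Extends Model.Refutes
  infer_instance

end Sig

namespace Model

theorem Refutes.mono {A : Model.{u}} [A.Ind] {w : ℕ → Set A.Num} {φ : Formula} {v : ℕ → A.Num}
    (n m : A.Num) (P P' N N' : Set A.Num) (hmn : m ≤ n) (hP : P ⊆ P') (hN : N ⊆ N')
    (h : A.Refutes w φ v n P N) : A.Refutes w φ v m P' N' :=
  Frc.mono (setOf_lt_subset hmn) h (sec_mono hP _) (sec_mono hN _) (sec_mono hP _) (sec_mono hN _)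

/-- The linear order of attempts to refute `φ`. -/
def attempts (A : Model.{u}) (φ : Formula) (v : ℕ → A.Num) (w : ℕ → A.sets) : Set A.Num :=
  nodes (Extends (A.Refutes (fun j => (w j).1) φ v))

theorem attempts_mem_sets {A : Model.{u}} [A.ACA] {φ : Formula} (hφ : IsArithmetical φ)
    (v : ℕ → A.Num) (w : ℕ → A.sets) : A.attempts φ v w ∈ A.sets :=
  mem_sets (Sig.DS.nodes (σ := A.fix) (Sig.D.extends_refutes (σ := A.fix)
    (w := fun _ j => (w j).1) (f := fun _ => v) (fun j => Sig.DS.fix_const (w j).2) hφ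
    fun _ => Sig.T.fix_const _))

theorem isConnectedIn_attempts_iff {A : Model.{u}} [A.ACA] {φ : Formula} (hφ : IsArithmetical φ)
    (v : ℕ → A.Num) (w : ℕ → A.sets) :
    A.IsConnectedIn (A.attempts φ v w) (A.topU (A.attempts φ v w) A.lex) ↔
      ∀ Y : A.sets, φ.Sat A v (push Y w) := by
  rw [isConnectedIn_top_iff (attempts_mem_sets hφ v w) lex_mem_sets isLinOrd_nodes hasLeast_nodes]
  refine (isWellOrd_nodes_iff (Sig.D.extends_refutes (σ := A.fix)
    (w := fun _ j => (w j).1) (f := fun _ => v) (fun j => Sig.DS.fix_const (w j).2) hφ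
    fun _ => Sig.T.fix_const _) Refutes.mono).trans ?_
  rw [← exists_not_sat_iff hφ v w]
  push Not
  rfl

end Model

theorem connectedIsPi11Hard : ConnectedIsPi11Hard.{u} := by
  rintro _ ⟨θ, hθ, rfl⟩
  -- Number variable `0` is reserved for the element of the defined set, so the parameters are read
  -- from index `1` on.
  have hL : uniSig.{u}.DS IsArithmetical
      (fun i _ => i.A.attempts θ (fun k => i.V (k + 1)) i.W) :=
    Sig.DS.nodes (σ := uniSig) (Sig.D.extends_refutes (σ := uniSig)
      (w := fun i j => (i.W j).1) (f := fun i k => i.V (k + 1)) (fun j => inferInstance) hθ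
      fun _ => inferInstance)
  have hU := Sig.DS.topU (σ := uniSig.{u}) (R := fun i => i.A.lex) (hL := hL)
  have hK := Sig.DS.topK (σ := uniSig.{u}) (hU := hU)
  obtain ⟨θX, hX, eX⟩ := Sig.D.exists_formula (Sig.D.mem (σ := uniSig) (t := fun i _ => i.V 0)
    (hX := hL))
  obtain ⟨θU, hU, eU⟩ := Sig.D.exists_formula (Sig.D.mem (σ := uniSig) (t := fun i _ => i.V 0)
    (hX := hU))
  obtain ⟨θK, hK, eK⟩ := Sig.D.exists_formula (Sig.D.mem (σ := uniSig) (t := fun i _ => i.V 0)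
    (hX := hK))
  refine ⟨θX, θU, θK, hX, hU, hK, fun A hA v w => ?_⟩
  have : A.ACA := ⟨hA⟩
  have hX' : A.defSet θX v w = A.attempts θ v w := by
    ext n
    exact (eX A (push n v) w).symm
  have hU' : A.defSet θU v w = A.topU (A.attempts θ v w) A.lex := by
    ext n
    exact (eU A (push n v) w).symm
  have hK' : A.defSet θK v w = A.topK (A.topU (A.attempts θ v w) A.lex) := by
    ext n
    exact (eK A (push n v) w).symm
  rw [hX', hU', hK']
  exact ⟨Model.isCSCS_top (Model.attempts_mem_sets hθ v w) Model.lex_mem_sets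
    Model.isLinOrd_nodes, (Model.isConnectedIn_attempts_iff hθ v w).symm⟩

/-! ### The `Π¹₁` definition of connectedness -/

namespace Model

/-- `G` and its complement are a partition of the space into nonempty open sets. -/
def IsSeparation (A : Model.{u}) (X U G : Set A.Num) : Prop :=
  (∀ x, x ∈ G → x ∈ X ∧ ∃ i, x ∈ A.sec U i ∧ ∀ y, y ∈ A.sec U i → y ∈ G) ∧
    (∀ x, x ∈ X → x ∉ G → ∃ i, x ∈ A.sec U i ∧ ∀ y, y ∈ A.sec U i → y ∈ X ∧ y ∉ G) ∧
    (∃ x, x ∈ G) ∧ ∃ x, x ∈ X ∧ x ∉ G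

/-- Disjoint open sets covering the space are complements of each other, so one set variable
suffices. Bounded comprehension provides the complement, hence this is available over `RCA₀` too. -/
theorem isConnectedIn_iff {A : Model.{u}} [A.Ind] {X U : Set A.Num} (hX : X ∈ A.sets) :
    A.IsConnectedIn X U ↔ ∀ G ∈ A.sets, ¬ A.IsSeparation X U G := by
  have := Fact.mk hX
  constructor
  · rintro h G hG ⟨h1, h2, h3, h4⟩
    have := Fact.mk hG
    have hH : {x | x ∈ X ∧ x ∉ G} ∈ A.sets := mem_sets_of_bounded inferInstance
    obtain ⟨x, hx, hx'⟩ := h G hG _ hH ⟨fun x hx => (h1 x hx).1, fun x hx => (h1 x hx).2⟩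
      ⟨fun x hx => hx.1, fun x hx => h2 x hx.1 hx.2⟩ h3 h4 (by
        ext x
        refine ⟨fun h => h.elim (fun h => (h1 x h).1) fun h => h.1, fun h => ?_⟩
        by_cases hx : x ∈ G
        exacts [.inl hx, .inr ⟨h, hx⟩])
    exact hx'.2 hx
  · intro h G hG H hH hGo hHo hGne ⟨y, hy⟩ hGH
    by_contra hne
    have hdisj : ∀ x ∈ H, x ∉ G := fun x hx hx' => hne ⟨x, hx', hx⟩
    have hHG : ∀ x, x ∈ X → x ∉ G → x ∈ H := fun x hx hx' =>
      (hGH.symm ▸ hx : x ∈ G ∪ H).resolve_left hx'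
    refine h G hG ⟨fun x hx => ⟨hGo.1 hx, hGo.2 x hx⟩, fun x hx hx' => ?_, hGne,
      y, hHo.1 hy, hdisj y hy⟩
    obtain ⟨i, hi, hsub⟩ := hHo.2 x (hHG x hx hx')
    exact ⟨i, hi, fun y hy => ⟨hHo.1 (hsub hy), hdisj y (hsub hy)⟩⟩

theorem isCSCS_iff {A : Model.{u}} {X U K : Set A.Num} : A.IsCSCS X U K ↔
    (∀ i x, x ∈ A.sec U i → x ∈ X) ∧ (∀ x, x ∈ X → ∃ i, x ∈ A.sec U i) ∧
    (∀ x, x ∈ X → ∀ i j, ∃ n, A.pair (A.pair x (A.pair i j)) n ∈ K ∧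
      ∀ m, A.pair (A.pair x (A.pair i j)) m ∈ K → m = n) ∧
    ∀ x, x ∈ X → ∀ i j n, x ∈ A.sec U i → x ∈ A.sec U j →
      A.pair (A.pair x (A.pair i j)) n ∈ K → x ∈ A.sec U n ∧
        ∀ y, y ∈ A.sec U n → y ∈ A.sec U i ∧ y ∈ A.sec U j :=
  ⟨fun h => ⟨fun i _ hx => h.subset i hx, h.cover, h.total, h.inter⟩,
    fun h => ⟨fun i x hx => h.1 i x hx, h.2.1, h.2.2.1, h.2.2.2⟩⟩

end Model

set_option synthInstance.maxHeartbeats 200000 in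
set_option synthInstance.maxSize 1000 in
theorem connectedIsPi11 : ConnectedIsPi11.{u} := by
  have h1 : uniSig.{u}.D IsArithmetical
      (fun i _ => i.A.IsCSCS (i.W 1).1 (i.W 2).1 (i.W 3).1) := by
    simp only [Model.isCSCS_iff]
    infer_instance
  have h2 : uniSig.{u}.D IsArithmetical
      (fun i _ => i.A.IsSeparation (i.W 1).1 (i.W 2).1 (i.W 0).1) := by
    unfold Model.IsSeparation
    infer_instance
  -- The quantified set `G` has index `0`, which moves the space to `1`, `2`, `3`. The quantifier is
  -- vacuous for the first conjunct, harmless because some set exists.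
  obtain ⟨θ, hθ, e⟩ := Sig.D.exists_formula (P := fun i _ =>
    i.A.IsCSCS (i.W 1).1 (i.W 2).1 (i.W 3).1 ∧
      ¬ i.A.IsSeparation (i.W 1).1 (i.W 2).1 (i.W 0).1) inferInstance
  refine ⟨_, ⟨θ, hθ, rfl⟩, fun A hA v w => ?_⟩
  have : A.ACA := ⟨hA⟩
  rw [Model.isConnectedIn_iff (w 0).2]
  have e' : ∀ G : A.sets, θ.Sat A v (push G w) ↔ A.IsCSCS (w 0).1 (w 1).1 (w 2).1 ∧
      ¬ A.IsSeparation (w 0).1 (w 1).1 G.1 := fun G => (e A v (push G w)).symm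
  simp only [Formula.Sat, e']
  obtain ⟨G₀, hG₀⟩ := hA.basic.sets_nonempty
  exact ⟨fun h => ⟨(h ⟨G₀, hG₀⟩).1, fun G hG => (h ⟨G, hG⟩).2⟩,
    fun h G => ⟨h.1, h.2 G.1 G.2⟩⟩

/-! ### Index sets of connected spaces -/

namespace Model

/-- A vacuous set quantifier turns an arithmetical formula into a `Π¹₁` formula. -/
theorem IsPi11CA0.isACA0 {A : Model.{u}} (h : A.IsPi11CA0) : A.IsACA0 := by
  refine ⟨h.basic, fun φ hφ v w => ?_⟩
  obtain ⟨Y, hY⟩ := h.basic.sets_nonempty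
  have := h.comprehension _ ⟨φ.subst Term.var Nat.succ, FormulaClass.subst _ _ hφ, rfl⟩ v w
  convert this using 1
  ext n
  simp only [Formula.Sat, Set.mem_ofPred_eq, Formula.sat_subst]
  exact ⟨fun h _ => h, fun h => h ⟨Y, hY⟩⟩

set_option synthInstance.maxHeartbeats 200000 in
set_option synthInstance.maxSize 1000 in
theorem IsPi11CA0.connectedIndexSets {A : Model.{u}} (h : A.IsPi11CA0) :
    A.ConnectedIndexSets := by
  intro X hX U hU K hK hC
  have hA := h.isACA0
  have : A.ACA := ⟨hA⟩
  have h2 : uniSig.{u}.D IsArithmetical (fun i _ => i.A.IsSeparation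
      (i.A.sec (i.W 1).1 (i.V 0)) (i.A.sec (i.W 2).1 (i.V 0)) (i.W 0).1) := by
    unfold Model.IsSeparation
    infer_instance
  obtain ⟨θ, hθ, e⟩ := Sig.D.exists_formula (P := fun i _ => ¬ i.A.IsSeparation
      (i.A.sec (i.W 1).1 (i.V 0)) (i.A.sec (i.W 2).1 (i.V 0)) (i.W 0).1) inferInstance
  have := h.comprehension _ ⟨θ, hθ, rfl⟩ (fun _ => 0) (push ⟨X, hX⟩ fun _ => ⟨U, hU⟩)
  convert this using 1
  ext j
  have hXj : A.sec X j ∈ A.sets := by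
    have := Fact.mk hX
    exact mem_sets inferInstance
  simp only [Set.mem_ofPred_eq, Formula.Sat]
  rw [isConnectedIn_iff hXj]
  exact ⟨fun h G => (e A _ _).1 (h G.1 G.2), fun h G hG => (e A _ _).2 (h ⟨G, hG⟩)⟩

/-- The reduction is applied with `n` as an additional number parameter; arithmetical comprehension
collects the resulting spaces into one sequence, and its index set is the required set. -/
theorem ConnectedIndexSets.isPi11CA0 {A : Model.{u}} (h : A.ConnectedIndexSets)
    (hA : A.IsACA0) : A.IsPi11CA0 := by
  refine ⟨hA.basic, fun ψ hψ v w => ?_⟩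
  have : A.ACA := ⟨hA⟩
  obtain ⟨θX, θU, θK, hX, hU, hK, H⟩ := connectedIsPi11Hard ψ hψ
  have key : ∀ θ, IsArithmetical θ → ∃ Y ∈ A.sets, ∀ n, A.sec Y n = A.defSet θ (push n v) w := by
    intro θ hθ
    have h1 := Sig.D.of_sat (σ := A.fix) hθ (w := fun j _ => w j)
      (t := fun k _ u => push (u 0) (push (u 1) v) k)
      (Sig.T.push (Sig.T.var 0) (Sig.T.push (Sig.T.var 1) fun _ => Sig.T.fix_const _))
      fun _ => trivial
    have h2 : {z | ∃ n x, z = A.pair n x ∧ θ.Sat A (push x (push n v)) w} ∈ A.sets := by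
      have h3 := h1.comp (g := fun _ u k => u k) fun _ => Sig.T.var _
      exact mem_sets inferInstance
    refine ⟨_, h2, fun n => ?_⟩
    ext x
    constructor
    · rintro ⟨n', x', h, h'⟩
      obtain ⟨rfl, rfl⟩ := pair_inj.1 h
      exact h'
    · exact fun h => ⟨n, x, rfl, h⟩
  obtain ⟨X, hXs, eX⟩ := key θX hX
  obtain ⟨U, hUs, eU⟩ := key θU hU
  obtain ⟨K, hKs, eK⟩ := key θK hK
  have := h X hXs U hUs K hKs fun j => by
    rw [eX, eU, eK]
    exact (H A hA _ w).1
  convert this using 1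
  ext n
  simp only [Set.mem_ofPred_eq]
  rw [eX, eU]
  exact (H A hA _ w).2

end Model
end SOA

namespace SOA

/-! ### From index sets of connected spaces to arithmetical comprehension -/

namespace Model

/-- With a vacuous number quantifier, a bounded formula is both `Σ⁰₁` and `Π⁰₁`. -/
theorem IsRCA0.ind {A : Model.{u}} (h : A.IsRCA0) : A.Ind := by
  refine ⟨h.basic, fun θ hθ v w => ?_⟩
  have hb : IsBounded (θ.subst (fun j => .var (j + 1)) id) := FormulaClass.subst _ _ hθ
  have e1 : ∀ n, (Formula.ex (θ.subst (fun j => .var (j + 1)) id)).Sat A (push n v) w ↔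
      θ.Sat A (push n v) w := fun n => by
    simp only [Formula.ex, Formula.Sat, Formula.sat_subst]
    exact ⟨fun h => by by_contra h'; exact h fun _ => h', fun h h' => h' A.zero h⟩
  have e2 : ∀ n, (Formula.all (θ.subst (fun j => .var (j + 1)) id)).Sat A (push n v) w ↔
      θ.Sat A (push n v) w := fun n => by
    simp only [Formula.Sat, Formula.sat_subst]
    exact ⟨fun h => h A.zero, fun h _ => h⟩
  have := h.delta01Comprehension _ _ ⟨_, hb, rfl⟩ ⟨_, hb, rfl⟩ v w
    fun n => (e1 n).trans (e2 n).symm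
  simpa only [e1] using this

variable {A : Model.{u}} [hA : A.Ind]

/-- The points of the space that is connected if and only if `∃ x, Q x`. -/
def IsPoint (Q : A.Num → Prop) (x : A.Num) : Prop :=
  x = 0 ∨ x = 1 ∨ ∃ y, y < x ∧ x = y + 1 + 1 ∧ Q y

/-- `x` belongs to the least neighbourhood of `i` in the space that is connected if and only if
`∃ x, Q x`. -/
def IsNear (Q : A.Num → Prop) (i x : A.Num) : Prop :=
  IsPoint Q x ∧ IsPoint Q i ∧ (x = i ∨ ((x = 0 ∨ x = 1) ∧ i ≠ 0 ∧ i ≠ 1))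

/-- The index set of this family of spaces gives `Σ⁰₁` comprehension. -/
theorem ConnectedIndexSets.exists_mem_sets (h : A.ConnectedIndexSets) {Q : A.Num → A.Num → Prop}
    (hQ : A.fix.D IsBounded (fun _ v => Q (v 0) (v 1))) : {j | ∃ x, Q x j} ∈ A.sets := by
  have : ∀ {s t : A.fix.Fn} [A.fix.T s] [A.fix.T t],
      A.fix.D IsBounded (fun i v => Q (s i v) (t i v)) := fun {s t} hs ht =>
    hQ.comp (g := fun i v => SOA.push (s i v) (SOA.push (t i v) v))
      (Sig.T.push hs (Sig.T.push ht fun _ => Sig.T.var _))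
  have hX : {p | ∃ j x, p = A.pair j x ∧ IsPoint (fun y => Q y j) x} ∈ A.sets := by
    unfold IsPoint
    exact mem_sets_of_bounded inferInstance
  have hU : {p | ∃ j q, p = A.pair j q ∧ ∃ i x, q = A.pair i x ∧
      IsNear (fun y => Q y j) i x} ∈ A.sets := by
    unfold IsNear IsPoint
    exact mem_sets_of_bounded inferInstance
  -- Each point is the index of its least neighbourhood, so `k(x, i, i') = x` works.
  have hK : {p | ∃ j q, p = A.pair j q ∧ ∃ r n, q = A.pair r n ∧ ∃ x s, r = A.pair x s ∧
      n = x} ∈ A.sets := mem_sets_of_bounded inferInstance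
  set X := {p | ∃ j x, p = A.pair j x ∧ IsPoint (fun y => Q y j) x}
  set U := {p | ∃ j q, p = A.pair j q ∧ ∃ i x, q = A.pair i x ∧ IsNear (fun y => Q y j) i x}
  set K := {p | ∃ j q, p = A.pair j q ∧ ∃ r n, q = A.pair r n ∧ ∃ x s, r = A.pair x s ∧ n = x}
  have eX : ∀ {j x}, x ∈ A.sec X j ↔ IsPoint (fun y => Q y j) x := fun {j x} => by
    constructor
    · rintro ⟨j', x', h, h'⟩
      obtain ⟨rfl, rfl⟩ := pair_inj.1 h
      exact h'
    · exact fun h => ⟨j, x, rfl, h⟩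
  have eU : ∀ {j i x}, x ∈ A.sec (A.sec U j) i ↔ IsNear (fun y => Q y j) i x := fun {j i x} => by
    constructor
    · rintro ⟨j', q, h, i', x', h', h''⟩
      obtain ⟨rfl, rfl⟩ := pair_inj.1 h
      obtain ⟨rfl, rfl⟩ := pair_inj.1 h'
      exact h''
    · exact fun h => ⟨j, _, rfl, i, x, rfl, h⟩
  have eK : ∀ {j x i i' n}, A.Val (A.sec K j) x i i' n ↔ n = x := fun {j x i i' n} => by
    constructor
    · rintro ⟨j', q, h, r, n', h', x', s, h'', e⟩
      obtain ⟨rfl, rfl⟩ := pair_inj.1 h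
      obtain ⟨rfl, rfl⟩ := pair_inj.1 h'
      obtain ⟨rfl, rfl⟩ := pair_inj.1 h''
      exact e
    · exact fun h => ⟨j, _, rfl, _, n, rfl, x, _, rfl, h⟩
  have self : ∀ {j x}, IsPoint (fun y => Q y j) x → IsNear (fun y => Q y j) x x :=
    fun h => ⟨h, h, .inl rfl⟩
  have key := h X hX U hU K hK fun j => by
    refine ⟨fun i x hx => eX.2 (eU.1 hx).1, fun x hx => ⟨x, eU.2 (self (eX.1 hx))⟩,
      fun x _ i i' => ⟨x, eK.2 rfl, fun y hy => eK.1 hy⟩, fun x hx i i' n hi hi' hn => ?_⟩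
    obtain rfl := eK.1 hn
    have hsub : ∀ {i}, n ∈ A.sec (A.sec U j) i →
        A.sec (A.sec U j) n ⊆ A.sec (A.sec U j) i := by
      intro i hi y hy
      rw [eU] at hi hy ⊢
      obtain ⟨hyp, hnp, hyn⟩ := hy
      rcases hyn with rfl | ⟨hy, h0, h1⟩
      · exact hi
      · rcases hi.2.2 with rfl | ⟨h | h, -⟩
        · exact ⟨hyp, hnp, .inr ⟨hy, h0, h1⟩⟩
        · exact absurd h h0
        · exact absurd h h1
    exact ⟨eU.2 (self (eX.1 hx)), fun y hy => ⟨hsub hi hy, hsub hi' hy⟩⟩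
  convert key using 1
  ext j
  have hXj : A.sec X j ∈ A.sets := by
    have := Fact.mk hX
    exact mem_sets_of_bounded inferInstance
  have p0 : IsPoint (fun y => Q y j) 0 := .inl rfl
  have p1 : IsPoint (fun y => Q y j) 1 := .inr (.inl rfl)
  have h01 : (0 : A.Num) ≠ 1 := zero_ne_one
  simp only [Set.mem_ofPred_eq]
  rw [isConnectedIn_iff hXj]
  constructor
  · rintro ⟨x, hx⟩ G hG ⟨h1, h2, ⟨a, ha⟩, b, hb, hbG⟩
    -- A separation cannot divide the least neighbourhood of a point.
    have hside : ∀ p, IsPoint (fun y => Q y j) p → ∀ y, IsNear (fun y => Q y j) p y →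
        (p ∈ G ↔ y ∈ G) := by
      intro p hp y hy
      by_cases hpG : p ∈ G
      · obtain ⟨-, i, hi, hsub⟩ := h1 p hpG
        refine iff_of_true hpG (hsub y (eU.2 ?_))
        have hi' := eU.1 hi
        rcases hi'.2.2 with rfl | ⟨h | h, h'⟩
        · exact hy
        · refine ⟨hy.1, hi'.2.1, ?_⟩
          rcases hy.2.2 with rfl | h''
          exacts [.inr ⟨.inl h, h'⟩, absurd h h''.2.1]
        · refine ⟨hy.1, hi'.2.1, ?_⟩
          rcases hy.2.2 with rfl | h''
          exacts [.inr ⟨.inr h, h'⟩, absurd h h''.2.2]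
      · obtain ⟨i, hi, hsub⟩ := h2 p (eX.2 hp) hpG
        refine iff_of_false hpG (hsub y (eU.2 ?_)).2
        have hi' := eU.1 hi
        rcases hi'.2.2 with rfl | ⟨h | h, h'⟩
        · exact hy
        · refine ⟨hy.1, hi'.2.1, ?_⟩
          rcases hy.2.2 with rfl | h''
          exacts [.inr ⟨.inl h, h'⟩, absurd h h''.2.1]
        · refine ⟨hy.1, hi'.2.1, ?_⟩
          rcases hy.2.2 with rfl | h''
          exacts [.inr ⟨.inr h, h'⟩, absurd h h''.2.2]
    have hsucc : ∀ y : A.Num, y + 1 + 1 ≠ 0 ∧ y + 1 + 1 ≠ 1 := fun y =>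
      ⟨(lt_add_one_iff.2 zero_le).ne', fun h => (lt_add_one_iff.2 (zero_le (a := y))).ne'
        (add_right_cancel (h.trans (zero_add 1).symm))⟩
    have hlt : ∀ y : A.Num, y < y + 1 + 1 := fun y =>
      (lt_add_one_iff.2 le_rfl).trans (lt_add_one_iff.2 le_rfl)
    -- The point `y + 2` of a witness `y` ties `0` and `1` together.
    have hsame : ∀ y, Q y j → (y + 1 + 1 ∈ G ↔ 0 ∈ G) ∧ (y + 1 + 1 ∈ G ↔ 1 ∈ G) := fun y hy => by
      have hp : IsPoint (fun y => Q y j) (y + 1 + 1) := .inr (.inr ⟨y, hlt y, rfl, hy⟩)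
      exact ⟨hside _ hp 0 ⟨p0, hp, .inr ⟨.inl rfl, hsucc y⟩⟩,
        hside _ hp 1 ⟨p1, hp, .inr ⟨.inr rfl, hsucc y⟩⟩⟩
    have hall : ∀ p, IsPoint (fun y => Q y j) p → (p ∈ G ↔ 0 ∈ G) := by
      rintro p (rfl | rfl | ⟨y, -, rfl, hy⟩)
      · rfl
      · exact (hsame x hx).2.symm.trans (hsame x hx).1
      · exact (hsame y hy).1
    exact hbG ((hall b (eX.1 hb)).2 ((hall a (eX.1 (h1 a ha).1)).1 ha))
  · intro hc
    by_contra! hno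
    have hpts : ∀ p, IsPoint (fun y => Q y j) p → p = 0 ∨ p = 1 := by
      rintro p (h | h | ⟨y, -, -, hy⟩)
      exacts [.inl h, .inr h, absurd hy (hno y)]
    -- Without witnesses the space is the discrete space with points `0` and `1`.
    have hG : {x : A.Num | x = 0} ∈ A.sets := mem_sets_of_bounded inferInstance
    refine hc _ hG ⟨?_, ?_, ⟨0, rfl⟩, 1, eX.2 p1, fun h => h01 (Eq.symm h)⟩
    · rintro x rfl
      refine ⟨eX.2 p0, 0, eU.2 (self p0), fun y hy => ?_⟩
      rcases (eU.1 hy).2.2 with h | ⟨-, h, -⟩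
      exacts [h, absurd rfl h]
    · intro x hx hx0
      have hx1 : x = 1 := (hpts x (eX.1 hx)).resolve_left hx0
      subst hx1
      refine ⟨1, eU.2 (self p1), fun y hy => ?_⟩
      rcases (eU.1 hy).2.2 with rfl | ⟨-, -, h⟩
      exacts [⟨hx, hx0⟩, absurd rfl h]

end Model

/-! ### Absorbing number quantifiers into set parameters -/

theorem Term.exists_support (t : Term) : ∃ N, ∀ (A : Model.{u}) (v v' : ℕ → A.Num),
    (∀ k < N, v k = v' k) → t.eval A v = t.eval A v' := by
  induction t with
  | var n => exact ⟨n + 1, fun A v v' h => h n n.lt_succ_self⟩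
  | zero => exact ⟨0, fun _ _ _ _ => rfl⟩
  | one => exact ⟨0, fun _ _ _ _ => rfl⟩
  | add s t ih1 ih2 | mul s t ih1 ih2 =>
    obtain ⟨M, hM⟩ := ih1
    obtain ⟨N, hN⟩ := ih2
    refine ⟨M + N, fun A v v' h => ?_⟩
    simp only [Term.eval]
    rw [hM A v v' fun k hk => h k (by omega), hN A v v' fun k hk => h k (by omega)]

theorem Formula.exists_support (φ : Formula) : ∃ N, ∀ (A : Model.{u}) (v v' : ℕ → A.Num)
    (w : ℕ → A.sets), (∀ k < N, v k = v' k) → (φ.Sat A v w ↔ φ.Sat A v' w) := by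
  induction φ with
  | eq s t | lt s t =>
    obtain ⟨M, hM⟩ := s.exists_support
    obtain ⟨N, hN⟩ := t.exists_support
    refine ⟨M + N, fun A v v' w h => ?_⟩
    simp only [Formula.Sat]
    rw [hM A v v' fun k hk => h k (by omega), hN A v v' fun k hk => h k (by omega)]
  | mem t X =>
    obtain ⟨N, hN⟩ := t.exists_support
    refine ⟨N, fun A v v' w h => ?_⟩
    simp only [Formula.Sat]
    rw [hN A v v' h]
  | neg φ ih =>
    obtain ⟨N, hN⟩ := ih
    exact ⟨N, fun A v v' w h => not_congr (hN A v v' w h)⟩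
  | imp φ ψ ih1 ih2 =>
    obtain ⟨M, hM⟩ := ih1
    obtain ⟨N, hN⟩ := ih2
    exact ⟨M + N, fun A v v' w h => imp_congr (hM A v v' w fun k hk => h k (by omega))
      (hN A v v' w fun k hk => h k (by omega))⟩
  | all φ ih =>
    obtain ⟨N, hN⟩ := ih
    refine ⟨N, fun A v v' w h => forall_congr' fun a => hN A _ _ w fun k hk => ?_⟩
    cases k with
    | zero => rfl
    | succ k => exact h k (by omega)
  | allSet φ ih =>
    obtain ⟨N, hN⟩ := ih
    exact ⟨N, fun A v v' w h => forall_congr' fun Y => hN A v v' _ h⟩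

/-- Definable relations depend on finitely many variables; this makes contracting them to a single
one a finite induction. -/
theorem Sig.D.exists_support {A : Model.{u}} [A.Ind] {Γ : Formula → Prop}
    {P : (ℕ → A.Num) → Prop} (h : A.fix.D Γ (fun _ v => P v)) :
    ∃ N, ∀ v v', (∀ k < N, v k = v' k) → (P v ↔ P v') := by
  obtain ⟨φ, -, x, w, hx, -, e⟩ := h.out
  obtain ⟨N, hN⟩ := φ.exists_support
  have : ∀ j, ∃ k, ∀ v v' : ℕ → A.Num, v k = v' k → x j ⟨⟩ v = x j ⟨⟩ v' := fun j => by
    rcases hx j with ⟨k, hk⟩ | ⟨c, -, hc⟩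
    · exact ⟨k, fun v v' h => by rw [hk]; exact h⟩
    · exact ⟨0, fun v v' _ => by rw [hc]⟩
  choose k hk using this
  refine ⟨(Finset.range N).sup k + 1, fun v v' h => ?_⟩
  rw [e ⟨⟩ v, e ⟨⟩ v']
  refine hN A _ _ _ fun j hj => hk j v v' (h _ ?_)
  exact Nat.lt_succ_of_le (Finset.le_sup (f := k) (Finset.mem_range.2 hj))

namespace Model
variable {A : Model.{u}} [hA : A.Ind]

/-- All variables but the first can be contracted into one. -/
theorem exists_contraction (N : ℕ) {P : (ℕ → A.Num) → Prop}
    (hP : A.fix.D IsBounded (fun _ v => P v))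
    (hN : ∀ v v', (∀ k < N + 2, v k = v' k) → (P v ↔ P v')) :
    ∃ (Q : A.Num → A.Num → Prop) (t : (ℕ → A.Num) → A.Num),
      A.fix.D IsBounded (fun _ v => Q (v 0) (v 1)) ∧ A.fix.T (fun _ v => t v) ∧
      ∀ a v, P (push a v) ↔ Q a (t v) := by
  induction N generalizing P with
  | zero =>
    refine ⟨fun a b => P (push a (push b fun _ => 0)), fun v => v 0,
      hP.comp (g := fun _ v => push (v 0) (push (v 1) fun _ => 0))
        (Sig.T.push (Sig.T.var 0) (Sig.T.push (Sig.T.var 1) fun _ => inferInstance)),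
      inferInstance, fun a v => hN _ _ fun k hk => ?_⟩
    match k, hk with
    | 0, _ => rfl
    | 1, _ => rfl
  | succ N ih =>
    have h1 : A.fix.D IsBounded (fun _ v =>
        P (push (v 2) (push (v 1) (push (v 0) fun k => v (k + 2 + 1 + 1))))) :=
      hP.comp (g := fun _ v => push (v 2) (push (v 1) (push (v 0) fun k => v (k + 2 + 1 + 1))))
        (Sig.T.push (Sig.T.var _) (Sig.T.push (Sig.T.var _) (Sig.T.push (Sig.T.var _)
          fun _ => Sig.T.var _)))
    -- Variables `1` and `2` are replaced by one variable for their pair. Unpairing is a bounded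
    -- quantification, so the relation stays bounded.
    obtain ⟨Q, t, hQ, ht, e⟩ := ih (P := fun v => ∃ p q, v 1 = A.pair p q ∧
        P (push (v 0) (push p (push q fun k => v (k + 2))))) inferInstance (by
      intro v v' h
      have h0 := h 0 (by omega)
      have h1 := h 1 (by omega)
      simp only [h0, h1]
      refine exists_congr fun p => exists_congr fun q => and_congr_right fun _ =>
        hN _ _ fun k hk => ?_
      match k, hk with
      | 0, _ => rfl
      | 1, _ => rfl
      | 2, _ => rfl
      | k + 3, hk => exact h (k + 2) (by omega))
    refine ⟨Q, fun v => t (push (A.pair (v 0) (v 1)) fun k => v (k + 2)), hQ,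
      ht.comp (g := fun _ v => push (A.pair (v 0) (v 1)) fun k => v (k + 2))
        (Sig.T.push inferInstance fun _ => Sig.T.var _), fun a v => ?_⟩
    rw [← e]
    have e1 : ∀ p q, push (push a (push (A.pair (v 0) (v 1)) fun k => v (k + 2)) 0)
        (push p (push q fun k => push a (push (A.pair (v 0) (v 1)) fun k => v (k + 2)) (k + 2))) =
        push a (push p (push q fun k => v (k + 2))) := fun p q => rfl
    have e2 : push a (push (v 0) (push (v 1) fun k => v (k + 2))) = push a v := by
      funext k
      match k with
      | 0 => rfl
      | 1 => rfl
      | 2 => rfl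
      | k + 3 => rfl
    simp only [e1]
    constructor
    · exact fun h => ⟨v 0, v 1, rfl, e2 ▸ h⟩
    · rintro ⟨p, q, h, h'⟩
      obtain ⟨rfl, rfl⟩ := pair_inj.1 h
      exact e2 ▸ h'

/-- After contraction to one parameter the projection exists as a set, so the quantified statement
becomes the atomic formula that a term belongs to this set. -/
theorem ConnectedIndexSets.bounded_exists (h : A.ConnectedIndexSets) {P : (ℕ → A.Num) → Prop}
    (hP : A.fix.D IsBounded (fun _ v => P v)) :
    A.fix.D IsBounded (fun _ v => ∃ a : A.Num, P (push a v)) := by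
  obtain ⟨N, hN⟩ := hP.exists_support
  obtain ⟨Q, t, hQ, ht, e⟩ := exists_contraction N hP
    fun v v' hv => hN v v' fun k hk => hv k (hk.trans_le (Nat.le_add_right N 2))
  have hm := Fact.mk (h.exists_mem_sets hQ)
  have hD : A.fix.D IsBounded (fun _ v => t v ∈ {j | ∃ x, Q x j}) := Sig.D.mem
  exact Sig.D.congr hD fun _ v => exists_congr fun a => e a v

theorem bounded_sat_of_bounded {φ : Formula} (hφ : IsBounded φ) (w : ℕ → A.sets) :
    A.fix.D IsBounded (fun _ v => φ.Sat A v w) :=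
  Sig.D.of_sat (σ := A.fix) hφ (t := fun k _ v => v k) (fun _ => Sig.T.var _)
    (w := fun j _ => w j) fun _ => trivial

theorem bounded_not {P : (ℕ → A.Num) → Prop} (hP : A.fix.D IsBounded (fun _ v => P v)) :
    A.fix.D IsBounded (fun _ v => ¬ P v) :=
  Sig.D.neg (hP := hP)

theorem bounded_imp {P Q : (ℕ → A.Num) → Prop} (hP : A.fix.D IsBounded (fun _ v => P v))
    (hQ : A.fix.D IsBounded (fun _ v => Q v)) : A.fix.D IsBounded (fun _ v => P v → Q v) :=
  Sig.D.imp (hP := hP) (hQ := hQ)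

theorem ConnectedIndexSets.bounded_forall (h : A.ConnectedIndexSets) {P : (ℕ → A.Num) → Prop}
    (hP : A.fix.D IsBounded (fun _ v => P v)) :
    A.fix.D IsBounded (fun _ v => ∀ a : A.Num, P (push a v)) := by
  have h1 := bounded_not (P := fun v : ℕ → A.Num => ∃ a : A.Num, ¬ P (push a v))
    (h.bounded_exists (P := fun v : ℕ → A.Num => ¬ P v) (bounded_not (P := P) hP))
  simpa only [not_exists, not_not] using h1

/-- Every number quantifier is traded for a new set parameter, so arithmetical definability with
parameters collapses to bounded definability. -/
theorem ConnectedIndexSets.bounded_sat (h : A.ConnectedIndexSets) (w : ℕ → A.sets) {φ : Formula}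
    (hφ : IsArithmetical φ) : A.fix.D IsBounded (fun _ v => φ.Sat A v w) := by
  induction hφ with
  | eq s t => exact bounded_sat_of_bounded (.eq s t) w
  | lt s t => exact bounded_sat_of_bounded (.lt s t) w
  | mem t X => exact bounded_sat_of_bounded (.mem t X) w
  | @neg φ _ ih => exact bounded_not (P := fun v => φ.Sat A v w) ih
  | @imp φ ψ _ _ ih1 ih2 =>
    exact bounded_imp (P := fun v => φ.Sat A v w) (Q := fun v => ψ.Sat A v w) ih1 ih2
  | @all φ _ ih => exact h.bounded_forall (P := fun v => φ.Sat A v w) ih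

theorem ConnectedIndexSets.isACA0 (h : A.ConnectedIndexSets) : A.IsACA0 :=
  ⟨hA.basic, fun _ hφ v w => mem_sets_of_bounded ⟨(h.bounded_sat w hφ).comp
    (g := fun _ u => push (u 0) v) (Sig.T.push (Sig.T.var 0) fun _ => Sig.T.fix_const _)⟩⟩

end Model
end SOA

theorem mainTheorem6 :
    -- over `ACA₀`, being a connected CSCS is a `Π¹₁`-universal property
    (SOA.ConnectedIsPi11.{u} ∧ SOA.ConnectedIsPi11Hard.{u}) ∧
    -- over `ACA₀`, `Top(L)` is a CSCS, and it is connected if and only if `L` is a well order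
    (∀ A : SOA.Model.{u}, A.IsACA0 → ∀ L ∈ A.sets, ∀ R ∈ A.sets,
      A.IsLinOrd L R → A.HasLeast L R →
        (∃ U ∈ A.sets, ∃ K ∈ A.sets, A.Presents L U K (A.topL L R)) ∧
        ∀ U ∈ A.sets, ∀ K ∈ A.sets, A.Presents L U K (A.topL L R) →
          (A.IsConnectedIn L U ↔ A.IsWellOrd L R)) ∧
    -- over `RCA₀`, `Π¹₁-CA₀` is equivalent to the existence of index sets of connected CSCS
    (∀ A : SOA.Model.{u}, A.IsRCA0 → (A.IsPi11CA0 ↔ A.ConnectedIndexSets)) := by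
  refine ⟨⟨SOA.connectedIsPi11, SOA.connectedIsPi11Hard⟩, ?_, ?_⟩
  · intro A hA L hL R hR hlin hleast
    have : A.ACA := ⟨hA⟩
    have hU := SOA.Model.topU_mem_sets hL hR
    have hP := SOA.Model.presents_top hL hR hlin
    -- An arbitrary presentation is compared with the canonical one, for which connectedness is
    -- known.
    exact ⟨⟨_, hU, _, SOA.Model.topK_mem_sets hU, hP⟩, fun U _ K _ h =>
      (h.isConnectedIn_iff hP).trans (SOA.Model.isConnectedIn_top_iff hL hR hlin hleast)⟩
  · intro A hA
    have : A.Ind := hA.ind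
    exact ⟨SOA.Model.IsPi11CA0.connectedIndexSets, fun h => h.isPi11CA0 h.isACA0⟩
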